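/- All graphs are finite and simple, and graph classes are closed under isomorphism. For a graph $G$ let $\mathrm{OPT}(G)$ be the minimum size of a vertex cover of $G$. A set $Y\subseteq V(G)$ is a blocking set of $G$ if no minimum vertex cover of $G$ contains $Y$; it is minimal if no proper subset of it is a blocking set. The minimal blocking set size of a class $\mathcal C$ is the supremum of the sizes of the minimal blocking sets of graphs in $\mathcal C$. The class $\mathcal C$ is hereditary if it is closed under vertex deletion, and robust if it is closed under disjoint union and under deletion of connected components. $\mathcal C+1$ is the class of graphs $G$ with a set $W\subseteq V(G)$, $|W|\le 1$, such that $G-W\in\mathcal C$. An instance $(G,k,X)$ consists of a graph $G$, an integer $k$ (possibly negative, written in binary), and $X\subseteq V(G)$; it is a yes-instance if $G$ has a vertex cover of size at most $k$, and two instances are equivalent if both or neither are yes-instances. Reduction rule (for an integer $d \ge 0$). Let a chunk be an independent set $Z\subseteq X$ of $G$ with $1\le |Z|\le d$, let $\mathcal X$ be the set of chunks and $\mathcal F$ the set of connected components of $G-X$. Let $G_B$ be the bipartite graph on $\mathcal X$ and $\mathcal F$ in which $Z$ is adjacent to $H$ iff $N_G(Z)\cap V(H)$ is a blocking set of $H$.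 Choose $\mathcal X'\subseteq\mathcal X$ and a matching $M$ of $G_B-N_{G_B}[\mathcal X']$ between $\mathcal X\setminus\mathcal X'$ and $\mathcal F \setminus N_{G_B}(\mathcal X')$ that saturates $\mathcal X\setminus\mathcal X'$, where $\mathcal X'=\emptyset$ or $|N_{G_B}(\mathcal X')|<|\mathcal X'|$. Let $\mathcal F_D$ be the set of components that are neither in $N_{G_B}(\mathcal X')$ nor matched by $M$. Delete all components in $\mathcal F_D$ from $G$, and decrease $k$ by $\mathrm{OPT}(\mathcal F_D)$, the minimum size of a vertex cover of the union of these components. Theorem. Let $\mathcal C$ be a graph class with minimal blocking set size $d<\infty$. (1) If $\mathcal C$ is hereditary and Vertex Cover is solvable in polynomial time on $\mathcal C$, then there is a polynomial-time algorithm that, given $(G,k,X)$ with $G-X\in\mathcal C$, applies the reduction rule and returns an equivalent instance $(G',k',X)$ such that $G'-X\in\mathcal C$ and $G'-X$ has at most $|X|^d$ connected components. (2) The same holds if $\mathcal C$ is robust and Vertex Cover is solvable in polynomial time on $\mathcal C$ and on $\mathcal C+1$. (3) If $\mathcal C$ is hereditary or robust and $G-X\in\mathcal C$, then suitable $\mathcal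 X'$ and $M$ exist, and for every choice of them the resulting graph $G'=G-\bigcup_{H \in \mathcal F_D} V(H)$ satisfies: $G'-X\in\mathcal C$; for every integer $k$, $(G,k,X)$ and $(G',k-\mathrm{OPT}(\mathcal F_D),X)$ are equivalent; and $G'-X$ has at most $|X|^d$ connected components. -/

import Mathlib

namespace VCKernel

/-! ### A programming language with a step count

Programs of the textbook WHILE language (Jones, "Computability and Complexity", in its one-variable
form). The single register holds a finite binary tree. Every operation is charged the size of the
data that it copies, so a unit of cost is a bounded number of symbol operations and "polynomial
time" means the same as for Turing machines. -/

/-- Finite binary trees without labels, the data of the programs. -/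
inductive Tr : Type
  | nil : Tr
  | cons : Tr → Tr → Tr

/-- The number of nodes of a tree; it measures the length of an input. -/
def Tr.size : Tr → ℕ
  | .nil => 1
  | .cons a b => a.size + b.size + 1

/-- The left subtree (`nil` for `nil`). -/
def Tr.hd : Tr → Tr
  | .nil => .nil
  | .cons a _ => a

/-- The right subtree (`nil` for `nil`). -/
def Tr.tl : Tr → Tr
  | .nil => .nil
  | .cons _ b => b

/-- Expressions over the single register. -/
inductive Expr : Type
  | reg : Expr
  | nil : Expr
  | cons : Expr → Expr → Expr
  | hd : Expr → Expr
  | tl : Expr → Expr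

/-- The value of an expression when the register holds `s`. -/
def Expr.eval (s : Tr) : Expr → Tr
  | .reg => s
  | .nil => .nil
  | .cons a b => .cons (a.eval s) (b.eval s)
  | .hd a => (a.eval s).hd
  | .tl a => (a.eval s).tl

/-- The cost of evaluating an expression: reading the register costs the size of its content,
every other operation costs one. -/
def Expr.cost (s : Tr) : Expr → ℕ
  | .reg => s.size
  | .nil => 1
  | .cons a b => a.cost s + b.cost s + 1
  | .hd a => a.cost s + 1
  | .tl a => a.cost s + 1

/-- Programs: assignment to the register, sequencing, branching and looping (the value `nil` is
false, every other value is true). -/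
inductive Prog : Type
  | assign : Expr → Prog
  | seq : Prog → Prog → Prog
  | ite : Expr → Prog → Prog → Prog
  | while : Expr → Prog → Prog

/-- `Runs p s u t`: started with register content `s`, the program `p` halts with register
content `u`, at total cost `t`. -/
inductive Runs : Prog → Tr → Tr → ℕ → Prop
  | assign (e : Expr) (s : Tr) : Runs (.assign e) s (e.eval s) (e.cost s + 1)
  | seq {p q : Prog} {s u v : Tr} {m n : ℕ} :
      Runs p s u m → Runs q u v n → Runs (.seq p q) s v (m + n + 1)
  | ite_true {e : Expr} {p q : Prog} {s u : Tr} {m : ℕ} :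
      e.eval s ≠ .nil → Runs p s u m → Runs (.ite e p q) s u (e.cost s + m + 1)
  | ite_false {e : Expr} {p q : Prog} {s u : Tr} {m : ℕ} :
      e.eval s = .nil → Runs q s u m → Runs (.ite e p q) s u (e.cost s + m + 1)
  | while_done {e : Expr} {p : Prog} {s : Tr} :
      e.eval s = .nil → Runs (.while e p) s s (e.cost s + 1)
  | while_step {e : Expr} {p : Prog} {s u v : Tr} {m n : ℕ} :
      e.eval s ≠ .nil → Runs p s u m → Runs (.while e p) u v n →
      Runs (.while e p) s v (e.cost s + m + n + 1)

/-- Some program, run on (the code of) any input `a` that satisfies the promise `dom`, halts within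
time polynomial in the size of the code, with an output `b` such that `post a b`. -/
def PolyTime {α : Type} (enc : α → Tr) (dom : α → Prop) (post : α → Tr → Prop) : Prop :=
  ∃ (p : Prog) (q : Polynomial ℕ), ∀ a : α, dom a →
    ∃ (b : Tr) (t : ℕ), Runs p (enc a) b t ∧ t ≤ q.eval (enc a).size ∧ post a b

/-! ### Encodings: numbers in binary, graphs by adjacency matrices -/

def encBool : Bool → Tr
  | false => .nil
  | true => .cons .nil .nil

def encList {α : Type} (f : α → Tr) : List α → Tr
  | [] => .nil
  | a :: l => .cons (f a) (encList f l)

/-- Binary digits, least significant digit first. -/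
def encNat (k : ℕ) : Tr := encList encBool k.bits

/-- Sign and absolute value. -/
def encInt (k : ℤ) : Tr := .cons (encBool (decide (k < 0))) (encNat k.natAbs)

/-- The characteristic vector of a set of vertices. -/
noncomputable def encSet {n : ℕ} (X : Set (Fin n)) : Tr :=
  open Classical in encList encBool (List.ofFn fun i => decide (i ∈ X))

/-- The list of the rows of the adjacency matrix. -/
noncomputable def encGraph {n : ℕ} (G : SimpleGraph (Fin n)) : Tr :=
  encList encSet (List.ofFn fun i => G.neighborSet i)

/-! ### Vertex covers and blocking sets -/

/-- `G - X`. -/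
abbrev del {V : Type} (G : SimpleGraph V) (X : Set V) : SimpleGraph ↥Xᶜ := G.induce Xᶜ

/-- `G` has a vertex cover of size at most `k` (never true for negative `k`). -/
def HasVC {V : Type} (G : SimpleGraph V) (k : ℤ) : Prop :=
  ∃ S : Set V, S.Finite ∧ G.IsVertexCover S ∧ (S.ncard : ℤ) ≤ k

/-- The size of a minimum vertex cover, as a natural number (used for finite graphs only). -/
noncomputable def opt {V : Type} (G : SimpleGraph V) : ℕ := G.vertexCoverNum.toNat

/-- `Y` is contained in no minimum vertex cover of `G`. -/
def IsBlocking {V : Type} (G : SimpleGraph V) (Y : Set V) : Prop :=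
  ¬ ∃ S : Set V, G.IsVertexCover S ∧ S.encard = G.vertexCoverNum ∧ Y ⊆ S

/-- `Y` is a blocking set of `G`, and no proper subset of `Y` is. -/
def IsMinBlocking {V : Type} (G : SimpleGraph V) (Y : Set V) : Prop :=
  IsBlocking G Y ∧ ∀ Y' : Set V, Y' ⊂ Y → ¬ IsBlocking G Y'

/-- The size of a largest minimal blocking set of `G`. -/
noncomputable def blockingSize {V : Type} (G : SimpleGraph V) : ℕ∞ :=
  ⨆ (Y : Set V) (_ : IsMinBlocking G Y), Y.encard

/-! ### Graph classes -/

/-- A class of finite graphs, closed under isomorphism. -/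
structure GraphClass where
  Mem : ∀ {V : Type} [Finite V], SimpleGraph V → Prop
  iso : ∀ {V W : Type} [Finite V] [Finite W] {G : SimpleGraph V} {H : SimpleGraph W},
    Nonempty (G ≃g H) → Mem G → Mem H

namespace GraphClass

/-- The supremum of the sizes of all minimal blocking sets of graphs in the class. -/
noncomputable def blockingSize (C : GraphClass) : ℕ∞ :=
  ⨆ (V : Type) (_ : Finite V) (G : SimpleGraph V) (_ : C.Mem G), VCKernel.blockingSize G

/-- Closed under deletion of vertices. -/
def Hereditary (C : GraphClass) : Prop :=
  ∀ {V : Type} [Finite V] (G : SimpleGraph V) (S : Set V), C.Mem G → C.Mem (del G S)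

/-- Closed under disjoint union and under deletion of connected components. -/
def Robust (C : GraphClass) : Prop :=
  (∀ {V W : Type} [Finite V] [Finite W] (G : SimpleGraph V) (H : SimpleGraph W),
    C.Mem G → C.Mem H → C.Mem (G.sum H)) ∧
  (∀ {V : Type} [Finite V] (G : SimpleGraph V) (H : G.ConnectedComponent),
    C.Mem G → C.Mem (del G H.supp))

/-- The class `C + c` of the graphs that have at most `c` vertices whose deletion yields a graph
in `C`. -/
def plus (C : GraphClass) (c : ℕ) : GraphClass where
  Mem {V} _ G := ∃ X : Set V, X.ncard ≤ c ∧ C.Mem (del G X)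
  iso := by
    rintro V W _ _ G H ⟨e⟩ ⟨X, hX, hm⟩
    refine ⟨e.symm ⁻¹' X, ?_, C.iso ⟨?_⟩ hm⟩
    · rwa [Set.ncard_preimage_of_injective_subset_range e.symm.injective
        (by rw [e.symm.surjective.range_eq]; exact Set.subset_univ _)]
    · exact
        { toEquiv := e.toEquiv.subtypeEquiv fun a => by simp
          map_rel_iff' := e.map_rel_iff }

/-- Vertex Cover (given `G` and a natural number `k`, is there a vertex cover of size at most `k`?)
is solvable in polynomial time on the class; the program accepts by an output other than `nil`. -/
def VCPolyTime (C : GraphClass) : Prop :=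
  PolyTime (α := (n : ℕ) × SimpleGraph (Fin n) × ℕ)
    (fun a => .cons (encGraph a.2.1) (encNat a.2.2))
    (fun a => C.Mem a.2.1)
    (fun a b => b ≠ .nil ↔ HasVC a.2.1 a.2.2)

end GraphClass

/-! ### The reduction rule -/

/-- The chunks of `X`: the independent subsets of `X` with at least one and at most `d` vertices. -/
def chunks {V : Type} (G : SimpleGraph V) (X : Set V) (d : ℕ) : Set (Set V) :=
  {Z | Z ⊆ X ∧ G.IsIndepSet Z ∧ 1 ≤ Z.encard ∧ Z.encard ≤ d}

/-- The connected components of `G - X`. -/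
abbrev Comp {V : Type} (G : SimpleGraph V) (X : Set V) : Type := (del G X).ConnectedComponent

/-- Adjacency of `Z` and `H` in the bipartite graph of chunks versus components: the neighbours
of `Z` in `H` form a blocking set of `H`. -/
def Blocks {V : Type} (G : SimpleGraph V) {X : Set V} (Z : Set V) (H : Comp G X) : Prop :=
  IsBlocking H.toSimpleGraph {v | ∃ z ∈ Z, G.Adj z v.1.1}

/-- The components that are adjacent, in the bipartite graph, to a member of `A`. -/
def blockedBy {V : Type} (G : SimpleGraph V) (X : Set V) (A : Set (Set V)) : Set (Comp G X) :=
  {H | ∃ Z ∈ A, Blocks G Z H}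

/-- The structure found in the bipartite graph: a set `A` of chunks that is empty or has fewer
than `|A|` neighbours, and a matching of the other chunks into the components outside the
neighbourhood of `A`. -/
structure Crown {V : Type} (G : SimpleGraph V) (X : Set V) (d : ℕ) where
  A : Set (Set V)
  A_subset : A ⊆ chunks G X d
  deficient : A = ∅ ∨ (blockedBy G X A).ncard < A.ncard
  mate : ↥(chunks G X d \ A) → Comp G X
  mate_injective : Function.Injective mate
  mate_adj : ∀ Z, Blocks G Z.1 (mate Z)
  mate_notMem : ∀ Z, mate Z ∉ blockedBy G X A

namespace Crown

variable {V : Type} {G : SimpleGraph V} {X : Set V} {d : ℕ}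

/-- The components that are neither neighbours of `A` nor matched. -/
def discarded (K : Crown G X d) : Set (Comp G X) :=
  {H | H ∉ blockedBy G X K.A ∧ H ∉ Set.range K.mate}

/-- The vertices of the discarded components. -/
def verts (K : Crown G X d) : Set V :=
  {v | ∃ h : v ∈ Xᶜ, (del G X).connectedComponentMk ⟨v, h⟩ ∈ K.discarded}

/-- The graph that remains after deletion of the discarded components. -/
abbrev rest (K : Crown G X d) : SimpleGraph ↥K.vertsᶜ := del G K.verts

/-- The modulator `X` as a vertex set of the remaining graph. -/
def restX (_K : Crown G X d) : Set ↥_K.vertsᶜ := {v | v.1 ∈ X}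

/-- The size of a minimum vertex cover of the union of the discarded components. -/
noncomputable def savings (K : Crown G X d) : ℕ := opt (G.induce K.verts)

end Crown

/-! ### Instances and the algorithm -/

/-- An instance `(G, k, X)` of Vertex Cover with a modulator. -/
structure Instance where
  n : ℕ
  G : SimpleGraph (Fin n)
  k : ℤ
  X : Set (Fin n)

namespace Instance

noncomputable def enc (I : Instance) : Tr := .cons (encGraph I.G) (.cons (encInt I.k) (encSet I.X))

/-- `J` is (up to the numbering of the vertices) the result of applying the reduction rule to `I`:
the graph of `J` is the graph of `I` without the discarded components, the modulator
is the same, and `k` drops by the vertex cover number of the discarded components. -/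
def ReducesTo (d : ℕ) (I J : Instance) : Prop :=
  ∃ (K : Crown I.G I.X d) (f : J.G ↪g I.G),
    Set.range f = K.vertsᶜ ∧ f '' J.X = I.X ∧ J.k = I.k - K.savings

end Instance

/-- There is a polynomial-time algorithm that, given `I = (G, k, X)` with `G - X ∈ C`, applies the
reduction rule and returns `J = (G', k', X)` with `G' - X ∈ C`, equivalent to `I`, such that
`G' - X` has at most `|X| ^ d` connected components. -/
def GraphClass.ComponentReduction (C : GraphClass) (d : ℕ) : Prop :=
  PolyTime Instance.enc (fun I => C.Mem (del I.G I.X)) (fun I b => ∃ J : Instance, b = J.enc ∧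
    Instance.ReducesTo d I J ∧
    C.Mem (del J.G J.X) ∧
    (HasVC J.G J.k ↔ HasVC I.G I.k) ∧
    Nat.card (Comp J.G J.X) ≤ I.X.ncard ^ d)

end VCKernel

/-!
The theorem has a combinatorial half and an algorithmic half.

**The reduction rule.** Let `K : Crown G X d` be a choice of the data of the rule.

* *Safety.* The inequality `opt G ≤ opt K.rest + K.savings` (`Crown.opt_le_opt_rest_add_savings`) is
  the one with content. Take an optimal cover `R` of the remaining graph and add to it one vertex of
  each chunk outside `K.A` that avoids `R`. Afterwards the uncovered part `U` of `X` blocks no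
  component outside the neighbourhood of `K.A`: otherwise some chunk inside `U` would already block
  it (`exists_chunk_blocks`: shrink the blocking set to a minimal one, which has at most `d`
  elements, and choose a neighbour in `U` for each of them). So every such component, discarded or
  matched, can be given a minimum vertex cover that contains all its neighbours of `U`. This pays
  for the added vertices: if a chunk avoids `R`, then on the component matched to it `R` contains
  the neighbours of the chunk, a blocking set, and is not optimal there.
* *Few components.* Every remaining component is a neighbour of `K.A` or is matched, so their number
  is at most the number of chunks, and there are at most `|X| ^ d` chunks (`ncard_chunks_le`).
* *Existence.* The components are auctioned off among the chunks. A chunk that has to buy takes a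
  cheapest adjacent component, raises its price by one and displaces its owner; it gives up when all
  its neighbours have reached the price `L`, a number greater than the number of components. If
  nobody gives up, every chunk ends up matched and `K.A` is empty. Otherwise, some price `ℓ < L` does
  not occur in the end, and the chunks all of whose neighbours cost more than `ℓ` form the set
  `K.A`: the owners of components above `ℓ` belong to it, and so do the chunks that gave up, which
  makes it deficient. The other chunks own components below `ℓ`. In both cases the discarded
  components are those of price `0` (`AuctionInv.exists_matching`).

**Polynomial time.** Programs have a single register and so no natural notion of subroutine.
`Prog.onHd` lets a program work on the left half of the register, and from this the class `PolyOn`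
of functions computable in polynomial time on a promise domain gets its closure properties:
composition, pairing, branching and, above all, `PolyOn.foldl`, loops over a list whose
intermediate states stay polynomially bounded. The algorithm is then a composition of functions on
lists; graphs are lists of rows (`mat`) and vertex sets are characteristic vectors (`row`). The
vertex cover number of a graph is found by asking the decision procedure of the class for every
`k` less than the number of vertices (`vcOpt`). A blocking set `Y` of `H` is recognized by comparing
vertex cover numbers: `Y` blocks iff `opt H < opt (H - Y) + |Y|` (`isBlocking_iff_opt_del`), which
stays in a hereditary class, and also iff adding a vertex with neighbourhood `Y` increases the
vertex cover number (`isBlocking_iff_opt_addVertex`), which needs the class `C + 1` only. The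
auction makes polynomially many steps, since each step raises a price or makes a chunk give up.
-/

namespace VCKernel

/-! ### Cost of programs, and running a program on a part of the register -/

theorem Tr.size_pos (s : Tr) : 1 ≤ s.size := by cases s <;> simp [Tr.size]

theorem Tr.hd_size_le (s : Tr) : s.hd.size ≤ s.size := by
  cases s <;> simp [Tr.size, Tr.hd]; omega

theorem Tr.tl_size_le (s : Tr) : s.tl.size ≤ s.size := by
  cases s <;> simp [Tr.size, Tr.tl]; omega

theorem Expr.eval_size_le (s : Tr) (e : Expr) : (e.eval s).size ≤ e.cost s := by
  induction e with
  | reg => exact le_rfl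
  | nil => exact le_rfl
  | cons a b ha hb => simp only [Expr.eval, Expr.cost, Tr.size]; omega
  | hd a ha => exact (Tr.hd_size_le _).trans (by simp only [Expr.cost]; omega)
  | tl a ha => exact (Tr.tl_size_le _).trans (by simp only [Expr.cost]; omega)

/-- The number of nodes of an expression. -/
def Expr.len : Expr → ℕ
  | .reg => 1
  | .nil => 1
  | .cons a b => a.len + b.len + 1
  | .hd a => a.len + 1
  | .tl a => a.len + 1

theorem Expr.cost_le (s : Tr) (e : Expr) : e.cost s ≤ e.len * s.size := by
  have hs := s.size_pos
  induction e with
  | reg => simp [Expr.cost, Expr.len]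
  | nil => simpa [Expr.cost, Expr.len] using hs
  | cons a b ha hb => simp only [Expr.cost, Expr.len]; nlinarith
  | hd a ha => simp only [Expr.cost, Expr.len]; nlinarith
  | tl a ha => simp only [Expr.cost, Expr.len]; nlinarith

theorem Runs.size_le {p : Prog} {s u : Tr} {t : ℕ} (h : Runs p s u t) : u.size ≤ s.size + t := by
  induction h with
  | assign e s => have := e.eval_size_le s; omega
  | seq _ _ h1 h2 => omega
  | ite_true _ _ h => omega
  | ite_false _ _ h => omega
  | while_done _ => omega
  | while_step _ _ _ h1 h2 => omega

/-- The expression `e` applied to the left subtree of the register. -/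
def Expr.onHd : Expr → Expr
  | .reg => .hd .reg
  | .nil => .nil
  | .cons a b => .cons a.onHd b.onHd
  | .hd a => .hd a.onHd
  | .tl a => .tl a.onHd

theorem Expr.onHd_eval (s r : Tr) (e : Expr) : e.onHd.eval (.cons s r) = e.eval s := by
  induction e <;> simp_all [Expr.onHd, Expr.eval, Tr.hd]

theorem Expr.onHd_cost (s r : Tr) (e : Expr) :
    e.onHd.cost (.cons s r) ≤ e.cost s * (r.size + 3) := by
  have hs := s.size_pos
  induction e with
  | reg => simp only [Expr.onHd, Expr.cost, Tr.size]; nlinarith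
  | nil => simp [Expr.onHd, Expr.cost]
  | cons a b ha hb => simp only [Expr.onHd, Expr.cost]; nlinarith
  | hd a ha => simp only [Expr.onHd, Expr.cost]; nlinarith
  | tl a ha => simp only [Expr.onHd, Expr.cost]; nlinarith

/-- The program `p` run on the left subtree of the register; the right subtree is kept. This makes
up for the missing further registers. -/
def Prog.onHd : Prog → Prog
  | .assign e => .assign (.cons e.onHd (.tl .reg))
  | .seq p q => .seq p.onHd q.onHd
  | .ite e p q => .ite e.onHd p.onHd q.onHd
  | .while e p => .while e.onHd p.onHd

theorem Runs.onHd {p : Prog} {s u : Tr} {t : ℕ} (h : Runs p s u t) (r : Tr) :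
    ∀ B, s.size + t + r.size + 6 ≤ B →
      ∃ t', Runs p.onHd (.cons s r) (.cons u r) t' ∧ t' ≤ t * B := by
  induction h with
  | assign e s =>
    intro B hB
    refine ⟨(Expr.cons e.onHd (.tl .reg)).cost (.cons s r) + 1, ?_, ?_⟩
    · have := Runs.assign (.cons e.onHd (.tl .reg)) (.cons s r)
      simpa only [Expr.eval, Expr.onHd_eval, Tr.tl, Prog.onHd] using this
    · have := e.onHd_cost s r
      simp only [Expr.cost, Tr.size]
      have h1 : e.cost s * (r.size + 3) ≤ e.cost s * B := Nat.mul_le_mul_left _ (by omega)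
      nlinarith
  | @seq p q s u v m n hp hq h1 h2 =>
    intro B hB
    have := hp.size_le
    obtain ⟨t1, r1, b1⟩ := h1 B (by omega)
    obtain ⟨t2, r2, b2⟩ := h2 B (by omega)
    exact ⟨_, .seq r1 r2, by nlinarith⟩
  | @ite_true e p q s u m he hp h1 =>
    intro B hB
    obtain ⟨t1, r1, b1⟩ := h1 B (by omega)
    have := e.onHd_cost s r
    have h1 : e.cost s * (r.size + 3) ≤ e.cost s * B := Nat.mul_le_mul_left _ (by omega)
    exact ⟨_, .ite_true (by rwa [Expr.onHd_eval]) r1, by nlinarith⟩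
  | @ite_false e p q s u m he hp h1 =>
    intro B hB
    obtain ⟨t1, r1, b1⟩ := h1 B (by omega)
    have := e.onHd_cost s r
    have h1 : e.cost s * (r.size + 3) ≤ e.cost s * B := Nat.mul_le_mul_left _ (by omega)
    exact ⟨_, .ite_false (by rwa [Expr.onHd_eval]) r1, by nlinarith⟩
  | @while_done e p s he =>
    intro B hB
    have := e.onHd_cost s r
    have h1 : e.cost s * (r.size + 3) ≤ e.cost s * B := Nat.mul_le_mul_left _ (by omega)
    exact ⟨_, .while_done (by rwa [Expr.onHd_eval]), by nlinarith⟩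
  | @while_step e p s u v m n he hp hq h1 h2 =>
    intro B hB
    have := hp.size_le
    obtain ⟨t1, r1, b1⟩ := h1 B (by omega)
    obtain ⟨t2, r2, b2⟩ := h2 B (by omega)
    have := e.onHd_cost s r
    have h1 : e.cost s * (r.size + 3) ≤ e.cost s * B := Nat.mul_le_mul_left _ (by omega)
    exact ⟨_, .while_step (by rwa [Expr.onHd_eval]) r1 r2, by nlinarith⟩

/-! ### Functions computable in polynomial time -/

/-- Types whose elements are coded by trees. -/
class TreeCode (α : Type) where
  /-- The code of an element. -/
  enc : α → Tr

open TreeCode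

instance : TreeCode Bool := ⟨encBool⟩
instance : TreeCode Unit := ⟨fun _ => .nil⟩
instance {α β : Type} [TreeCode α] [TreeCode β] : TreeCode (α × β) :=
  ⟨fun x => .cons (enc x.1) (enc x.2)⟩
instance {α : Type} [TreeCode α] : TreeCode (List α) := ⟨encList enc⟩
instance {α : Type} [TreeCode α] : TreeCode (Option α) :=
  ⟨fun x => x.elim .nil fun a => .cons (enc a) .nil⟩

/-- The size of the code. -/
def sz {α : Type} [TreeCode α] (a : α) : ℕ := (enc a).size

variable {α β γ σ : Type} [TreeCode α] [TreeCode β] [TreeCode γ] [TreeCode σ]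

theorem enc_prod (a : α) (b : β) : enc (a, b) = .cons (enc a) (enc b) := rfl
theorem enc_nil : enc ([] : List α) = .nil := rfl
theorem enc_cons (a : α) (l : List α) : enc (a :: l) = .cons (enc a) (enc l) := rfl
theorem enc_true : enc true = .cons .nil .nil := rfl
theorem enc_false : enc false = .nil := rfl

theorem sz_pos (a : α) : 1 ≤ sz a := Tr.size_pos _
theorem sz_prod (a : α) (b : β) : sz (a, b) = sz a + sz b + 1 := rfl
theorem sz_nil : sz ([] : List α) = 1 := rfl
theorem sz_cons (a : α) (l : List α) : sz (a :: l) = sz a + sz l + 1 := rfl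
theorem sz_none : sz (none : Option α) = 1 := rfl
theorem sz_some (a : α) : sz (some a) = sz a + 2 := rfl
theorem sz_bool (b : Bool) : sz b ≤ 3 := by cases b <;> decide
theorem sz_unit (b : Unit) : sz b = 1 := rfl

theorem sz_append (l m : List α) : sz (l ++ m) + 1 = sz l + sz m := by
  induction l with
  | nil => simp [sz_nil]; omega
  | cons a l ih => simp only [List.cons_append, sz_cons]; omega

theorem length_le_sz (l : List α) : 2 * l.length + 1 ≤ sz l := by
  induction l with
  | nil => simp [sz_nil]
  | cons a l ih => simp only [List.length_cons, sz_cons]; have := sz_pos a; omega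

theorem sz_reverse (l : List α) : sz l.reverse = sz l := by
  induction l with
  | nil => rfl
  | cons a l ih =>
    have := sz_append l.reverse [a]
    simp only [List.reverse_cons, sz_cons, sz_nil] at *; omega

theorem sz_le_of_mem {a : α} {l : List α} (h : a ∈ l) : sz a ≤ sz l := by
  induction l with
  | nil => simp at h
  | cons b l ih =>
    rw [sz_cons]
    rcases List.mem_cons.1 h with rfl | h
    · omega
    · have := ih h; omega

theorem sz_le_of_forall (l : List α) (M : ℕ) (h : ∀ a ∈ l, sz a ≤ M) :
    sz l ≤ l.length * (M + 1) + 1 := by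
  induction l with
  | nil => simp [sz_nil]
  | cons a l ih =>
    have h1 := h a (by simp)
    have h2 := ih fun b hb => h b (by simp [hb])
    simp only [List.length_cons, sz_cons]; nlinarith

theorem sz_sublist {l m : List α} (h : l.Sublist m) : sz l ≤ sz m := by
  induction h with
  | slnil => exact le_rfl
  | cons a _ ih => rw [sz_cons]; omega
  | cons_cons a _ ih => rw [sz_cons, sz_cons]; omega

theorem eval_mono (q : Polynomial ℕ) {m n : ℕ} (h : m ≤ n) : q.eval m ≤ q.eval n := by
  rw [Polynomial.eval_eq_sum_range, Polynomial.eval_eq_sum_range]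
  gcongr

/-- The numbers `g a` are bounded by a polynomial in the size of the code of `a`. -/
def PolyBdd (D : α → Prop) (g : α → ℕ) : Prop :=
  ∃ q : Polynomial ℕ, ∀ a, D a → g a ≤ q.eval (sz a)

/-- The function `f` is computable in polynomial time on the inputs that satisfy the promise `D`. -/
def PolyOn (D : α → Prop) (f : α → β) : Prop :=
  ∃ (p : Prog) (g : α → ℕ), PolyBdd D g ∧
    ∀ a, D a → ∃ t, Runs p (enc a) (enc (f a)) t ∧ t ≤ g a

namespace PolyBdd

variable {D E : α → Prop} {g h : α → ℕ}

theorem mono (hg : PolyBdd D g) (H : ∀ a, D a → h a ≤ g a) : PolyBdd D h := by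
  obtain ⟨q, hq⟩ := hg
  exact ⟨q, fun a ha => (H a ha).trans (hq a ha)⟩

theorem weaken (hg : PolyBdd D g) (H : ∀ a, E a → D a) : PolyBdd E g := by
  obtain ⟨q, hq⟩ := hg
  exact ⟨q, fun a ha => hq a (H a ha)⟩

theorem const (n : ℕ) : PolyBdd D fun _ => n := ⟨Polynomial.C n, fun a _ => by simp⟩

theorem id : PolyBdd D (sz (α := α)) := ⟨Polynomial.X, fun a _ => by simp⟩

theorem add (hg : PolyBdd D g) (hh : PolyBdd D h) : PolyBdd D fun a => g a + h a := by
  obtain ⟨q, hq⟩ := hg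
  obtain ⟨r, hr⟩ := hh
  exact ⟨q + r, fun a ha => by simpa using Nat.add_le_add (hq a ha) (hr a ha)⟩

theorem mul (hg : PolyBdd D g) (hh : PolyBdd D h) : PolyBdd D fun a => g a * h a := by
  obtain ⟨q, hq⟩ := hg
  obtain ⟨r, hr⟩ := hh
  exact ⟨q * r, fun a ha => by simpa using Nat.mul_le_mul (hq a ha) (hr a ha)⟩

theorem pow (hg : PolyBdd D g) (n : ℕ) : PolyBdd D fun a => g a ^ n := by
  obtain ⟨q, hq⟩ := hg
  exact ⟨q ^ n, fun a ha => by simpa using Nat.pow_le_pow_left (hq a ha) n⟩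

theorem eval (hg : PolyBdd D g) (q : Polynomial ℕ) : PolyBdd D fun a => q.eval (g a) := by
  obtain ⟨r, hr⟩ := hg
  exact ⟨q.comp r, fun a ha => by simpa using eval_mono q (hr a ha)⟩

end PolyBdd

namespace PolyOn

variable {D E : α → Prop} {f : α → β}

theorem weaken (hf : PolyOn D f) (H : ∀ a, E a → D a) : PolyOn E f := by
  obtain ⟨p, g, hg, h⟩ := hf
  exact ⟨p, g, hg.weaken H, fun a ha => h a (H a ha)⟩

theorem congr {f' : α → β} (hf : PolyOn D f) (H : ∀ a, D a → f a = f' a) : PolyOn D f' := by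
  obtain ⟨p, g, hg, h⟩ := hf
  exact ⟨p, g, hg, fun a ha => H a ha ▸ h a ha⟩

theorem sz_bdd (hf : PolyOn D f) : PolyBdd D fun a => sz (f a) := by
  obtain ⟨p, g, hg, h⟩ := hf
  refine (PolyBdd.id.add hg).mono fun a ha => ?_
  obtain ⟨t, hr, ht⟩ := h a ha
  have := hr.size_le
  unfold sz; omega

theorem of_expr (e : Expr) (h : ∀ a, D a → e.eval (enc a) = enc (f a)) : PolyOn D f := by
  refine ⟨.assign e, fun a => e.len * sz a + 1,
    ((PolyBdd.const _).mul .id).add (.const 1), fun a ha => ?_⟩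
  have := e.cost_le (enc a)
  exact ⟨e.cost (enc a) + 1, h a ha ▸ Runs.assign e _, by simp only [sz]; omega⟩

theorem comp {E : β → Prop} {g : β → γ} (hg : PolyOn E g) (hf : PolyOn D f)
    (H : ∀ a, D a → E (f a)) : PolyOn D fun a => g (f a) := by
  have hs := hf.sz_bdd
  obtain ⟨p, b, hb, hp⟩ := hf
  obtain ⟨q, c, ⟨r, hr⟩, hq⟩ := hg
  refine ⟨.seq p q, fun a => b a + r.eval (sz (f a)) + 1,
    (hb.add (hs.eval r)).add (.const 1), fun a ha => ?_⟩
  obtain ⟨t1, r1, b1⟩ := hp a ha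
  obtain ⟨t2, r2, b2⟩ := hq (f a) (H a ha)
  have := hr _ (H a ha)
  exact ⟨_, .seq r1 r2, by simp only; omega⟩

theorem id : PolyOn D fun a => a := of_expr .reg fun _ _ => rfl

theorem const_bool (b : Bool) : PolyOn D fun _ => b := by
  cases b
  · exact of_expr .nil fun _ _ => rfl
  · exact of_expr (.cons .nil .nil) fun _ _ => rfl

theorem const_nil : PolyOn D fun _ => ([] : List β) := of_expr .nil fun _ _ => rfl
theorem const_none : PolyOn D fun _ => (none : Option β) := of_expr .nil fun _ _ => rfl
theorem const_unit : PolyOn D fun _ => () := of_expr .nil fun _ _ => rfl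

/-- A program for `f` also runs on the first component of a pair. -/
theorem first (hf : PolyOn D f) :
    PolyOn (fun x : α × γ => D x.1) fun x => (f x.1, x.2) := by
  obtain ⟨p, g, ⟨q, hq⟩, h⟩ := hf
  refine ⟨p.onHd, fun x => q.eval (sz x) * (sz x + q.eval (sz x) + 6),
    (PolyBdd.id.eval q).mul ((PolyBdd.id.add (PolyBdd.id.eval q)).add (.const 6)), ?_⟩
  rintro ⟨a, c⟩ ha
  obtain ⟨t, hr, ht⟩ := h a ha
  have h1 : t ≤ q.eval (sz (a, c)) :=
    (ht.trans (hq a ha)).trans (eval_mono q (by rw [sz_prod]; omega))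
  obtain ⟨t', hr', ht'⟩ := hr.onHd (enc c) (sz (a, c) + q.eval (sz (a, c)) + 6)
    (by rw [sz_prod] at *; simp only [sz] at *; omega)
  exact ⟨t', hr', ht'.trans (Nat.mul_le_mul_right _ h1)⟩

theorem pair {g : α → γ} (hf : PolyOn D f) (hg : PolyOn D g) :
    PolyOn D fun a => (f a, g a) := by
  have dup : PolyOn D fun a => (a, a) := of_expr (.cons .reg .reg) fun _ _ => rfl
  have h1 : PolyOn D fun a => (f a, a) := (hf.first (γ := α)).comp dup fun a ha => ha
  have h2 : PolyOn D fun a => (a, f a) :=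
    (of_expr (D := fun _ => True) (f := fun x : β × α => (x.2, x.1))
      (.cons (.tl .reg) (.hd .reg)) fun _ _ => rfl).comp h1 fun _ _ => trivial
  have h3 : PolyOn D fun a => (g a, f a) := (hg.first (γ := β)).comp h2 fun a ha => ha
  exact (of_expr (D := fun _ => True) (f := fun x : γ × β => (x.2, x.1))
      (.cons (.tl .reg) (.hd .reg)) fun _ _ => rfl).comp h3 fun _ _ => trivial

theorem fst {f : α → β × γ} (hf : PolyOn D f) : PolyOn D fun a => (f a).1 :=
  (of_expr (D := fun _ => True) (f := fun x : β × γ => x.1) (.hd .reg)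
    fun _ _ => rfl).comp hf fun _ _ => trivial

theorem snd {f : α → β × γ} (hf : PolyOn D f) : PolyOn D fun a => (f a).2 :=
  (of_expr (D := fun _ => True) (f := fun x : β × γ => x.2) (.tl .reg)
    fun _ _ => rfl).comp hf fun _ _ => trivial

theorem cons {g : α → List β} (hf : PolyOn D f) (hg : PolyOn D g) :
    PolyOn D fun a => f a :: g a :=
  (of_expr (D := fun _ => True) (f := fun x : β × List β => x.1 :: x.2) .reg
    fun _ _ => rfl).comp (hf.pair hg) fun _ _ => trivial

theorem tail {f : α → List β} (hf : PolyOn D f) : PolyOn D fun a => (f a).tail :=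
  (of_expr (D := fun _ => True) (f := fun x : List β => x.tail) (.tl .reg)
    fun x _ => by cases x <;> rfl).comp hf fun _ _ => trivial

theorem some (hf : PolyOn D f) : PolyOn D fun a => Option.some (f a) :=
  (of_expr (D := fun _ => True) (f := fun x : β => Option.some x) (.cons .reg .nil)
    fun _ _ => rfl).comp hf fun _ _ => trivial

/-- Branching on a test whose outcome is read off from a tree. -/
theorem branch {τ : Type} [TreeCode τ] {c : α → τ} {P : α → Prop} {f' : α → β}
    (hc : PolyOn D c) (hP : ∀ a, D a → (P a ↔ enc (c a) ≠ .nil))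
    (hf : PolyOn (fun a => D a ∧ P a) f) (hf' : PolyOn (fun a => D a ∧ ¬ P a) f')
    {h : α → β} (h1 : ∀ a, D a → P a → h a = f a) (h2 : ∀ a, D a → ¬ P a → h a = f' a) :
    PolyOn D h := by
  have h0 : PolyOn D fun a => (c a, a) := hc.pair .id
  have hs := h0.sz_bdd
  obtain ⟨p, b, hb, hp⟩ := h0
  obtain ⟨p1, g1, ⟨q1, hq1⟩, hp1⟩ := hf
  obtain ⟨p2, g2, ⟨q2, hq2⟩, hp2⟩ := hf'
  refine ⟨.seq p (.ite (.hd .reg) (.seq (.assign (.tl .reg)) p1) (.seq (.assign (.tl .reg)) p2)),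
    fun a => b a + (sz (c a, a) + sz (c a, a) + (q1.eval (sz a) + q2.eval (sz a)) + 10),
    hb.add ((((hs.add hs)).add ((PolyBdd.id.eval _).add (PolyBdd.id.eval _))).add (.const 10)), ?_⟩
  intro a ha
  obtain ⟨t, r, ht⟩ := hp a ha
  have ra : Runs (.assign (.tl .reg)) (enc (c a, a)) (enc a) (sz (c a, a) + 2) :=
    .assign (.tl .reg) (enc (c a, a))
  by_cases hPa : P a
  · obtain ⟨t1, r1, b1⟩ := hp1 a ⟨ha, hPa⟩
    have := hq1 a ⟨ha, hPa⟩
    have e1 : (Expr.hd .reg).eval (enc (c a, a)) ≠ .nil := (hP a ha).1 hPa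
    refine ⟨_, .seq r (.ite_true e1 (.seq ra (by rw [h1 a ha hPa]; exact r1))), ?_⟩
    simp only [Expr.cost]
    change t + (sz (c a, a) + 1 + _ + 1) + 1 ≤ _
    omega
  · obtain ⟨t1, r1, b1⟩ := hp2 a ⟨ha, hPa⟩
    have := hq2 a ⟨ha, hPa⟩
    have e1 : (Expr.hd .reg).eval (enc (c a, a)) = .nil := by
      by_contra e; exact hPa ((hP a ha).2 e)
    refine ⟨_, .seq r (.ite_false e1 (.seq ra (by rw [h2 a ha hPa]; exact r1))), ?_⟩
    simp only [Expr.cost]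
    change t + (sz (c a, a) + 1 + _ + 1) + 1 ≤ _
    omega

theorem ite {c : α → Bool} {f' : α → β} (hc : PolyOn D c)
    (hf : PolyOn (fun a => D a ∧ c a = true) f) (hf' : PolyOn (fun a => D a ∧ ¬ c a = true) f') :
    PolyOn D fun a => if c a = true then f a else f' a :=
  branch (P := fun a => c a = true) hc
    (fun a _ => by cases c a <;> simp [enc_true, enc_false]) hf hf'
    (fun a _ h => by simp [h]) (fun a _ h => by simp [h])

theorem not {c : α → Bool} (hc : PolyOn D c) : PolyOn D fun a => !c a :=
  (hc.ite (const_bool false) (const_bool true)).congr fun a _ => by cases c a <;> rfl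

theorem and {b c : α → Bool} (hb : PolyOn D b) (hc : PolyOn D c) : PolyOn D fun a => b a && c a :=
  (hb.ite (hc.weaken fun _ h => h.1) (const_bool false)).congr fun a _ => by cases b a <;> rfl

theorem or {b c : α → Bool} (hb : PolyOn D b) (hc : PolyOn D c) : PolyOn D fun a => b a || c a :=
  (hb.ite (const_bool true) (hc.weaken fun _ h => h.1)).congr fun a _ => by cases b a <;> rfl

theorem isEmpty {l : α → List β} (hl : PolyOn D l) : PolyOn D fun a => (l a).isEmpty :=
  branch (P := fun a => l a ≠ []) hl
    (fun a _ => by cases l a <;> simp [enc_cons, enc_nil]) (const_bool false) (const_bool true)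
    (fun a _ h => by cases hl : l a <;> simp_all) (fun a _ h => by simp_all)

theorem list_cases {l : α → List β} {f : α → γ} {g : α → β → List β → γ} {E : α × β × List β → Prop}
    (hl : PolyOn D l) (hf : PolyOn (fun a => D a ∧ l a = []) f)
    (hg : PolyOn E fun x => g x.1 x.2.1 x.2.2)
    (hE : ∀ a b m, D a → l a = b :: m → E (a, b, m)) {h : α → γ}
    (h1 : ∀ a, D a → l a = [] → h a = f a)
    (h2 : ∀ a b m, D a → l a = b :: m → h a = g a b m) : PolyOn D h := by
  by_cases hne : Nonempty β
  · obtain ⟨b0⟩ := hne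
    have hx : PolyOn (fun a => D a ∧ ¬ l a = []) fun a => (a, (l a).headD b0, (l a).tail) := by
      refine (of_expr (D := fun x : α × List β => x.2 ≠ [])
        (f := fun x => (x.1, x.2.headD b0, x.2.tail)) .reg ?_).comp
        (PolyOn.id.pair (hl.weaken fun a h => h.1)) fun a h => h.2
      rintro ⟨a, _ | ⟨b, m⟩⟩ h
      · simp at h
      · rfl
    have hy := hg.comp hx fun a ⟨ha, hn⟩ => hE _ _ _ ha (by cases hl : l a <;> simp_all)
    refine branch (P := fun a => ¬ l a = []) hl
      (fun a _ => by cases l a <;> simp [enc_cons, enc_nil]) hy (hf.weaken fun a h => ?_) ?_ ?_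
    · simpa using h
    · intro a ha hn; refine h2 a _ _ ha ?_; cases hl : l a <;> simp_all
    · intro a ha hn; exact h1 a ha (by simpa using hn)
  · have h0 : ∀ a, l a = [] := fun a => by
      cases hl : l a with
      | nil => rfl
      | cons b m => exact (hne ⟨b⟩).elim
    exact (hf.weaken fun a h => ⟨h, h0 a⟩).congr fun a ha => (h1 a ha (h0 a)).symm

theorem option_cases {l : α → Option β} {f : α → γ} {g : α → β → γ} {E : α × β → Prop}
    (hl : PolyOn D l) (hf : PolyOn (fun a => D a ∧ l a = none) f)
    (hg : PolyOn E fun x => g x.1 x.2)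
    (hE : ∀ a b, D a → l a = Option.some b → E (a, b)) {h : α → γ}
    (h1 : ∀ a, D a → l a = none → h a = f a)
    (h2 : ∀ a b, D a → l a = Option.some b → h a = g a b) : PolyOn D h := by
  have hl' : PolyOn D fun a => (l a).toList :=
    (of_expr (D := fun _ => True) (f := fun x : Option β => x.toList) .reg
      fun x _ => by cases x <;> rfl).comp hl fun _ _ => trivial
  refine list_cases (E := fun x => E (x.1, x.2.1)) (g := fun a b _ => g a b) hl'
    (hf.weaken fun a h => ⟨h.1, by simpa using h.2⟩)
    (hg.comp (PolyOn.id.fst.pair PolyOn.id.snd.fst) fun _ h => h) ?_ ?_ ?_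
  · intro a b m ha h; exact hE a b ha (by cases hx : l a <;> simp_all)
  · intro a ha h; exact h1 a ha (by simpa using h)
  · intro a b m ha h; exact h2 a b ha (by cases hx : l a <;> simp_all)

/-- Loops over a list, provided that all intermediate states have polynomial size. -/
theorem foldl {l : α → List β} {i : α → σ} {step : α → σ → β → σ} {E : α × σ × β → Prop}
    {g : α → ℕ} (hl : PolyOn D l) (hi : PolyOn D i)
    (hs : PolyOn E fun x => step x.1 x.2.1 x.2.2)
    (hE : ∀ a p b r, D a → l a = p ++ b :: r → E (a, p.foldl (step a) (i a), b))
    (hg : PolyBdd D g)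
    (hB : ∀ a p r, D a → l a = p ++ r → sz (p.foldl (step a) (i a)) ≤ g a) :
    PolyOn D fun a => (l a).foldl (step a) (i a) := by
  let body : PolyOn (fun x : List β × σ × α => ∃ b m, x.1 = b :: m ∧ E (x.2.2, x.2.1, b))
      fun x => (x.1.tail, x.1.head?.elim x.2.1 (step x.2.2 x.2.1), x.2.2) := by
    by_cases hne : Nonempty β
    swap
    · refine PolyOn.id.congr ?_
      rintro _ ⟨b, _⟩
      exact (hne ⟨b⟩).elim
    obtain ⟨b0⟩ := hne
    have h1 : PolyOn (fun x : List β × σ × α => ∃ b m, x.1 = b :: m ∧ E (x.2.2, x.2.1, b))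
        fun x => ((x.2.2, x.2.1, x.1.headD b0), x.1.tail, x.2.2) := by
      refine of_expr (.cons (.cons (.tl (.tl .reg)) (.cons (.hd (.tl .reg)) (.hd (.hd .reg))))
        (.cons (.tl (.hd .reg)) (.tl (.tl .reg)))) ?_
      rintro ⟨l, s, a⟩ ⟨b, m, rfl, _⟩
      rfl
    have h2 := (hs.first (γ := List β × α)).comp h1 (by
      rintro ⟨l, s, a⟩ ⟨b, m, rfl, h⟩
      exact h)
    have h3 := (of_expr (D := fun _ => True)
      (f := fun x : σ × List β × α => (x.2.1, x.1, x.2.2))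
      (.cons (.hd (.tl .reg)) (.cons (.hd .reg) (.tl (.tl .reg)))) fun _ _ => rfl).comp h2
      fun _ _ => trivial
    refine h3.congr ?_
    rintro ⟨l, s, a⟩ ⟨b, m, rfl, h⟩
    rfl
  have h0 : PolyOn D fun a => (l a, i a, a) := hl.pair (hi.pair .id)
  have hls := hl.sz_bdd
  obtain ⟨p0, b0, hb0, hp0⟩ := h0
  obtain ⟨p1, b1, ⟨q1, hq1⟩, hp1⟩ := body
  let N : α → ℕ := fun a => sz (l a) + (g a + sz a) + 2
  have hN : PolyBdd D N := (hls.add (hg.add .id)).add (.const 2)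
  refine ⟨.seq p0 (.seq (.while (.hd .reg) p1) (.assign (.hd (.tl .reg)))),
    fun a => b0 a + (sz (l a) * (N a + q1.eval (N a) + 2) + N a + 2 + (N a + 3) + 2),
    hb0.add ((((hls.mul ((hN.add (hN.eval q1)).add (.const 2))).add hN).add (.const 2)).add
      (hN.add (.const 3)) |>.add (.const 2)), fun a ha => ?_⟩
  have hloop : ∀ r p, l a = p ++ r → ∃ t,
      Runs (.while (.hd .reg) p1) (enc (r, p.foldl (step a) (i a), a))
        (enc (([] : List β), (l a).foldl (step a) (i a), a)) t ∧
      t ≤ r.length * (N a + q1.eval (N a) + 2) + N a + 2 := by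
    intro r
    have hsz : ∀ p r, l a = p ++ r → sz (r, p.foldl (step a) (i a), a) ≤ N a := by
      intro p r h
      have := hB a p r ha h
      have h3 := sz_append p r
      have h4 := sz_pos p
      have h5 := sz_pos r
      rw [← h] at h3
      simp only [sz_prod, N]; omega
    induction r with
    | nil =>
      intro p h
      have hs := hsz _ _ h
      rw [List.append_nil] at h
      subst h
      refine ⟨_, .while_done rfl, ?_⟩
      simp only [Expr.cost]
      change sz _ + 1 + 1 ≤ _
      simp only [List.length_nil]; omega
    | cons b r ih =>
      intro p h
      have hs := hsz _ _ h
      obtain ⟨t1, r1, ht1⟩ := hp1 (b :: r, p.foldl (step a) (i a), a) ⟨b, r, rfl, hE a p b r ha h⟩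
      have hq := hq1 (b :: r, p.foldl (step a) (i a), a) ⟨b, r, rfl, hE a p b r ha h⟩
      obtain ⟨t2, r2, ht2⟩ := ih (p ++ [b]) (by simpa using h)
      have hq' := eval_mono q1 hs
      rw [List.foldl_append] at r2
      refine ⟨_, .while_step (by simp [Expr.eval, enc_prod, enc_cons, Tr.hd]) r1 r2, ?_⟩
      simp only [Expr.cost]
      change sz _ + 1 + t1 + t2 + 1 ≤ _
      simp only [List.length_cons]
      have : t1 ≤ q1.eval (N a) := by omega
      nlinarith
  obtain ⟨t0, r0, ht0⟩ := hp0 a ha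
  obtain ⟨t1, r1, ht1⟩ := hloop (l a) [] rfl
  have hlen := length_le_sz (l a)
  have hfin : sz (([] : List β), (l a).foldl (step a) (i a), a) ≤ N a := by
    have := hB a (l a) [] ha (by simp)
    simp only [sz_prod, sz_nil, N]; omega
  have h6 : (l a).length * (N a + q1.eval (N a) + 2) ≤ sz (l a) * (N a + q1.eval (N a) + 2) :=
    Nat.mul_le_mul_right _ (by omega)
  refine ⟨_, .seq r0 (.seq r1 (.assign (.hd (.tl .reg)) _)), ?_⟩
  simp only [Expr.cost]
  change t0 + (t1 + (sz (([] : List β), (l a).foldl (step a) (i a), a) + 1 + 1 + 1) + 1) + 1 ≤ _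
  omega

end PolyOn

end VCKernel

namespace VCKernel

open TreeCode

/-! ### List functions in polynomial time -/

/-- Numbers are coded in unary here; binary numbers are lists of digits. -/
instance : TreeCode ℕ := ⟨fun n => enc (List.replicate n ())⟩

theorem sz_nat (n : ℕ) : sz n = 2 * n + 1 := by
  change sz (List.replicate n ()) = _
  induction n with
  | zero => rfl
  | succ n ih => rw [List.replicate_succ, sz_cons, ih, sz_unit]; omega

namespace PolyOn

variable {α β γ σ : Type} [TreeCode α] [TreeCode β] [TreeCode γ] [TreeCode σ] {D : α → Prop}

theorem sz_le_of_eq_append {l p r : List β} (h : l = p ++ r) : sz p ≤ sz l ∧ sz r ≤ sz l := by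
  have := sz_append p r
  have h1 := sz_pos p
  have h2 := sz_pos r
  rw [← h] at this; omega

theorem reverse {l : α → List β} (hl : PolyOn D l) : PolyOn D fun a => (l a).reverse := by
  have key : ∀ p q : List β, p.foldl (fun acc b => b :: acc) q = p.reverse ++ q := by
    intro p
    induction p with
    | nil => simp
    | cons b p ih => intro q; simp [ih]
  refine (foldl (E := fun _ => True) (g := fun a => sz (l a)) (i := fun _ => [])
    (step := fun _ acc b => b :: acc) hl const_nil
    (PolyOn.id.snd.snd.cons PolyOn.id.snd.fst) (fun _ _ _ _ _ _ => trivial) hl.sz_bdd ?_).congr ?_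
  · intro a p r _ h
    rw [key, List.append_nil, sz_reverse]
    exact (sz_le_of_eq_append h).1
  · intro a _; simp only [key, List.append_nil]

theorem append {l m : α → List β} (hl : PolyOn D l) (hm : PolyOn D m) :
    PolyOn D fun a => l a ++ m a := by
  have key : ∀ p q : List β, p.foldl (fun acc b => b :: acc) q = p.reverse ++ q := by
    intro p
    induction p with
    | nil => simp
    | cons b p ih => intro q; simp [ih]
  refine (foldl (E := fun _ => True) (g := fun a => sz (l a) + sz (m a)) (i := m)
    (step := fun _ acc b => b :: acc) hl.reverse hm
    (PolyOn.id.snd.snd.cons PolyOn.id.snd.fst) (fun _ _ _ _ _ _ => trivial)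
    (hl.sz_bdd.add hm.sz_bdd) ?_).congr ?_
  · intro a p r _ h
    have h1 := (sz_le_of_eq_append h).1
    have h2 := sz_append p.reverse (m a)
    rw [sz_reverse] at h1 h2
    simp only [key]
    omega
  · intro a _; simp only [key, List.reverse_reverse]

/-- A step function with a polynomial time bound yields values of polynomial size, uniformly over
the elements of a list. -/
theorem sz_bdd_mem {l : α → List β} {E : α × β → Prop} {f : α → β → γ} (hl : PolyOn D l)
    (hf : PolyOn E fun x => f x.1 x.2) (hE : ∀ a b, D a → b ∈ l a → E (a, b)) :
    ∃ g : α → ℕ, PolyBdd D g ∧ ∀ a b, D a → b ∈ l a → sz (f a b) ≤ g a := by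
  obtain ⟨q, hq⟩ := hf.sz_bdd
  refine ⟨fun a => q.eval (sz a + sz (l a) + 1),
    ((PolyBdd.id.add hl.sz_bdd).add (.const 1)).eval q, fun a b ha hb => ?_⟩
  refine (hq (a, b) (hE a b ha hb)).trans (eval_mono q ?_)
  have := sz_le_of_mem hb
  rw [sz_prod]; omega

theorem map {l : α → List β} {E : α × β → Prop} {f : α → β → γ} (hl : PolyOn D l)
    (hf : PolyOn E fun x => f x.1 x.2) (hE : ∀ a b, D a → b ∈ l a → E (a, b)) :
    PolyOn D fun a => (l a).map (f a) := by
  have key : ∀ a (p : List β) (q : List γ),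
      p.foldl (fun acc b => f a b :: acc) q = (p.map (f a)).reverse ++ q := by
    intro a p
    induction p with
    | nil => simp
    | cons b p ih => intro q; simp [ih]
  obtain ⟨g, hg, hb⟩ := sz_bdd_mem hl hf hE
  refine (PolyOn.reverse (foldl (E := fun x => E (x.1, x.2.2))
    (g := fun a => sz (l a) * (g a + 1) + 1) (i := fun _ => [])
    (step := fun a acc b => f a b :: acc) hl const_nil
    ((hf.comp (PolyOn.id.fst.pair PolyOn.id.snd.snd) fun _ h => h).cons PolyOn.id.snd.fst)
    ?_ ((hl.sz_bdd.mul (hg.add (.const 1))).add (.const 1)) ?_)).congr ?_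
  · intro a p b r ha h
    exact hE a b ha (by simp [h])
  · intro a p r ha h
    rw [key, List.append_nil, sz_reverse]
    refine (sz_le_of_forall _ (g a) ?_).trans ?_
    · intro c hc
      obtain ⟨b, hbp, rfl⟩ := List.mem_map.1 hc
      exact hb a b ha (by simp [h, hbp])
    · have h1 := length_le_sz p
      have h2 := (sz_le_of_eq_append h).1
      rw [List.length_map]
      gcongr; omega
  · intro a _; simp only [key, List.append_nil, List.reverse_reverse]

theorem filter {l : α → List β} {E : α × β → Prop} {f : α → β → Bool} (hl : PolyOn D l)
    (hf : PolyOn E fun x => f x.1 x.2) (hE : ∀ a b, D a → b ∈ l a → E (a, b)) :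
    PolyOn D fun a => (l a).filter (f a) := by
  have key : ∀ a (p q : List β),
      p.foldl (fun acc b => if f a b = true then b :: acc else acc) q =
        (p.filter (f a)).reverse ++ q := by
    intro a p
    induction p with
    | nil => simp
    | cons b p ih => intro q; by_cases h : f a b = true <;> simp [ih, h]
  refine (PolyOn.reverse (foldl (E := fun x => E (x.1, x.2.2)) (i := fun _ => [])
    (g := fun a => sz (l a))
    (step := fun a acc b => if f a b = true then b :: acc else acc) hl const_nil
    ((hf.comp (PolyOn.id.fst.pair PolyOn.id.snd.snd) fun _ h => h).ite
      (PolyOn.id.snd.snd.cons PolyOn.id.snd.fst) PolyOn.id.snd.fst)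
    ?_ hl.sz_bdd ?_)).congr ?_
  · intro a p b r ha h
    exact hE a b ha (by simp [h])
  · intro a p r ha h
    rw [key, List.append_nil, sz_reverse]
    exact (sz_sublist List.filter_sublist).trans (sz_le_of_eq_append h).1
  · intro a _; simp only [key, List.append_nil, List.reverse_reverse]

theorem any {l : α → List β} {E : α × β → Prop} {f : α → β → Bool} (hl : PolyOn D l)
    (hf : PolyOn E fun x => f x.1 x.2) (hE : ∀ a b, D a → b ∈ l a → E (a, b)) :
    PolyOn D fun a => (l a).any (f a) :=
  (hl.filter hf hE).isEmpty.not.congr fun a _ => by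
    induction l a with
    | nil => rfl
    | cons b p ih => by_cases h : f a b = true <;> simp_all

theorem all {l : α → List β} {E : α × β → Prop} {f : α → β → Bool} (hl : PolyOn D l)
    (hf : PolyOn E fun x => f x.1 x.2) (hE : ∀ a b, D a → b ∈ l a → E (a, b)) :
    PolyOn D fun a => (l a).all (f a) :=
  (hl.any (f := fun a b => !f a b) hf.not hE).not.congr fun a _ => by
    induction l a with
    | nil => rfl
    | cons b p ih => by_cases h : f a b = true <;> simp_all

theorem foldr {l : α → List β} {i : α → σ} {step : α → β → σ → σ} {E : α × σ × β → Prop}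
    {g : α → ℕ} (hl : PolyOn D l) (hi : PolyOn D i)
    (hs : PolyOn E fun x => step x.1 x.2.2 x.2.1)
    (hE : ∀ a p b r, D a → l a = p ++ b :: r → E (a, r.foldr (step a) (i a), b))
    (hg : PolyBdd D g)
    (hB : ∀ a p r, D a → l a = p ++ r → sz (r.foldr (step a) (i a)) ≤ g a) :
    PolyOn D fun a => (l a).foldr (step a) (i a) := by
  refine (foldl (g := g) (step := fun a s b => step a b s) hl.reverse hi hs ?_ hg ?_).congr ?_
  · intro a p b r ha h
    rw [List.foldl_eq_foldr_reverse]
    exact hE a r.reverse b p.reverse ha (by rw [← List.reverse_reverse (l a), h]; simp)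
  · intro a p r ha h
    rw [List.foldl_eq_foldr_reverse]
    exact hB a r.reverse p.reverse ha (by rw [← List.reverse_reverse (l a), h]; simp)
  · intro a _
    simp only [List.foldl_reverse]

theorem zip {l : α → List β} {m : α → List γ} (hl : PolyOn D l) (hm : PolyOn D m) :
    PolyOn D fun a => (l a).zip (m a) := by
  let step : List γ × List (β × γ) → β → List γ × List (β × γ) := fun s b =>
    match s.1 with
    | [] => ([], s.2)
    | c :: t => (t, (b, c) :: s.2)
  have key : ∀ (p : List β) (m : List γ) (q : List (β × γ)),
      p.foldl step (m, q) = (m.drop p.length, (p.zip m).reverse ++ q) := by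
    intro p
    induction p with
    | nil => simp
    | cons b p ih =>
      rintro (_ | ⟨c, m⟩) q
      · simp [step, ih]
      · simp [step, ih]
  have hstep : PolyOn (fun _ : α × (List γ × List (β × γ)) × β => True)
      fun x => step x.2.1 x.2.2 := by
    have h1 : PolyOn (fun x : α × (List γ × List (β × γ)) × β => True ∧ x.2.1.1 = [])
        fun x => (([] : List γ), x.2.1.2) := const_nil.pair PolyOn.id.snd.fst.snd
    have h2 : PolyOn (fun _ : (α × (List γ × List (β × γ)) × β) × γ × List γ => True)
        fun x => (x.2.2, (x.1.2.2, x.2.1) :: x.1.2.1.2) :=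
      PolyOn.id.snd.snd.pair
        ((PolyOn.id.fst.snd.snd.pair PolyOn.id.snd.fst).cons PolyOn.id.fst.snd.fst.snd)
    refine list_cases (g := fun x c t => (t, (x.2.2, c) :: x.2.1.2)) PolyOn.id.snd.fst.fst h1 h2
      (fun _ _ _ _ _ => trivial) ?_ ?_
    · rintro ⟨a, ⟨m, q⟩, b⟩ _ h
      simp only at h; subst h; rfl
    · rintro ⟨a, ⟨m, q⟩, b⟩ c t _ h
      simp only at h; subst h; rfl
  refine (PolyOn.reverse (foldl (E := fun _ => True) (step := fun _ => step)
    (g := fun a => sz (m a) + (sz (l a) * (sz (l a) + sz (m a) + 2) + 1) + 1) hl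
    (hm.pair const_nil) hstep (fun _ _ _ _ _ _ => trivial)
    ((hm.sz_bdd.add ((hl.sz_bdd.mul ((hl.sz_bdd.add hm.sz_bdd).add (.const 2))).add
      (.const 1))).add (.const 1)) ?_).snd).congr ?_
  · intro a p r ha h
    simp only [key, List.append_nil, sz_prod, sz_reverse]
    have h1 := (sz_le_of_eq_append (List.take_append_drop p.length (m a)).symm).2
    have h2 := (sz_le_of_eq_append h).1
    have h3 : sz (p.zip (m a)) ≤ sz (l a) * (sz (l a) + sz (m a) + 2) + 1 := by
      refine (sz_le_of_forall _ (sz (l a) + sz (m a) + 1) ?_).trans ?_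
      · rintro ⟨b, c⟩ hbc
        obtain ⟨hb, hc⟩ := List.of_mem_zip hbc
        have h4 := sz_le_of_mem hb
        have h5 := sz_le_of_mem hc
        rw [sz_prod]; omega
      · have h4 := length_le_sz p
        have h5 : (p.zip (m a)).length ≤ sz (l a) := by simp; omega
        gcongr
    omega
  · intro a _
    simp only [key, List.append_nil, List.reverse_reverse]

/-! ### Unary numbers -/

theorem zero : PolyOn D fun _ => (0 : ℕ) := of_expr .nil fun _ _ => rfl

theorem succ {f : α → ℕ} (hf : PolyOn D f) : PolyOn D fun a => f a + 1 :=
  (of_expr (D := fun _ => True) (f := fun n : ℕ => n + 1) (.cons .nil .reg)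
    fun _ _ => rfl).comp hf fun _ _ => trivial

theorem const_nat (n : ℕ) : PolyOn D fun _ => n := by
  induction n with
  | zero => exact zero
  | succ n ih => exact ih.succ

theorem replicate {f : α → ℕ} (hf : PolyOn D f) : PolyOn D fun a => List.replicate (f a) () :=
  (of_expr (D := fun _ => True) (f := fun n : ℕ => List.replicate n ()) .reg
    fun _ _ => rfl).comp hf fun _ _ => trivial

theorem length {l : α → List β} (hl : PolyOn D l) : PolyOn D fun a => (l a).length := by
  have h := hl.map (f := fun _ _ => ()) (E := fun _ => True) const_unit fun _ _ _ _ => trivial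
  refine ((of_expr (D := fun x : List Unit => True) (f := fun x => x.length) .reg
    fun x _ => ?_).comp h fun _ _ => trivial).congr fun a _ => by simp
  change enc x = enc (List.replicate x.length ())
  rw [← List.eq_replicate_of_mem (a := ()) (l := x) (fun _ _ => rfl)]

theorem add {f g : α → ℕ} (hf : PolyOn D f) (hg : PolyOn D g) : PolyOn D fun a => f a + g a :=
  (hf.replicate.append hg.replicate).length.congr fun a _ => by simp

theorem lt {f g : α → ℕ} (hf : PolyOn D f) (hg : PolyOn D g) :
    PolyOn D fun a => decide (f a < g a) := by
  have key : ∀ m n : ℕ, (List.replicate m ()).foldl (fun s _ => s.tail) (List.replicate n ()) =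
      List.replicate (n - m) () := by
    intro m
    induction m with
    | zero => simp
    | succ m ih =>
      rintro (_ | n)
      · simpa [List.replicate_succ] using ih 0
      · simpa [List.replicate_succ] using ih n
  refine (foldl (E := fun _ => True) (step := fun _ s _ => s.tail)
    (g := fun a => 2 * g a + 1) hf.replicate
    hg.replicate PolyOn.id.snd.fst.tail (fun _ _ _ _ _ _ => trivial)
    (hg.sz_bdd.mono fun a _ => (sz_nat _).ge) ?_).isEmpty.not.congr ?_
  · intro a p r _ h
    have hp : p = List.replicate p.length () := List.eq_replicate_of_mem fun _ _ => rfl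
    rw [hp, key]
    have := sz_nat (g a - p.length)
    change sz (List.replicate (g a - p.length) ()) = _ at this
    omega
  · intro a _
    simp only [key]
    by_cases h : f a < g a
    · have : g a - f a ≠ 0 := by omega
      simp [h, this]
    · have : g a - f a = 0 := by omega
      simp [h, this]

end PolyOn

end VCKernel

namespace VCKernel

/-! ### Embeddings, components and graph classes -/

section Embeddings

variable {V W W' : Type} {G : SimpleGraph V} {H : SimpleGraph W} {H' : SimpleGraph W'}

/-- Two induced subgraphs on the same vertex set are isomorphic. -/
theorem exists_iso_of_range_eq (f : H ↪g G) (f' : H' ↪g G) (h : Set.range f = Set.range f') :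
    ∃ e : H ≃g H', ∀ a, f' (e a) = f a := by
  have h1 : ∀ a, ∃ b, f' b = f a := fun a => by
    have : f a ∈ Set.range f' := h ▸ ⟨a, rfl⟩
    exact this
  have h2 : ∀ b, ∃ a, f a = f' b := fun b => by
    have : f' b ∈ Set.range f := h ▸ ⟨b, rfl⟩
    exact this
  choose g hg using h1
  choose g' hg' using h2
  refine ⟨⟨⟨g, g', fun a => ?_, fun b => ?_⟩, ?_⟩, hg⟩
  · exact f.injective (by rw [hg', hg])
  · exact f'.injective (by rw [hg, hg'])
  · intro a b
    change H'.Adj (g a) (g b) ↔ _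
    rw [← f'.map_adj_iff, hg, hg, f.map_adj_iff]

theorem nonempty_iso_of_range_eq (f : H ↪g G) (f' : H' ↪g G) (h : Set.range f = Set.range f') :
    Nonempty (H ≃g H') :=
  ⟨(exists_iso_of_range_eq f f' h).choose⟩

/-- The inclusion of `G - X`. -/
def delEmb (G : SimpleGraph V) (X : Set V) : del G X ↪g G := SimpleGraph.Embedding.induce _

theorem range_delEmb (X : Set V) : Set.range (delEmb G X) = Xᶜ := by
  ext v
  exact ⟨fun ⟨w, hw⟩ => hw ▸ w.2, fun hv => ⟨⟨v, hv⟩, rfl⟩⟩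

/-- The inclusion of an induced subgraph. -/
def induceEmb (G : SimpleGraph V) (U : Set V) : G.induce U ↪g G := SimpleGraph.Embedding.induce _

theorem range_induceEmb (U : Set V) : Set.range (induceEmb G U) = U := by
  ext v
  exact ⟨fun ⟨w, hw⟩ => hw ▸ w.2, fun hv => ⟨⟨v, hv⟩, rfl⟩⟩

theorem reachable_of_embedding (f : H ↪g G)
    (hf : ∀ a v, G.Adj (f a) v → v ∈ Set.range f) {a b : W} (h : G.Reachable (f a) (f b)) :
    H.Reachable a b := by
  obtain ⟨p⟩ := h
  generalize hu : f a = u at p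
  generalize hv : f b = v at p
  induction p generalizing a with
  | nil => rw [f.injective (hu.trans hv.symm)]
  | cons hadj p ih =>
    subst hu
    obtain ⟨c, rfl⟩ := hf a _ hadj
    exact (f.map_adj_iff.1 hadj).reachable.trans (ih rfl hv)

end Embeddings

/-- The class contains with a graph also every union of connected components of the graph. This is
all that the reduction rule needs of a hereditary or robust class. -/
def GraphClass.ComponentClosed (C : GraphClass) : Prop :=
  ∀ {V : Type} [Finite V] (G : SimpleGraph V) (F : Set G.ConnectedComponent), C.Mem G →
    C.Mem (G.induce {v | G.connectedComponentMk v ∈ F})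

theorem GraphClass.Hereditary.mem_of_embedding {C : GraphClass} (h : C.Hereditary) {V W : Type}
    [Finite V] [Finite W] {G : SimpleGraph V} {H : SimpleGraph W} (f : H ↪g G) (hG : C.Mem G) :
    C.Mem H :=
  C.iso (nonempty_iso_of_range_eq (delEmb G (Set.range f)ᶜ) f
    (by rw [range_delEmb, compl_compl])) (h G (Set.range f)ᶜ hG)

theorem GraphClass.Hereditary.componentClosed {C : GraphClass} (h : C.Hereditary) :
    C.ComponentClosed := fun G _ hG => h.mem_of_embedding (induceEmb G _) hG

theorem GraphClass.Robust.componentClosed {C : GraphClass} (h : C.Robust) :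
    C.ComponentClosed := by
  intro V _ G F hG
  have key : ∀ F : Set G.ConnectedComponent, F.Finite →
      C.Mem (G.induce {v | G.connectedComponentMk v ∉ F}) := by
    intro F hF
    induction F, hF using Set.Finite.induction_on with
    | empty =>
      refine C.iso (nonempty_iso_of_range_eq (SimpleGraph.Embedding.refl (G := G))
        (induceEmb G _) ?_) hG
      rw [range_induceEmb]; ext; simp
    | @insert H F hH hF ih =>
      obtain ⟨v, rfl⟩ := H.exists_rep
      let w : {v | G.connectedComponentMk v ∉ F} := ⟨v, hH⟩
      let H1 := (G.induce {v | G.connectedComponentMk v ∉ F}).connectedComponentMk w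
      refine C.iso (nonempty_iso_of_range_eq
        ((delEmb _ H1.supp).trans (induceEmb G _)) (induceEmb G _) ?_) (h.2 _ H1 ih)
      rw [range_induceEmb]
      have hadj : ∀ (a : {v | G.connectedComponentMk v ∉ F}) (u : V),
          G.Adj (induceEmb G _ a) u → u ∈ Set.range (induceEmb G
            {v | G.connectedComponentMk v ∉ F}) := by
        intro a u hau
        rw [range_induceEmb]
        have h1 : G.connectedComponentMk a.1 ∉ F := a.2
        have h2 : G.connectedComponentMk a.1 = G.connectedComponentMk u :=
          SimpleGraph.ConnectedComponent.connectedComponentMk_eq_of_adj hau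
        rw [h2] at h1
        exact h1
      have hmem : ∀ a : {v | G.connectedComponentMk v ∉ F},
          a ∈ H1.supp ↔ G.connectedComponentMk a.1 = G.connectedComponentMk v := by
        intro a
        rw [SimpleGraph.ConnectedComponent.mem_supp_iff, SimpleGraph.ConnectedComponent.eq,
          SimpleGraph.ConnectedComponent.eq]
        refine ⟨fun hr => hr.map (induceEmb G _).toHom, fun hr => ?_⟩
        exact reachable_of_embedding (induceEmb G _) hadj hr
      ext u
      constructor
      · rintro ⟨⟨a, ha⟩, rfl⟩
        change ¬ (G.connectedComponentMk a.1 ∈ insert _ F)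
        rintro (h1 | h1)
        · exact ha ((hmem a).2 h1)
        · exact a.2 h1
      · intro hu
        have hu' : G.connectedComponentMk u ∉ F := fun h1 => hu (Or.inr h1)
        exact ⟨⟨⟨u, hu'⟩, fun h1 => hu (Or.inl ((hmem _).1 h1))⟩, rfl⟩
  have e : {v | G.connectedComponentMk v ∉ Fᶜ} = {v | G.connectedComponentMk v ∈ F} := by
    ext v; simp
  have h1 := key Fᶜ (Set.toFinite _)
  rwa [e] at h1

/-! ### Minimum vertex covers -/

section Covers

variable {V W : Type} {G : SimpleGraph V} {H : SimpleGraph W}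

theorem coe_opt [Finite V] (G : SimpleGraph V) : (opt G : ℕ∞) = G.vertexCoverNum :=
  ENat.natCast_toNat SimpleGraph.vertexCoverNum_ne_top_of_finite

theorem opt_le [Finite V] {S : Set V} (hS : G.IsVertexCover S) : opt G ≤ S.ncard := by
  have := hS.vertexCoverNum_le
  rw [← coe_opt, ← S.toFinite.cast_ncard_eq] at this
  exact_mod_cast this

theorem exists_opt [Finite V] (G : SimpleGraph V) :
    ∃ S : Set V, G.IsVertexCover S ∧ S.ncard = opt G := by
  obtain ⟨S, h1, h2⟩ := SimpleGraph.vertexCoverNum_exists G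
  refine ⟨S, h2, ?_⟩
  rw [← coe_opt, ← S.toFinite.cast_ncard_eq] at h1
  exact_mod_cast h1

theorem hasVC_iff [Finite V] (k : ℤ) : HasVC G k ↔ (opt G : ℤ) ≤ k := by
  constructor
  · rintro ⟨S, _, h, hk⟩
    have := opt_le h
    omega
  · intro h
    obtain ⟨S, h1, h2⟩ := exists_opt G
    exact ⟨S, S.toFinite, h1, by omega⟩

theorem opt_congr (e : Nonempty (G ≃g H)) : opt G = opt H := by
  obtain ⟨e⟩ := e
  unfold opt
  rw [SimpleGraph.vertexCoverNum_congr e]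

theorem opt_le_card [Finite V] : opt G ≤ Nat.card V := by
  simpa using opt_le (G := G) (S := Set.univ) (by simp)

theorem not_isBlocking_iff [Finite V] {Y : Set V} :
    ¬ IsBlocking G Y ↔ ∃ S, G.IsVertexCover S ∧ S.ncard = opt G ∧ Y ⊆ S := by
  unfold IsBlocking
  rw [not_not]
  refine exists_congr fun S => and_congr_right fun _ => and_congr_left fun _ => ?_
  rw [← coe_opt, ← S.toFinite.cast_ncard_eq]
  exact_mod_cast Iff.rfl

theorem IsBlocking.mono {Y Y' : Set V} (h : IsBlocking G Y) (hY : Y ⊆ Y') : IsBlocking G Y' :=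
  fun ⟨S, h1, h2, h3⟩ => h ⟨S, h1, h2, hY.trans h3⟩

theorem IsBlocking.nonempty [Finite V] {Y : Set V} (h : IsBlocking G Y) : Y.Nonempty := by
  by_contra hY
  rw [Set.not_nonempty_iff_eq_empty] at hY
  obtain ⟨S, h1, h2⟩ := exists_opt G
  exact not_isBlocking_iff.2 ⟨S, h1, h2, by simp [hY]⟩ h

theorem IsBlocking.exists_minimal [Finite V] {Y : Set V} (h : IsBlocking G Y) :
    ∃ Y' ⊆ Y, IsMinBlocking G Y' := by
  obtain ⟨Y', h1, h2⟩ := (Set.toFinite {Y' | IsBlocking G Y'}).exists_le_minimal h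
  refine ⟨Y', h1, h2.prop, fun Z hZ hb => hZ.not_subset (h2.le_of_le hb hZ.subset)⟩

theorem GraphClass.encard_le_blockingSize {C : GraphClass} [Finite V] (hG : C.Mem G) {Y : Set V}
    (hY : IsMinBlocking G Y) : Y.encard ≤ C.blockingSize := by
  unfold GraphClass.blockingSize VCKernel.blockingSize
  refine le_iSup_of_le V (le_iSup_of_le ‹Finite V› (le_iSup_of_le G (le_iSup_of_le hG ?_)))
  exact le_iSup₂_of_le Y hY le_rfl

theorem IsBlocking.iso {Y : Set V} (h : IsBlocking G Y) (e : G ≃g H) : IsBlocking H (e '' Y) := by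
  rintro ⟨S, h1, h2, h3⟩
  refine h ⟨e ⁻¹' S, (SimpleGraph.isVertexCover_preimage_iso e).2 h1, ?_, ?_⟩
  · rw [SimpleGraph.vertexCoverNum_congr e, ← h2]
    have : e ⁻¹' S = e.toEquiv.symm '' S := by
      rw [Equiv.image_symm_eq_preimage]; rfl
    rw [this, e.toEquiv.symm.injective.encard_image]
  · exact Set.image_subset_iff.1 h3

/-- Every edge of `G` between vertices of `U` has an end in `S`. -/
def CoversOn (G : SimpleGraph V) (U S : Set V) : Prop :=
  ∀ ⦃u v⦄, u ∈ U → v ∈ U → G.Adj u v → u ∈ S ∨ v ∈ S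

theorem opt_le_of_coversOn [Finite V] (f : H ↪g G) {S : Set V}
    (h : CoversOn G (Set.range f) S) : opt H ≤ (S ∩ Set.range f).ncard := by
  have : Finite W := Finite.of_injective f f.injective
  refine (opt_le (S := f ⁻¹' S) fun a b hab => ?_).trans ?_
  · exact h ⟨a, rfl⟩ ⟨b, rfl⟩ (f.map_adj_iff.2 hab)
  · rw [← Set.image_preimage_eq_inter_range, Set.ncard_image_of_injective _ f.injective]

theorem coversOn_image (f : H ↪g G) {S : Set W} (h : H.IsVertexCover S) :
    CoversOn G (Set.range f) (f '' S) := by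
  rintro _ _ ⟨a, rfl⟩ ⟨b, rfl⟩ hab
  rcases h (f.map_adj_iff.1 hab) with h | h
  · exact Or.inl ⟨a, h, rfl⟩
  · exact Or.inr ⟨b, h, rfl⟩

end Covers

/-! ### Safety of the reduction rule -/

section Safety

variable {V : Type} {G : SimpleGraph V} {X : Set V} {d : ℕ}

/-- The inclusion of a connected component. -/
def componentEmb (H : G.ConnectedComponent) : H.toSimpleGraph ↪g G :=
  SimpleGraph.Embedding.induce H.supp

theorem range_componentEmb (H : G.ConnectedComponent) : Set.range (componentEmb H) = H.supp :=
  range_induceEmb H.supp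

/-- The inclusion of a component of `G - X` into `G`. -/
def compEmb (H : Comp G X) : H.toSimpleGraph ↪g G := (componentEmb H).trans (delEmb G X)

/-- The vertices of a component of `G - X`, as a subset of `V(G)`. -/
def compSet (H : Comp G X) : Set V := Set.range (compEmb H)

theorem mem_compSet {H : Comp G X} {v : V} :
    v ∈ compSet H ↔ ∃ h : v ∈ Xᶜ, (del G X).connectedComponentMk ⟨v, h⟩ = H := by
  constructor
  · rintro ⟨⟨⟨v, hv⟩, h⟩, rfl⟩
    exact ⟨hv, h⟩
  · rintro ⟨hv, h⟩
    exact ⟨⟨⟨v, hv⟩, h⟩, rfl⟩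

theorem mem_compSet_of_adj {H : Comp G X} {u v : V} (hu : u ∈ compSet H) (hv : v ∉ X)
    (huv : G.Adj u v) : v ∈ compSet H := by
  obtain ⟨h, rfl⟩ := mem_compSet.1 hu
  refine mem_compSet.2 ⟨hv, ?_⟩
  exact (SimpleGraph.ConnectedComponent.connectedComponentMk_eq_of_adj
    (G := del G X) (v := ⟨u, h⟩) (w := ⟨v, hv⟩) huv).symm

theorem exists_mem_compSet {v : V} (hv : v ∉ X) : ∃ H : Comp G X, v ∈ compSet H :=
  ⟨_, mem_compSet.2 ⟨hv, rfl⟩⟩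

theorem compSet_unique {H H' : Comp G X} {v : V} (h : v ∈ compSet H) (h' : v ∈ compSet H') :
    H = H' := by
  obtain ⟨_, rfl⟩ := mem_compSet.1 h
  obtain ⟨_, rfl⟩ := mem_compSet.1 h'
  rfl

theorem notMem_of_mem_compSet {H : Comp G X} {v : V} (h : v ∈ compSet H) : v ∉ X :=
  (mem_compSet.1 h).1

theorem compSet_nonempty (H : Comp G X) : (compSet H).Nonempty := by
  obtain ⟨v, hv⟩ := H.nonempty_supp
  exact ⟨v.1, mem_compSet.2 ⟨v.2, hv⟩⟩

theorem compSet_injective : Function.Injective (compSet : Comp G X → Set V) := fun H H' h => by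
  obtain ⟨v, hv⟩ := compSet_nonempty H
  exact compSet_unique hv (h ▸ hv)

theorem ncard_eq_sum_compSet [Finite V] [Fintype (Comp G X)] (W : Set V) :
    W.ncard = (W ∩ X).ncard + ∑ H : Comp G X, (W ∩ compSet H).ncard := by
  classical
  have : Fintype V := Fintype.ofFinite V
  rw [← Set.ncard_inter_add_ncard_sdiff_eq_ncard W X]
  congr 1
  have h1 : ∑ H : Comp G X, (W ∩ compSet H).ncard =
      ∑ H : Comp G X, (Finset.univ.filter fun v => v ∈ W ∩ compSet H).card :=
    Finset.sum_congr rfl fun H _ => by rw [Set.ncard_eq_toFinset_card', Set.toFinset_card,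
      Fintype.card_subtype]
  rw [h1, ← Finset.card_biUnion]
  · rw [Set.ncard_eq_toFinset_card']
    congr 1
    ext v
    simp only [Set.mem_toFinset, Set.mem_sdiff, Finset.mem_biUnion, Finset.mem_univ, true_and,
      Finset.mem_filter, Set.mem_inter_iff]
    constructor
    · rintro ⟨hv, hX⟩
      obtain ⟨H, hH⟩ := exists_mem_compSet (G := G) hX
      exact ⟨H, hv, hH⟩
    · rintro ⟨H, hv, hH⟩
      exact ⟨hv, notMem_of_mem_compSet hH⟩
  · intro H _ H' _ hne
    rw [Function.onFun, Finset.disjoint_left]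
    intro v hv hv'
    simp only [Finset.mem_filter, Finset.mem_univ, true_and, Set.mem_inter_iff] at hv hv'
    exact hne (compSet_unique hv.2 hv'.2)

theorem GraphClass.ComponentClosed.toSimpleGraph_mem {C : GraphClass} (hC : C.ComponentClosed)
    [Finite V] (hG : C.Mem (del G X)) (H : Comp G X) : C.Mem H.toSimpleGraph := by
  refine C.iso (nonempty_iso_of_range_eq (induceEmb (del G X) _) (componentEmb H) ?_)
    (hC (del G X) {H} hG)
  rw [range_induceEmb, range_componentEmb]
  rfl

/-- If the neighbourhood of an independent set `U ⊆ X` blocks a component, then so does the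
neighbourhood of a chunk inside `U`: select a neighbour in `U` for each vertex of a minimal blocking
set. -/
theorem exists_chunk_blocks [Finite V] {C : GraphClass} (hd : C.blockingSize = d) {U : Set V}
    (hU : U ⊆ X) (hi : G.IsIndepSet U) {H : Comp G X} (hH : C.Mem H.toSimpleGraph)
    (hb : Blocks G U H) : ∃ Z ∈ chunks G X d, Z ⊆ U ∧ Blocks G Z H := by
  obtain ⟨Y, hYU, hY⟩ := IsBlocking.exists_minimal hb
  have hcard := C.encard_le_blockingSize hH hY
  rw [hd] at hcard
  have : Nonempty V := ⟨hY.1.nonempty.some.1.1⟩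
  have hYU' : ∀ y ∈ Y, ∃ z, z ∈ U ∧ G.Adj z y.1.1 := fun y hy => hYU hy
  choose! z hzU hz using hYU'
  refine ⟨z '' Y, ⟨?_, ?_, ?_, (Set.encard_image_le _ _).trans hcard⟩, ?_, ?_⟩
  · rintro _ ⟨y, hy, rfl⟩
    exact hU (hzU y hy)
  · refine hi.mono ?_
    rintro _ ⟨y, hy, rfl⟩
    exact hzU y hy
  · rw [Set.one_le_encard_iff_nonempty]
    exact hY.1.nonempty.image _
  · rintro _ ⟨y, hy, rfl⟩
    exact hzU y hy
  · exact hY.1.mono fun y hy => ⟨z y, ⟨y, hy, rfl⟩, hz y hy⟩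

theorem exists_cover_of_not_blocks [Finite V] {U : Set V} {H : Comp G X} (h : ¬ Blocks G U H) :
    ∃ S ⊆ compSet H, CoversOn G (compSet H) S ∧ S.ncard = opt H.toSimpleGraph ∧
      ∀ u ∈ U, ∀ v ∈ compSet H, G.Adj u v → v ∈ S := by
  obtain ⟨S, h1, h2, h3⟩ := not_isBlocking_iff.1 h
  refine ⟨compEmb H '' S, Set.image_subset_range _ _, coversOn_image _ h1, ?_, ?_⟩
  · rw [Set.ncard_image_of_injective _ (compEmb H).injective, h2]
  · rintro u hu _ ⟨v, rfl⟩ huv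
    exact ⟨v, h3 ⟨u, hu, huv⟩, rfl⟩

/-- A cover of a component that contains all neighbours of a blocking set is not optimal. -/
theorem lt_ncard_of_blocks [Finite V] {Z R : Set V} {H : Comp G X} (hb : Blocks G Z H)
    (hR : CoversOn G (compSet H) R) (hZ : ∀ u ∈ Z, ∀ v ∈ compSet H, G.Adj u v → v ∈ R) :
    opt H.toSimpleGraph + 1 ≤ (R ∩ compSet H).ncard := by
  have h1 : opt H.toSimpleGraph ≤ (R ∩ compSet H).ncard := opt_le_of_coversOn (compEmb H) hR
  refine Nat.lt_of_le_of_ne h1 fun he => ?_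
  refine not_isBlocking_iff.2 ⟨compEmb H ⁻¹' R, ?_, ?_, ?_⟩ hb
  · intro a b hab
    exact hR ⟨a, rfl⟩ ⟨b, rfl⟩ ((compEmb H).map_adj_iff.2 hab)
  · rw [he, compSet, ← Set.image_preimage_eq_inter_range,
      Set.ncard_image_of_injective _ (compEmb H).injective]
  · rintro v ⟨z, hz, hzv⟩
    exact hZ z hz _ ⟨v, rfl⟩ hzv

namespace Crown

variable (K : Crown G X d)

theorem mem_verts {v : V} : v ∈ K.verts ↔ ∃ H ∈ K.discarded, v ∈ compSet H := by
  constructor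
  · rintro ⟨h, hv⟩
    exact ⟨_, hv, mem_compSet.2 ⟨h, rfl⟩⟩
  · rintro ⟨H, hH, hv⟩
    obtain ⟨h, rfl⟩ := mem_compSet.1 hv
    exact ⟨h, hH⟩

theorem subset_compl_verts : X ⊆ K.vertsᶜ := fun _ hx ⟨h, _⟩ => h hx

theorem opt_rest_add_savings_le [Finite V] : opt K.rest + K.savings ≤ opt G := by
  obtain ⟨S, h1, h2⟩ := exists_opt G
  have e1 := opt_le_of_coversOn (delEmb G K.verts) (S := S) fun u v _ _ h => h1 h
  have e2 := opt_le_of_coversOn (induceEmb G K.verts) (S := S) fun u v _ _ h => h1 h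
  rw [range_delEmb] at e1
  rw [range_induceEmb] at e2
  rw [← h2, ← Set.ncard_inter_add_ncard_sdiff_eq_ncard S K.verts, Set.sdiff_eq]
  change opt (del G K.verts) + opt (G.induce K.verts) ≤ _
  omega

/-- The exchange argument. To an optimal cover `R` of the rest, add one vertex of each chunk outside
`A` that avoids `R`; afterwards no component outside the neighbourhood of `A` is
blocked any more, and its part of the cover can be replaced by an optimal one. A component that is
matched to a chunk avoiding `R` saves a vertex by this, which pays for the additional vertices. -/
theorem opt_le_opt_rest_add_savings [Finite V] {C : GraphClass} (hd : C.blockingSize = d)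
    (hC : C.ComponentClosed) (hG : C.Mem (del G X)) : opt G ≤ opt K.rest + K.savings := by
  classical
  have : Fintype (Comp G X) := Fintype.ofFinite _
  have : Fintype ↥(chunks G X d \ K.A) := Fintype.ofFinite _
  obtain ⟨R', hR', hR'c⟩ := exists_opt K.rest
  obtain ⟨Q', hQ', hQ'c⟩ := exists_opt (G.induce K.verts)
  set R := delEmb G K.verts '' R' with hRdef
  set Q := induceEmb G K.verts '' Q' with hQdef
  have hRc : R.ncard = opt K.rest := by
    rw [hRdef, Set.ncard_image_of_injective _ (delEmb G K.verts).injective, hR'c]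
  have hQc : Q.ncard = K.savings := by
    rw [hQdef, Set.ncard_image_of_injective _ (induceEmb G K.verts).injective, hQ'c]; rfl
  have hR : CoversOn G K.vertsᶜ R := by
    have := coversOn_image (delEmb G K.verts) hR'
    rwa [range_delEmb] at this
  have hQ : CoversOn G K.verts Q := by
    have := coversOn_image (induceEmb G K.verts) hQ'
    rwa [range_induceEmb] at this
  have hkeep : ∀ H : Comp G X, H ∉ K.discarded → compSet H ⊆ K.vertsᶜ := by
    intro H hH v hv hv'
    obtain ⟨H', hH', hv''⟩ := K.mem_verts.1 hv'
    exact hH (compSet_unique hv hv'' ▸ hH')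
  -- the chunks outside `A` that avoid `R`, and a vertex of each
  let B : Finset ↥(chunks G X d \ K.A) := Finset.univ.filter fun Z => Disjoint Z.1 R
  have hne : ∀ Z : ↥(chunks G X d \ K.A), ∃ z, z ∈ Z.1 := fun Z =>
    Set.one_le_encard_iff_nonempty.1 Z.2.1.2.2.1
  choose z hz using hne
  let T : Set V := (R ∩ X) ∪ z '' (B : Set _)
  have hTX : T ⊆ X := by
    rintro _ (h | ⟨Z, _, rfl⟩)
    · exact h.2
    · exact Z.2.1.1 (hz Z)
  have hTc : T.ncard ≤ (R ∩ X).ncard + B.card := by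
    refine (Set.ncard_union_le _ _).trans (Nat.add_le_add_left ?_ _)
    exact (Set.ncard_image_le (Set.toFinite _)).trans (by rw [Set.ncard_coe_finset])
  have hindep : G.IsIndepSet (X \ T) := by
    intro u hu v hv _ huv
    rcases hR (K.subset_compl_verts hu.1) (K.subset_compl_verts hv.1) huv with h | h
    · exact hu.2 (Or.inl ⟨h, hu.1⟩)
    · exact hv.2 (Or.inl ⟨h, hv.1⟩)
  have hfree : ∀ H : Comp G X, H ∉ blockedBy G X K.A → ¬ Blocks G (X \ T) H := by
    intro H hH hb
    obtain ⟨Z, hZ, hZT, hbZ⟩ := exists_chunk_blocks hd Set.sdiff_subset hindep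
      (hC.toSimpleGraph_mem hG H) hb
    have hZA : Z ∉ K.A := fun h => hH ⟨Z, h, hbZ⟩
    have hZB : (⟨Z, hZ, hZA⟩ : ↥(chunks G X d \ K.A)) ∈ B := by
      simp only [B, Finset.mem_filter, Finset.mem_univ, true_and]
      rw [Set.disjoint_left]
      intro v hv hvR
      exact (hZT hv).2 (Or.inl ⟨hvR, (hZT hv).1⟩)
    exact (hZT (hz ⟨Z, hZ, hZA⟩)).2 (Or.inr ⟨_, hZB, rfl⟩)
  choose! P hPsub hPcov hPc hPN using fun H h => exists_cover_of_not_blocks (hfree H h)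
  let S : Set V := T ∪ {v | ∃ H : Comp G X, v ∈ compSet H ∧
    if H ∈ blockedBy G X K.A then v ∈ R else v ∈ P H}
  have hSH : ∀ {H : Comp G X} {v}, v ∈ compSet H →
      (v ∈ S ↔ if H ∈ blockedBy G X K.A then v ∈ R else v ∈ P H) := by
    intro H v hv
    constructor
    · rintro (h | ⟨H', hv', h⟩)
      · exact (notMem_of_mem_compSet hv (hTX h)).elim
      · exact compSet_unique hv' hv ▸ h
    · intro h
      exact Or.inr ⟨H, hv, h⟩
  have hnd : ∀ H : Comp G X, H ∈ blockedBy G X K.A → H ∉ K.discarded := fun H h h' => h'.1 h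
  have cross : ∀ u v, u ∈ X → v ∉ X → G.Adj u v → u ∈ S ∨ v ∈ S := by
    intro u v hu hv huv
    by_cases huT : u ∈ T
    · exact Or.inl (Or.inl huT)
    right
    obtain ⟨H, hH⟩ := exists_mem_compSet (G := G) hv
    rw [hSH hH]
    split_ifs with hb
    · exact (hR (K.subset_compl_verts hu) (hkeep H (hnd H hb) hH) huv).resolve_left
        fun h => huT (Or.inl ⟨h, hu⟩)
    · exact hPN H hb u ⟨hu, huT⟩ v hH huv
  have hS : G.IsVertexCover S := by
    intro u v huv
    by_cases hu : u ∈ X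
    · by_cases hv : v ∈ X
      · rcases hR (K.subset_compl_verts hu) (K.subset_compl_verts hv) huv with h | h
        · exact Or.inl (Or.inl (Or.inl ⟨h, hu⟩))
        · exact Or.inr (Or.inl (Or.inl ⟨h, hv⟩))
      · exact cross u v hu hv huv
    · by_cases hv : v ∈ X
      · exact (cross v u hv hu huv.symm).symm
      · obtain ⟨H, hH⟩ := exists_mem_compSet (G := G) hu
        have hH' := mem_compSet_of_adj hH hv huv
        rw [hSH hH, hSH hH']
        split_ifs with hb
        · exact hR (hkeep H (hnd H hb) hH) (hkeep H (hnd H hb) hH') huv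
        · exact hPcov H hb hH hH' huv
  have hSX : (S ∩ X).ncard ≤ (R ∩ X).ncard + B.card := by
    refine le_trans (Set.ncard_le_ncard ?_) hTc
    rintro v ⟨h | ⟨H, hv, _⟩, hX⟩
    · exact h
    · exact (notMem_of_mem_compSet hv hX).elim
  have hcomp : ∀ H : Comp G X, (S ∩ compSet H).ncard + (if H ∈ B.image K.mate then 1 else 0) ≤
      (R ∩ compSet H).ncard + (Q ∩ compSet H).ncard := by
    intro H
    by_cases hb : H ∈ blockedBy G X K.A
    · have h1 : S ∩ compSet H = R ∩ compSet H := by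
        ext v
        refine and_congr_left fun hv => ?_
        rw [hSH hv, if_pos hb]
      have h2 : H ∉ B.image K.mate := by
        intro h
        obtain ⟨Z, _, rfl⟩ := Finset.mem_image.1 h
        exact K.mate_notMem Z hb
      rw [h1, if_neg h2]; omega
    · have h1 : (S ∩ compSet H).ncard = opt H.toSimpleGraph := by
        rw [← hPc H hb]
        congr 1
        ext v
        refine ⟨fun h => ?_, fun h => ⟨?_, hPsub H hb h⟩⟩
        · have := (hSH h.2).1 h.1
          rwa [if_neg hb] at this
        · rw [hSH (hPsub H hb h), if_neg hb]
          exact h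
      rw [h1]
      by_cases hm : H ∈ Set.range K.mate
      · have hkeepH := hkeep H fun h => h.2 hm
        have hRH : CoversOn G (compSet H) R := fun u v hu hv => hR (hkeepH hu) (hkeepH hv)
        split_ifs with hB
        · obtain ⟨Z, hZ, rfl⟩ := Finset.mem_image.1 hB
          refine (lt_ncard_of_blocks (K.mate_adj Z) hRH ?_).trans (Nat.le_add_right _ _)
          intro u hu v hv huv
          have hdis : Disjoint Z.1 R := (Finset.mem_filter.1 hZ).2
          exact (hR (K.subset_compl_verts (Z.2.1.1 hu)) (hkeepH hv) huv).resolve_left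
            (Set.disjoint_left.1 hdis hu)
        · exact (opt_le_of_coversOn (compEmb H) hRH).trans (Nat.le_add_right _ _)
      · have h2 : H ∉ B.image K.mate := by
          intro h
          obtain ⟨Z, _, rfl⟩ := Finset.mem_image.1 h
          exact hm ⟨Z, rfl⟩
        rw [if_neg h2, add_zero]
        refine (opt_le_of_coversOn (compEmb H) fun u v hu hv huv => ?_).trans
          (Nat.le_add_left _ _)
        exact hQ (K.mem_verts.2 ⟨H, ⟨hb, hm⟩, hu⟩) (K.mem_verts.2 ⟨H, ⟨hb, hm⟩, hv⟩) huv
  have hsum := Finset.sum_le_sum fun H (_ : H ∈ Finset.univ) => hcomp H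
  rw [Finset.sum_add_distrib, Finset.sum_add_distrib, Finset.sum_ite_mem, Finset.univ_inter,
    Finset.sum_const, smul_eq_mul, mul_one, Finset.card_image_of_injective _ K.mate_injective]
    at hsum
  have e1 := ncard_eq_sum_compSet (G := G) (X := X) S
  have e2 := ncard_eq_sum_compSet (G := G) (X := X) R
  have e3 := ncard_eq_sum_compSet (G := G) (X := X) Q
  have := opt_le hS
  omega

theorem opt_eq [Finite V] {C : GraphClass} (hd : C.blockingSize = d) (hC : C.ComponentClosed)
    (hG : C.Mem (del G X)) : opt G = opt K.rest + K.savings :=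
  le_antisymm (K.opt_le_opt_rest_add_savings hd hC hG) K.opt_rest_add_savings_le

theorem hasVC_rest_iff [Finite V] {C : GraphClass} (hd : C.blockingSize = d)
    (hC : C.ComponentClosed) (hG : C.Mem (del G X)) (k : ℤ) :
    HasVC K.rest (k - K.savings) ↔ HasVC G k := by
  rw [hasVC_iff, hasVC_iff, K.opt_eq hd hC hG]
  push_cast
  omega

/-- The inclusion of the reduced graph without the modulator. -/
def restEmb : del K.rest K.restX ↪g del G X where
  toFun v := ⟨v.1.1, v.2⟩
  inj' _ _ h := Subtype.ext (Subtype.ext (Subtype.mk.inj h))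
  map_rel_iff' := Iff.rfl

theorem range_restEmb : Set.range K.restEmb =
    {v | (del G X).connectedComponentMk v ∉ K.discarded} := by
  ext v
  constructor
  · rintro ⟨⟨⟨v, hv⟩, hX⟩, rfl⟩ h
    exact hv ⟨hX, h⟩
  · intro hv
    refine ⟨⟨⟨v.1, ?_⟩, v.2⟩, rfl⟩
    rintro ⟨_, h⟩
    exact hv h

theorem mem_rest [Finite V] {C : GraphClass} (hC : C.ComponentClosed) (hG : C.Mem (del G X)) :
    C.Mem (del K.rest K.restX) := by
  refine C.iso (nonempty_iso_of_range_eq (induceEmb (del G X) _) K.restEmb ?_)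
    (hC (del G X) K.discardedᶜ hG)
  rw [range_induceEmb, range_restEmb]
  rfl

theorem mem_induce_verts [Finite V] {C : GraphClass} (hC : C.ComponentClosed)
    (hG : C.Mem (del G X)) : C.Mem (G.induce K.verts) := by
  refine C.iso (nonempty_iso_of_range_eq ((induceEmb (del G X) _).trans (delEmb G X))
    (induceEmb G K.verts) ?_) (hC (del G X) K.discarded hG)
  rw [range_induceEmb]
  ext v
  constructor
  · rintro ⟨⟨w, hw⟩, rfl⟩
    exact ⟨w.2, hw⟩
  · rintro ⟨h, hv⟩
    exact ⟨⟨⟨v, h⟩, hv⟩, rfl⟩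

theorem ncard_chunks_le [Finite V] : (chunks G X d).ncard ≤ X.ncard ^ d := by
  have h1 : chunks G X d ⊆ Set.range fun f : Fin d → X => Set.range fun i => (f i).1 := by
    rintro Z ⟨hZX, _, h1, hd⟩
    have : Nonempty Z := (Set.one_le_encard_iff_nonempty.1 h1).to_subtype
    have : Fintype Z := Fintype.ofFinite _
    have hc : Fintype.card Z ≤ Fintype.card (Fin d) := by
      rw [Fintype.card_fin, ← Nat.card_eq_fintype_card, Nat.card_coe_set_eq]
      rw [← Z.toFinite.cast_ncard_eq] at hd
      exact_mod_cast hd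
    obtain ⟨e⟩ := Function.Embedding.nonempty_of_card_le hc
    refine ⟨fun i => ⟨(Function.invFun e i).1, hZX (Function.invFun e i).2⟩, ?_⟩
    ext v
    constructor
    · rintro ⟨i, rfl⟩
      exact (Function.invFun e i).2
    · intro hv
      exact ⟨e ⟨v, hv⟩, by simp [Function.leftInverse_invFun e.injective _]⟩
  refine (Set.ncard_le_ncard h1).trans ?_
  rw [← Set.image_univ]
  refine (Set.ncard_image_le (Set.toFinite _)).trans ?_
  rw [Set.ncard_univ, Nat.card_fun, Nat.card_coe_set_eq, Nat.card_fin]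

theorem card_comp_rest_le [Finite V] : Nat.card (Comp K.rest K.restX) ≤ X.ncard ^ d := by
  have hadj : ∀ a v, (del G X).Adj (K.restEmb a) v → v ∈ Set.range K.restEmb := by
    intro a v h
    have ha : K.restEmb a ∈ Set.range K.restEmb := ⟨a, rfl⟩
    rw [range_restEmb] at ha ⊢
    change (del G X).connectedComponentMk v ∉ K.discarded
    rwa [← SimpleGraph.ConnectedComponent.connectedComponentMk_eq_of_adj h]
  let F : Comp K.rest K.restX → ↥(K.discardedᶜ) := fun H =>
    ⟨H.map K.restEmb.toHom, by
      obtain ⟨v, rfl⟩ := H.exists_rep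
      have ha : K.restEmb v ∈ Set.range K.restEmb := ⟨v, rfl⟩
      rw [range_restEmb] at ha
      exact ha⟩
  have hF : Function.Injective F := by
    intro H H' h
    obtain ⟨v, rfl⟩ := H.exists_rep
    obtain ⟨w, rfl⟩ := H'.exists_rep
    have h' := congrArg Subtype.val h
    exact SimpleGraph.ConnectedComponent.sound
      (reachable_of_embedding K.restEmb hadj (SimpleGraph.ConnectedComponent.exact h'))
  refine (Nat.card_le_card_of_injective F hF).trans ?_
  rw [Nat.card_coe_set_eq]
  have hsub : K.discardedᶜ ⊆ blockedBy G X K.A ∪ Set.range K.mate := by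
    intro H hH
    by_contra h
    rw [Set.mem_union, not_or] at h
    exact hH h
  have h1 : (blockedBy G X K.A).ncard ≤ K.A.ncard := by
    rcases K.deficient with h | h
    · rw [h]; simp [blockedBy]
    · exact h.le
  have h2 : (Set.range K.mate).ncard = (chunks G X d \ K.A).ncard := by
    rw [← Set.image_univ, Set.ncard_image_of_injective _ K.mate_injective, Set.ncard_univ,
      Nat.card_coe_set_eq]
  have h3 := Set.ncard_sdiff_add_ncard_of_subset K.A_subset
  have h4 := ncard_chunks_le (G := G) (X := X) (d := d)
  have h5 := (Set.ncard_le_ncard hsub).trans (Set.ncard_union_le _ _)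
  omega

end Crown

end Safety

end VCKernel

namespace VCKernel

/-! ### Matching by an auction -/

section Auction

variable {γ ι : Type}

/-- An item of the auction: its name, its current price and its current owner. -/
abbrev Item (γ ι : Type) : Type := ι × ℕ × Option γ

variable (adj : γ → ι → Bool) (L : ℕ)

/-- One step in the search for a cheapest item of price less than `L` that the bidder `z` accepts;
the state consists of the best item so far and of all other items. -/
def pickStep (z : γ) (s : Option (Item γ ι) × List (Item γ ι)) (x : Item γ ι) :
    Option (Item γ ι) × List (Item γ ι) :=
  if (adj z x.1 && (decide (x.2.1 < L) && s.1.elim true fun y => decide (x.2.1 < y.2.1))) = true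
  then (some x, s.1.toList ++ s.2) else (s.1, x :: s.2)

/-- A cheapest item of price less than `L` that the bidder `z` accepts, and the other items. -/
def pick (z : γ) (I : List (Item γ ι)) : Option (Item γ ι) × List (Item γ ι) :=
  I.foldl (pickStep adj L z) (none, [])

/-- The first bidder `z` of the queue buys a cheapest acceptable item, raises its price by one and
sends the previous owner back to the queue; if there is no acceptable item of price less than `L`,
then `z` leaves the auction. -/
def auctionStep (s : List γ × List (Item γ ι)) : List γ × List (Item γ ι) :=
  match s.1 with
  | [] => s
  | z :: Q => (pick adj L z s.2).1.elim (Q, s.2) fun x =>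
      (x.2.2.toList ++ Q, (x.1, x.2.1 + 1, some z) :: (pick adj L z s.2).2)

/-- The auction, run for a given number of steps. -/
def auction (n : ℕ) (cs : List γ) (is : List ι) : List γ × List (Item γ ι) :=
  (List.replicate n ()).foldl (fun s _ => auctionStep adj L s) (cs, is.map fun i => (i, 0, none))

variable {adj L}

theorem pick_spec (z : γ) (I : List (Item γ ι)) :
    ((pick adj L z I).1.toList ++ (pick adj L z I).2).Perm I ∧
    ((pick adj L z I).1 = none → ∀ x ∈ I, adj z x.1 = true → L ≤ x.2.1) ∧
    (∀ x, (pick adj L z I).1 = some x → adj z x.1 = true ∧ x.2.1 < L ∧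
      ∀ y ∈ I, adj z y.1 = true → x.2.1 ≤ y.2.1) := by
  induction I using List.reverseRecOn with
  | nil => simp [pick]
  | append_singleton I x ih =>
    obtain ⟨h1, h2, h3⟩ := ih
    have e : pick adj L z (I ++ [x]) = pickStep adj L z (pick adj L z I) x := by
      simp [pick]
    rw [e]
    generalize pick adj L z I = s at h1 h2 h3
    obtain ⟨b, r⟩ := s
    have hperm : (b.toList ++ x :: r).Perm (I ++ [x]) :=
      List.perm_middle.trans ((List.Perm.cons x h1).trans
        (List.perm_append_singleton x I).symm)
    unfold pickStep
    split_ifs with hc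
    · simp only [Bool.and_eq_true, decide_eq_true_eq] at hc
      obtain ⟨ha, hL, hb⟩ := hc
      have hperm' : (x :: (b.toList ++ r)).Perm (I ++ [x]) := List.perm_middle.symm.trans hperm
      refine ⟨hperm', by simp, ?_⟩
      rintro _ ⟨⟩
      refine ⟨ha, hL, fun y hy hay => ?_⟩
      rcases List.mem_append.1 hy with hy | hy
      · cases b with
        | none => exact hL.le.trans (h2 rfl y hy hay)
        | some w =>
          simp only [Option.elim, decide_eq_true_eq] at hb
          exact hb.le.trans ((h3 w rfl).2.2 y hy hay)
      · rw [List.mem_singleton.1 hy]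
    · simp only [Bool.and_eq_true, decide_eq_true_eq, not_and] at hc
      refine ⟨hperm, fun hb y hy hay => ?_, fun w hw => ?_⟩
      · simp only at hb
        subst hb
        rcases List.mem_append.1 hy with hy | hy
        · exact h2 rfl y hy hay
        · rw [List.mem_singleton.1 hy] at hay ⊢
          by_contra hlt
          exact hc hay (by omega) rfl
      · simp only at hw
        subst hw
        obtain ⟨w1, w2, w3⟩ := h3 w rfl
        refine ⟨w1, w2, fun y hy hay => ?_⟩
        rcases List.mem_append.1 hy with hy | hy
        · exact w3 y hy hay
        · rw [List.mem_singleton.1 hy] at hay ⊢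
          by_contra hlt
          refine hc hay (by omega) ?_
          simp only [Option.elim, decide_eq_true_eq]
          omega

/-- The invariant of the auction: prices stay at most `L`; exactly the items of price zero have no
owner; an owner has paid at most one more than the cheapest item acceptable to it; and everybody who
has left the auction accepts only items of price at least `L`. -/
structure AuctionInv (adj : γ → ι → Bool) (L : ℕ) (cs : List γ) (is : List ι)
    (s : List γ × List (Item γ ι)) : Prop where
  perm : (s.2.map Prod.fst).Perm is
  nodup : (s.1 ++ s.2.filterMap fun x => x.2.2).Nodup
  mem : ∀ z ∈ s.1 ++ s.2.filterMap (fun x => x.2.2), z ∈ cs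
  price : ∀ x ∈ s.2, x.2.1 ≤ L ∧ (x.2.1 = 0 ↔ x.2.2 = none)
  tight : ∀ x ∈ s.2, ∀ z, x.2.2 = some z →
    adj z x.1 = true ∧ ∀ y ∈ s.2, adj z y.1 = true → x.2.1 ≤ y.2.1 + 1
  total : ∀ z ∈ cs, z ∈ s.1 ∨ (∃ x ∈ s.2, x.2.2 = some z) ∨
    ∀ y ∈ s.2, adj z y.1 = true → L ≤ y.2.1

theorem AuctionInv.init {cs : List γ} (hcs : cs.Nodup) (is : List ι) :
    AuctionInv adj L cs is (cs, is.map fun i => (i, 0, none)) where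
  perm := by simp [Function.comp_def]
  nodup := by simpa [List.filterMap_map] using hcs
  mem := by simp [List.filterMap_map]
  price := by simp
  tight := by simp
  total := fun z hz => Or.inl hz

theorem AuctionInv.step {cs : List γ} {is : List ι} {s : List γ × List (Item γ ι)}
    (h : AuctionInv adj L cs is s) : AuctionInv adj L cs is (auctionStep adj L s) := by
  obtain ⟨Q, I⟩ := s
  cases Q with
  | nil => exact h
  | cons z Q =>
    obtain ⟨p1, p2, p3⟩ := pick_spec (adj := adj) (L := L) z I
    have e : auctionStep adj L (z :: Q, I) = (pick adj L z I).1.elim (Q, I) fun x =>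
      (x.2.2.toList ++ Q, (x.1, x.2.1 + 1, some z) :: (pick adj L z I).2) := rfl
    rw [e]
    generalize pick adj L z I = s at p1 p2 p3
    obtain ⟨b, r⟩ := s
    cases b with
    | none =>
      refine ⟨h.perm, (List.nodup_cons.1 h.nodup).2, fun w hw => h.mem w (List.mem_cons_of_mem _ hw),
        h.price, h.tight, fun w hw => ?_⟩
      rcases h.total w hw with h1 | h1
      · rcases List.mem_cons.1 h1 with rfl | h1
        · exact Or.inr (Or.inr (p2 rfl))
        · exact Or.inl h1
      · exact Or.inr h1
    | some x =>
      obtain ⟨hax, hxL, hmin⟩ := p3 x rfl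
      have p1' : (x :: r).Perm I := p1
      have hown : (x.2.2.toList ++ Q ++ z :: r.filterMap fun x => x.2.2).Perm
          (z :: Q ++ I.filterMap fun x => x.2.2) := by
        have h1 : (I.filterMap fun x => x.2.2).Perm
            (x.2.2.toList ++ r.filterMap fun x => x.2.2) := by
          refine (p1'.symm.filterMap _).trans ?_
          rw [List.filterMap_cons]
          cases x.2.2 <;> simp
        refine List.perm_middle.trans (List.Perm.cons z ?_)
        refine List.Perm.trans ?_ (List.Perm.append_left Q h1.symm)
        rw [← List.append_assoc]
        exact List.Perm.append_right _ List.perm_append_comm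
      have hmemI : ∀ y, y ∈ (x.1, x.2.1 + 1, some z) :: r →
          ∃ y' ∈ I, y'.1 = y.1 ∧ y'.2.1 ≤ y.2.1 := by
        intro y hy
        rcases List.mem_cons.1 hy with rfl | hy
        · exact ⟨x, p1'.subset (by simp), rfl, Nat.le_succ _⟩
        · exact ⟨y, p1'.subset (by simp [hy]), rfl, le_rfl⟩
      have hmemI' : ∀ y ∈ r, y ∈ I := fun y hy => p1'.subset (by simp [hy])
      refine ⟨?_, ?_, ?_, ?_, ?_, ?_⟩
      · exact (p1'.map Prod.fst).trans h.perm
      · simpa using hown.nodup_iff.2 h.nodup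
      · intro w hw
        exact h.mem w (hown.subset (by simpa using hw))
      · intro y hy
        rcases List.mem_cons.1 hy with rfl | hy
        · exact ⟨hxL, by simp⟩
        · exact h.price y (hmemI' y hy)
      · intro y hy w hw
        rcases List.mem_cons.1 hy with rfl | hy
        · simp only [Option.some.injEq] at hw
          subst hw
          refine ⟨hax, fun y hy hay => ?_⟩
          obtain ⟨y', hy', e1, e2⟩ := hmemI y hy
          have := hmin y' hy' (e1 ▸ hay)
          simp only
          omega
        · obtain ⟨t1, t2⟩ := h.tight y (hmemI' y hy) w hw
          refine ⟨t1, fun v hv hav => ?_⟩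
          obtain ⟨v', hv', e1, e2⟩ := hmemI v hv
          have := t2 v' hv' (e1 ▸ hav)
          omega
      · intro w hw
        rcases h.total w hw with h1 | ⟨y, hy, hyw⟩ | h1
        · rcases List.mem_cons.1 h1 with rfl | h1
          · exact Or.inr (Or.inl ⟨_, List.mem_cons_self, rfl⟩)
          · exact Or.inl (List.mem_append_right _ h1)
        · rcases List.mem_cons.1 (p1'.symm.subset hy) with rfl | hy
          · exact Or.inl (List.mem_append_left _ (by simp [hyw]))
          · exact Or.inr (Or.inl ⟨y, List.mem_cons_of_mem _ hy, hyw⟩)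
        · refine Or.inr (Or.inr fun y hy hay => ?_)
          obtain ⟨y', hy', e1, e2⟩ := hmemI y hy
          exact (h1 y' hy' (e1 ▸ hay)).trans e2

/-- The sum of all prices. -/
def totalPrice (I : List (Item γ ι)) : ℕ := (I.map fun x => x.2.1).sum

theorem AuctionInv.totalPrice_le {cs : List γ} {is : List ι} {s : List γ × List (Item γ ι)}
    (h : AuctionInv adj L cs is s) : totalPrice s.2 ≤ is.length * L := by
  have h1 := List.sum_le_card_nsmul (s.2.map fun x => x.2.1) L (by
    intro n hn
    obtain ⟨x, hx, rfl⟩ := List.mem_map.1 hn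
    exact (h.price x hx).1)
  have h2 := h.perm.length_eq
  rw [List.length_map] at h1 h2
  rwa [h2] at h1

theorem auctionStep_progress (z : γ) (Q : List γ) (I : List (Item γ ι)) :
    2 * totalPrice I + Q.length + 2 ≤
      2 * totalPrice (auctionStep adj L (z :: Q, I)).2 +
        2 * (Q.length + 1) - (auctionStep adj L (z :: Q, I)).1.length ∧
    (auctionStep adj L (z :: Q, I)).1.length ≤ Q.length + 1 := by
  obtain ⟨p1, -, -⟩ := pick_spec (adj := adj) (L := L) z I
  have e : auctionStep adj L (z :: Q, I) = (pick adj L z I).1.elim (Q, I) fun x =>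
    (x.2.2.toList ++ Q, (x.1, x.2.1 + 1, some z) :: (pick adj L z I).2) := rfl
  rw [e]
  generalize pick adj L z I = s at p1
  obtain ⟨b, r⟩ := s
  cases b with
  | none => simp only [Option.elim]; omega
  | some x =>
    have p1' : (x :: r).Perm I := p1
    have h1 : totalPrice I = x.2.1 + totalPrice r := by
      have := (p1'.map fun x => x.2.1).sum_eq
      simpa [totalPrice] using this.symm
    have h2 : totalPrice ((x.1, x.2.1 + 1, some z) :: r) = x.2.1 + 1 + totalPrice r := by
      simp [totalPrice]
    have h3 : (x.2.2.toList ++ Q).length ≤ Q.length + 1 := by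
      cases x.2.2 <;> simp
    simp only [Option.elim]
    omega

theorem auction_inv {cs : List γ} (hcs : cs.Nodup) (is : List ι) (n : ℕ) :
    AuctionInv adj L cs is (auction adj L n cs is) := by
  induction n with
  | zero => exact .init hcs is
  | succ n ih =>
    have : auction adj L (n + 1) cs is = auctionStep adj L (auction adj L n cs is) := by
      simp [auction, List.replicate_succ']
    rw [this]
    exact ih.step

/-- The auction ends: each step makes somebody leave or raises the price of an item. -/
theorem auction_queue_eq_nil {cs : List γ} (hcs : cs.Nodup) {is : List ι} {n : ℕ}
    (hn : cs.length + 2 * (is.length * L) ≤ n) : (auction adj L n cs is).1 = [] := by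
  have key : ∀ n, (auction adj L n cs is).1 = [] ∨
      n + (auction adj L n cs is).1.length ≤
        cs.length + 2 * totalPrice (auction adj L n cs is).2 := by
    intro n
    induction n with
    | zero => right; simp [auction]
    | succ n ih =>
      have e : auction adj L (n + 1) cs is = auctionStep adj L (auction adj L n cs is) := by
        simp [auction, List.replicate_succ']
      rw [e]
      generalize auction adj L n cs is = s at ih
      obtain ⟨Q, I⟩ := s
      cases Q with
      | nil => left; rfl
      | cons z Q =>
        right
        have := auctionStep_progress (adj := adj) (L := L) z Q I
        simp only [List.length_cons, reduceCtorEq, false_or] at ih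
        omega
  rcases key n with h | h
  · exact h
  · have := (auction_inv (adj := adj) (L := L) hcs is n).totalPrice_le
    rw [← List.length_eq_zero_iff]
    omega

/-- When the auction is over, some price level `ℓ < L` is unused. The bidders that accept only items
of price more than `ℓ` form a deficient set if somebody has left, and all others own an item of price
less than `ℓ`. -/
theorem AuctionInv.exists_matching {cs : List γ} {is : List ι} {I : List (Item γ ι)}
    (h : AuctionInv adj L cs is ([], I)) (his : is.Nodup) (hL : is.length < L) :
    ∃ A : Set γ, A ⊆ {z | z ∈ cs} ∧
      (A = ∅ ∨ {i | i ∈ is ∧ ∃ z ∈ A, adj z i = true}.ncard < A.ncard) ∧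
      ∃ mate : ∀ z : γ, z ∈ cs → z ∉ A → ι,
        (∀ z hz hA, mate z hz hA ∈ is ∧ adj z (mate z hz hA) = true ∧
          ∀ z' ∈ A, ¬ adj z' (mate z hz hA) = true) ∧
        (∀ z hz hA z' hz' hA', mate z hz hA = mate z' hz' hA' → z = z') ∧
        ∀ x ∈ I, ((∀ z ∈ A, ¬ adj z x.1 = true) ∧ ∀ z hz hA, mate z hz hA ≠ x.1) ↔ x.2.1 = 0 := by
  classical
  have hnd : (I.map Prod.fst).Nodup := h.perm.nodup_iff.2 his
  have huniq : ∀ x ∈ I, ∀ y ∈ I, x.1 = y.1 → x = y := fun x hx y hy e =>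
    List.inj_on_of_nodup_map hnd hx hy e
  have hmemis : ∀ x ∈ I, x.1 ∈ is := fun x hx => h.perm.subset (List.mem_map_of_mem hx)
  have hitem : ∀ i ∈ is, ∃ x ∈ I, x.1 = i := fun i hi => by
    simpa using h.perm.symm.subset hi
  have hown : ∀ x ∈ I, ∀ z, x.2.2 = some z → z ∈ cs := fun x hx z hz =>
    h.mem z (List.mem_append_right _ (List.mem_filterMap.2 ⟨x, hx, hz⟩))
  have hfun : ∀ x ∈ I, ∀ y ∈ I, ∀ z, x.2.2 = some z → y.2.2 = some z → x = y := by
    have hnd' : (I.filterMap fun x => x.2.2).Nodup := by simpa using h.nodup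
    clear * - hnd'
    induction I with
    | nil => simp
    | cons w I ih =>
      intro x hx y hy z hxz hyz
      rw [List.filterMap_cons] at hnd'
      cases hw : w.2.2 with
      | none =>
        rw [hw] at hnd'
        rcases List.mem_cons.1 hx with rfl | hx
        · simp [hw] at hxz
        rcases List.mem_cons.1 hy with rfl | hy
        · simp [hw] at hyz
        exact ih hnd' x hx y hy z hxz hyz
      | some v =>
        rw [hw] at hnd'
        obtain ⟨h1, h2⟩ := List.nodup_cons.1 hnd'
        rcases List.mem_cons.1 hx with rfl | hx' <;> rcases List.mem_cons.1 hy with rfl | hy'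
        · rfl
        · rw [hw] at hxz
          cases hxz
          exact (h1 (List.mem_filterMap.2 ⟨y, hy', hyz⟩)).elim
        · rw [hw] at hyz
          cases hyz
          exact (h1 (List.mem_filterMap.2 ⟨x, hx', hxz⟩)).elim
        · exact ih h2 x hx' y hy' z hxz hyz
  have hpos : ∀ x ∈ I, x.2.1 ≠ 0 → ∃ z, x.2.2 = some z := fun x hx h0 =>
    Option.ne_none_iff_exists'.1 fun hn => h0 ((h.price x hx).2.2 hn)
  by_cases hall : ∀ z ∈ cs, ∃ x ∈ I, x.2.2 = some z
  · choose m hmI hmo using hall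
    refine ⟨∅, by simp, Or.inl rfl, fun z hz _ => (m z hz).1, ?_, ?_, ?_⟩
    · intro z hz _
      exact ⟨hmemis _ (hmI z hz), (h.tight _ (hmI z hz) z (hmo z hz)).1, by simp⟩
    · intro z hz _ z' hz' _ e
      have := huniq _ (hmI z hz) _ (hmI z' hz') e
      have h1 := hmo z hz
      rw [this, hmo z' hz'] at h1
      exact (Option.some.inj h1).symm
    · intro x hx
      constructor
      · rintro ⟨-, h2⟩
        by_contra h0
        obtain ⟨z, hz⟩ := hpos x hx h0
        have hzc := hown x hx z hz
        exact h2 z hzc (by simp) (congrArg Prod.fst (hfun _ (hmI z hzc) _ hx z (hmo z hzc) hz))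
      · intro h0
        refine ⟨by simp, fun z hz _ e => ?_⟩
        have h1 := hmo z hz
        rw [huniq _ (hmI z hz) _ hx e, (h.price x hx).2.1 h0] at h1
        simp at h1
  · push Not at hall
    obtain ⟨z0, hz0, hz0'⟩ := hall
    -- an unused price level exists since there are fewer than `L` items
    obtain ⟨l, hlL, hl⟩ : ∃ l < L, ∀ x ∈ I, x.2.1 ≠ l := by
      have hlen := h.perm.length_eq
      rw [List.length_map] at hlen
      have h1 : (I.map fun x => x.2.1).toFinset.card < (Finset.range L).card := by
        refine (List.toFinset_card_le _).trans_lt ?_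
        rw [List.length_map, Finset.card_range]
        simp only at hlen
        omega
      obtain ⟨l, hl, hl'⟩ := Finset.exists_mem_notMem_of_card_lt_card h1
      refine ⟨l, Finset.mem_range.1 hl, fun x hx e => hl' ?_⟩
      rw [List.mem_toFinset]
      exact List.mem_map.2 ⟨x, hx, e⟩
    let A : Set γ := {z | z ∈ cs ∧ ∀ y ∈ I, adj z y.1 = true → l < y.2.1}
    have hz0A : z0 ∈ A := by
      refine ⟨hz0, fun y hy hay => ?_⟩
      rcases h.total z0 hz0 with h1 | ⟨x, hx, hx'⟩ | h1
      · simp at h1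
      · exact (hz0' x hx hx').elim
      · exact hlL.trans_le (h1 y hy hay)
    have hAown : ∀ x ∈ I, l < x.2.1 → ∃ z ∈ A, x.2.2 = some z := by
      intro x hx hlx
      obtain ⟨z, hz⟩ := hpos x hx (by omega)
      refine ⟨z, ⟨hown x hx z hz, fun y hy hay => ?_⟩, hz⟩
      have h1 := (h.tight x hx z hz).2 y hy hay
      have h2 := hl y hy
      omega
    have hlow : ∀ z, z ∈ cs → z ∉ A → ∃ x ∈ I, x.2.2 = some z ∧ x.2.1 < l := by
      intro z hz hzA
      have : ∃ y ∈ I, adj z y.1 = true ∧ y.2.1 ≤ l := by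
        by_contra hcon
        push Not at hcon
        exact hzA ⟨hz, hcon⟩
      obtain ⟨y, hy, hay, hyl⟩ := this
      have hyl' := hl y hy
      rcases h.total z hz with h1 | ⟨x, hx, hx'⟩ | h1
      · simp at h1
      · refine ⟨x, hx, hx', ?_⟩
        have h1 := (h.tight x hx z hx').2 y hy hay
        have h2 := hl x hx
        omega
      · have := h1 y hy hay
        omega
    choose m hmI hmo hml using hlow
    refine ⟨A, fun z hz => hz.1, Or.inr ?_, fun z hz hA => (m z hz hA).1, ?_, ?_, ?_⟩
    · -- the owners of the items of price more than `l` are in `A`, but `z0` owns nothing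
      have hAfin : A.Finite := (List.finite_toSet cs).subset fun z hz => hz.1
      let J : Set (Item γ ι) := {x | x ∈ I ∧ ∃ z ∈ A, x.2.2 = some z}
      have hJ : J.Finite := (List.finite_toSet I).subset fun x hx => hx.1
      have h0 : {i | i ∈ is ∧ ∃ z ∈ A, adj z i = true} ⊆ Prod.fst '' J := by
        rintro i ⟨hi, z, hz, hzi⟩
        obtain ⟨x, hx, rfl⟩ := hitem i hi
        exact ⟨x, ⟨hx, hAown x hx (hz.2 x hx hzi)⟩, rfl⟩
      let o : Item γ ι → γ := fun x => x.2.2.getD z0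
      have h1 : o '' J ⊆ A \ {z0} := by
        rintro _ ⟨x, ⟨hx, z, hz, hxz⟩, rfl⟩
        have e : o x = z := by simp [o, hxz]
        rw [e]
        refine ⟨hz, fun e' => hz0' x hx ?_⟩
        rw [hxz, Set.mem_singleton_iff.1 e']
      have h2 : Set.InjOn o J := by
        rintro x ⟨hx, z, hz, hxz⟩ y ⟨hy, z', hz', hyz⟩ e
        have e' : z = z' := by simpa [o, hxz, hyz] using e
        subst e'
        exact hfun x hx y hy z hxz hyz
      refine (Set.ncard_le_ncard h0 (hJ.image _)).trans_lt ((Set.ncard_image_le hJ).trans_lt ?_)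
      rw [← h2.ncard_image]
      refine (Set.ncard_le_ncard h1 (hAfin.subset Set.sdiff_subset)).trans_lt ?_
      exact Set.ncard_sdiff_singleton_lt_of_mem hz0A hAfin
    · intro z hz hA
      refine ⟨hmemis _ (hmI z hz hA), (h.tight _ (hmI z hz hA) z (hmo z hz hA)).1, ?_⟩
      intro z' hz' hadj
      have := hz'.2 _ (hmI z hz hA) hadj
      have := hml z hz hA
      omega
    · intro z hz hA z' hz' hA' e
      have := huniq _ (hmI z hz hA) _ (hmI z' hz' hA') e
      have h1 := hmo z hz hA
      rw [this, hmo z' hz' hA'] at h1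
      exact (Option.some.inj h1).symm
    · intro x hx
      constructor
      · rintro ⟨h1, h2⟩
        by_contra h0
        obtain ⟨z, hz⟩ := hpos x hx h0
        have hzc := hown x hx z hz
        by_cases hA : z ∈ A
        · exact h1 z hA (h.tight x hx z hz).1
        · exact h2 z hzc hA (congrArg Prod.fst
            (hfun _ (hmI z hzc hA) _ hx z (hmo z hzc hA) hz))
      · intro h0
        refine ⟨fun z hz hadj => ?_, fun z hz hA e => ?_⟩
        · have := hz.2 x hx hadj
          omega
        · have h1 := hmo z hz hA
          rw [huniq _ (hmI z hz hA) _ hx e, (h.price x hx).2.1 h0] at h1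
          simp at h1

/-- An auction in which the bidders represent the chunks and the items represent the components
yields a set of chunks and a matching as in the reduction rule; the discarded components are the
items of price zero. -/
theorem exists_crown {V : Type} [Finite V] {G : SimpleGraph V} {X : Set V} {d : ℕ}
    {cs : List γ} {is : List ι} {I : List (Item γ ι)} {ofSet : Set V → γ}
    {ofComp : Comp G X → ι} (h : AuctionInv adj L cs is ([], I)) (his : is.Nodup)
    (hL : is.length < L) (hset : Set.InjOn ofSet (chunks G X d))
    (hcs : ∀ z, z ∈ cs ↔ ∃ Z ∈ chunks G X d, ofSet Z = z)
    (hcomp : Function.Injective ofComp) (hsurj : ∀ i, i ∈ is ↔ ∃ H, ofComp H = i)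
    (hadj : ∀ Z ∈ chunks G X d, ∀ H, adj (ofSet Z) (ofComp H) = true ↔ Blocks G Z H) :
    ∃ K : Crown G X d, ∀ x ∈ I, ∀ H, ofComp H = x.1 → (H ∈ K.discarded ↔ x.2.1 = 0) := by
  obtain ⟨A, hA, hdef, mate, hm, hminj, hdisc⟩ := h.exists_matching his hL
  let A' : Set (Set V) := {Z | Z ∈ chunks G X d ∧ ofSet Z ∈ A}
  have himage : ofSet '' A' = A := by
    ext z
    constructor
    · rintro ⟨Z, hZ, rfl⟩
      exact hZ.2
    · intro hz
      obtain ⟨Z, hZ, rfl⟩ := (hcs z).1 (hA hz)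
      exact ⟨Z, ⟨hZ, hz⟩, rfl⟩
  have hblocked : ∀ H, H ∈ blockedBy G X A' ↔ ∃ z ∈ A, adj z (ofComp H) = true := by
    intro H
    constructor
    · rintro ⟨Z, ⟨hZ, hZA⟩, hb⟩
      exact ⟨_, hZA, (hadj Z hZ H).2 hb⟩
    · rintro ⟨z, hz, hzH⟩
      obtain ⟨Z, hZ, rfl⟩ := (hcs z).1 (hA hz)
      exact ⟨Z, ⟨hZ, hz⟩, (hadj Z hZ H).1 hzH⟩
  have hZcs : ∀ Z : ↥(chunks G X d \ A'), ofSet Z.1 ∈ cs := fun Z => (hcs _).2 ⟨Z.1, Z.2.1, rfl⟩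
  have hZA : ∀ Z : ↥(chunks G X d \ A'), ofSet Z.1 ∉ A := fun Z h => Z.2.2 ⟨Z.2.1, h⟩
  have hmate : ∀ Z : ↥(chunks G X d \ A'), ∃ H, ofComp H = mate _ (hZcs Z) (hZA Z) :=
    fun Z => (hsurj _).1 (hm _ (hZcs Z) (hZA Z)).1
  choose m hmm using hmate
  let K : Crown G X d :=
    { A := A'
      A_subset := fun Z hZ => hZ.1
      deficient := by
        rcases hdef with rfl | hdef
        · exact Or.inl (Set.image_eq_empty.1 himage)
        · right
          have hinj : Set.InjOn ofSet A' := hset.mono fun Z hZ => hZ.1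
          rw [← hinj.ncard_image, himage, ← Set.ncard_image_of_injective _ hcomp]
          refine lt_of_le_of_lt (Set.ncard_le_ncard ?_ ?_) hdef
          · rintro _ ⟨H, hH, rfl⟩
            exact ⟨(hsurj _).2 ⟨H, rfl⟩, (hblocked H).1 hH⟩
          · exact (List.finite_toSet is).subset fun i hi => hi.1
      mate := m
      mate_injective := by
        intro Z Z' e
        have h1 := congrArg ofComp e
        rw [hmm, hmm] at h1
        exact Subtype.ext (hset Z.2.1 Z'.2.1 (hminj _ _ _ _ _ _ h1))
      mate_adj := by
        intro Z
        have h1 := (hm _ (hZcs Z) (hZA Z)).2.1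
        rw [← hmm] at h1
        exact (hadj Z.1 Z.2.1 _).1 h1
      mate_notMem := by
        intro Z hb
        obtain ⟨z, hz, hzH⟩ := (hblocked _).1 hb
        rw [hmm] at hzH
        exact (hm _ (hZcs Z) (hZA Z)).2.2 z hz hzH }
  refine ⟨K, fun x hx H hH => ?_⟩
  rw [← hdisc x hx, ← hH]
  change (H ∉ blockedBy G X A' ∧ H ∉ Set.range m) ↔ _
  rw [hblocked]
  refine and_congr (by push Not; rfl) ⟨fun h1 z hz hzA e => ?_, ?_⟩
  · obtain ⟨Z, hZ, rfl⟩ := (hcs z).1 hz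
    refine h1 ⟨⟨Z, hZ, fun h2 => hzA h2.2⟩, hcomp ?_⟩
    rw [hmm, e]
  · rintro h1 ⟨Z, rfl⟩
    exact h1 _ (hZcs Z) (hZA Z) (hmm Z).symm

end Auction

theorem nonempty_crown {V : Type} [Finite V] (G : SimpleGraph V) (X : Set V) (d : ℕ) :
    Nonempty (Crown G X d) := by
  classical
  have : Fintype (Comp G X) := Fintype.ofFinite _
  have : Fintype (Set V) := Fintype.ofFinite _
  let cs := (Finset.univ.filter fun Z => Z ∈ chunks G X d).toList
  let is := (Finset.univ : Finset (Comp G X)).toList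
  let adj : Set V → Comp G X → Bool := fun Z H => decide (Blocks G Z H)
  let n := cs.length + 2 * (is.length * (is.length + 1))
  have h := auction_inv (adj := adj) (L := is.length + 1) (Finset.nodup_toList _ : cs.Nodup) is n
  have hQ := auction_queue_eq_nil (adj := adj) (L := is.length + 1)
    (Finset.nodup_toList _ : cs.Nodup) (is := is) (n := n) le_rfl
  generalize auction adj (is.length + 1) n cs is = s at h hQ
  obtain ⟨Q, I⟩ := s
  simp only at hQ
  subst hQ
  obtain ⟨K, -⟩ := exists_crown (ofSet := fun Z : Set V => Z) (ofComp := fun H : Comp G X => H)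
    (d := d) h (Finset.nodup_toList _) (Nat.lt_succ_self _) (fun _ _ _ _ e => e)
    (fun Z => by simp) (fun _ _ e => e) (fun H => by simp [is]) (fun Z _ H => by simp [adj])
  exact ⟨K⟩

end VCKernel

namespace VCKernel

open TreeCode

/-! ### Vertex sets and graphs as lists -/

/-- The sublist of `l` at the positions that are marked in `m`. -/
def select {β : Type} (m : List Bool) (l : List β) : List β :=
  ((m.zip l).filter fun p => p.1).map fun p => p.2

/-- Two sets of vertices, given by characteristic vectors, intersect. -/
def meets (r s : List Bool) : Bool := (r.zip s).any fun p => p.1 && p.2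

/-- The vertices with a neighbour in the set `r`. -/
def nbr (M : List (List Bool)) (r : List Bool) : List Bool := M.map fun s => meets s r

/-- Complement of a characteristic vector. -/
def rowNot (r : List Bool) : List Bool := r.map fun b => !b

/-- Union of characteristic vectors. -/
def rowOr (r s : List Bool) : List Bool := (r.zip s).map fun p => p.1 || p.2

/-- Intersection of characteristic vectors. -/
def rowAnd (r s : List Bool) : List Bool := (r.zip s).map fun p => p.1 && p.2

/-- Equality of characteristic vectors of the same length. -/
def rowEq (r s : List Bool) : Bool := (r.zip s).all fun p => (p.1 && p.2) || (!p.1 && !p.2)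

/-- The adjacency matrix of the subgraph induced by the set `m`. -/
def induceMat (m : List Bool) (M : List (List Bool)) : List (List Bool) :=
  (select m M).map fun r => select m r

/-- The set of vertices that can be reached from `r` without entering `X`; as many rounds as there
are vertices suffice. -/
def reach (M : List (List Bool)) (X r : List Bool) : List Bool :=
  M.foldl (fun s _ => rowOr s (rowAnd (nbr M s) (rowNot X))) r

/-- The size of the set with the given characteristic vector. -/
def count (r : List Bool) : ℕ := (r.filter fun b => b).length

/-- The subsets of size at most `d` of a set. -/
def subsets (d : ℕ) (A : List Bool) : List (List Bool) :=
  A.foldr (fun b acc => acc.map (fun m => false :: m) ++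
    if b = true then (acc.filter fun m => decide (count m < d)).map (fun m => true :: m) else [])
    [[]]

/-- Removal of duplicates. -/
def dedupRows (l : List (List Bool)) : List (List Bool) :=
  l.foldr (fun a acc => if (acc.any fun b => rowEq a b) = true then acc else a :: acc) []

/-- The chunks. -/
def chunkRows (d : ℕ) (M : List (List Bool)) (X : List Bool) : List (List Bool) :=
  (subsets d X).filter fun z => (z.any fun b => b) && !meets z (nbr M z)

/-- The connected components of the graph without `X`. -/
def compRows (M : List (List Bool)) (X : List Bool) : List (List Bool) :=
  dedupRows (((subsets 1 (rowNot X)).filter fun z => z.any fun b => b).map fun z => reach M X z)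

section Semantics

variable {n : ℕ}

open Classical in
/-- The characteristic vector of a set of vertices. -/
noncomputable def row (S : Set (Fin n)) : List Bool := (List.finRange n).map fun i => decide (i ∈ S)

/-- The adjacency matrix of a graph. -/
noncomputable def mat (G : SimpleGraph (Fin n)) : List (List Bool) :=
  (List.finRange n).map fun i => row (G.neighborSet i)

theorem encList_map {α β : Type} (f : β → Tr) (g : α → β) (l : List α) :
    encList f (l.map g) = encList (fun a => f (g a)) l := by
  induction l with
  | nil => rfl
  | cons a l ih => simp [encList, ih]

theorem enc_row (S : Set (Fin n)) : enc (row S) = encSet S := by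
  unfold encSet row
  rw [List.ofFn_eq_map]
  rfl

theorem enc_mat (G : SimpleGraph (Fin n)) : enc (mat G) = encGraph G := by
  unfold encGraph mat
  rw [List.ofFn_eq_map]
  change encList enc _ = _
  rw [encList_map, encList_map]
  exact congrArg (fun f => encList f (List.finRange n)) (funext fun i => enc_row _)

theorem length_row (S : Set (Fin n)) : (row S).length = n := by simp [row]

theorem length_mat (G : SimpleGraph (Fin n)) : (mat G).length = n := by simp [mat]

theorem row_injective : Function.Injective (row (n := n)) := by
  intro S T h
  ext i
  have := List.map_inj_left.1 h i (List.mem_finRange i)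
  simpa using this

theorem mat_injective : Function.Injective (mat (n := n)) := by
  intro G H h
  ext i j
  have := row_injective (List.map_inj_left.1 h i (List.mem_finRange i))
  exact Set.ext_iff.1 this j

theorem zip_finRange {α β : Type} (f : Fin n → α) (g : Fin n → β) :
    ((List.finRange n).map f).zip ((List.finRange n).map g) =
      (List.finRange n).map fun i => (f i, g i) := by
  rw [List.zip_map']

open Classical in
/-- The members of a set of vertices in increasing order. -/
noncomputable def vlist (S : Set (Fin n)) : List (Fin n) :=
  (List.finRange n).filter fun i => decide (i ∈ S)

theorem mem_vlist {S : Set (Fin n)} {i : Fin n} : i ∈ vlist S ↔ i ∈ S := by simp [vlist]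

theorem nodup_vlist (S : Set (Fin n)) : (vlist S).Nodup := (List.nodup_finRange n).filter _

theorem length_vlist (S : Set (Fin n)) : (vlist S).length = S.ncard := by
  classical
  rw [← List.toFinset_card_of_nodup (nodup_vlist S), ← Set.ncard_coe_finset]
  congr 1
  ext i
  simp [mem_vlist]

/-- The subgraph induced by `S`, with its vertices renumbered. -/
noncomputable def subgr (G : SimpleGraph (Fin n)) (S : Set (Fin n)) :
    SimpleGraph (Fin (vlist S).length) := G.comap (vlist S).get

/-- The inclusion of the renumbered induced subgraph. -/
noncomputable def subEmb (G : SimpleGraph (Fin n)) (S : Set (Fin n)) : subgr G S ↪g G where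
  toFun := (vlist S).get
  inj' := (nodup_vlist S).injective_get
  map_rel_iff' := Iff.rfl

theorem range_subEmb (G : SimpleGraph (Fin n)) (S : Set (Fin n)) :
    Set.range (subEmb G S) = S := by
  ext i
  refine Iff.trans ?_ (mem_vlist (S := S))
  rw [List.mem_iff_get]
  rfl

theorem select_row {β : Type} (S : Set (Fin n)) (g : Fin n → β) :
    select (row S) ((List.finRange n).map g) = (vlist S).map g := by
  unfold select row vlist
  rw [zip_finRange, List.filter_map, List.map_map]
  rfl

theorem map_vlist {β : Type} (S : Set (Fin n)) (g : Fin n → β) :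
    (vlist S).map g = (List.finRange (vlist S).length).map fun a => g ((vlist S).get a) := by
  conv_lhs => rw [← List.map_get_finRange (vlist S)]
  rw [List.map_map]
  rfl

theorem select_row_row (G : SimpleGraph (Fin n)) (S T : Set (Fin n)) :
    select (row S) (row T) = row (subEmb G S ⁻¹' T) := by
  unfold row
  rw [← row, select_row, map_vlist]
  rfl

theorem induceMat_row (G : SimpleGraph (Fin n)) (S : Set (Fin n)) :
    induceMat (row S) (mat G) = mat (subgr G S) := by
  unfold induceMat mat
  rw [select_row, List.map_map, map_vlist]
  refine List.map_congr_left fun a _ => ?_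
  exact select_row_row G S _

theorem meets_row (S T : Set (Fin n)) : meets (row S) (row T) = true ↔ (S ∩ T).Nonempty := by
  unfold meets row
  rw [zip_finRange, List.any_map, List.any_eq_true]
  simp [Set.Nonempty]

theorem nbr_row (G : SimpleGraph (Fin n)) (S : Set (Fin n)) :
    nbr (mat G) (row S) = row {v | ∃ z ∈ S, G.Adj z v} := by
  unfold nbr mat
  rw [List.map_map]
  refine List.map_congr_left fun i _ => ?_
  rw [Function.comp_apply, Bool.eq_iff_iff, meets_row]
  simp only [decide_eq_true_eq]
  constructor
  · rintro ⟨z, h1, h2⟩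
    exact ⟨z, h2, h1.symm⟩
  · rintro ⟨z, h1, h2⟩
    exact ⟨z, h2.symm, h1⟩

theorem rowNot_row (S : Set (Fin n)) : rowNot (row S) = row Sᶜ := by
  unfold rowNot row
  rw [List.map_map]
  refine List.map_congr_left fun i _ => ?_
  by_cases h : i ∈ S <;> simp [h]

theorem rowOr_row (S T : Set (Fin n)) : rowOr (row S) (row T) = row (S ∪ T) := by
  unfold rowOr row
  rw [zip_finRange, List.map_map]
  refine List.map_congr_left fun i _ => ?_
  by_cases h : i ∈ S <;> by_cases h' : i ∈ T <;> simp [h, h']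

theorem rowAnd_row (S T : Set (Fin n)) : rowAnd (row S) (row T) = row (S ∩ T) := by
  unfold rowAnd row
  rw [zip_finRange, List.map_map]
  refine List.map_congr_left fun i _ => ?_
  by_cases h : i ∈ S <;> by_cases h' : i ∈ T <;> simp [h, h']

theorem rowEq_row (S T : Set (Fin n)) : rowEq (row S) (row T) = true ↔ S = T := by
  unfold rowEq row
  rw [zip_finRange, List.all_map, List.all_eq_true, Set.ext_iff]
  refine ⟨fun h i => ?_, fun h i _ => ?_⟩
  · have := h i (List.mem_finRange i)
    by_cases h1 : i ∈ S <;> by_cases h2 : i ∈ T <;> simp_all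
  · have := h i
    by_cases h1 : i ∈ S <;> by_cases h2 : i ∈ T <;> simp_all

theorem any_row (S : Set (Fin n)) : ((row S).any fun b => b) = true ↔ S.Nonempty := by
  unfold row
  rw [List.any_map, List.any_eq_true]
  simp [Set.Nonempty]

theorem count_row (S : Set (Fin n)) : count (row S) = S.ncard := by
  rw [← length_vlist]
  unfold count row vlist
  rw [List.filter_map, List.length_map]
  rfl

theorem reach_row (G : SimpleGraph (Fin n)) (X : Set (Fin n)) {v : Fin n} (hv : v ∉ X) :
    reach (mat G) (row X) (row {v}) =
      row (compSet ((del G X).connectedComponentMk ⟨v, hv⟩)) := by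
  let f : Set (Fin n) → Set (Fin n) := fun S => S ∪ ({w | ∃ z ∈ S, G.Adj z w} ∩ Xᶜ)
  have h1 : ∀ (l : List (List Bool)) (S : Set (Fin n)),
      l.foldl (fun s _ => rowOr s (rowAnd (nbr (mat G) s) (rowNot (row X)))) (row S) =
        row (f^[l.length] S) := by
    intro l
    induction l with
    | nil => intro S; rfl
    | cons r l ih =>
      intro S
      have e : rowOr (row S) (rowAnd (nbr (mat G) (row S)) (rowNot (row X))) = row (f S) := by
        rw [nbr_row, rowNot_row, rowAnd_row, rowOr_row]
      rw [List.foldl_cons, e, ih]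
      rfl
  have hmono : ∀ k S, S ⊆ f^[k] S := by
    intro k
    induction k with
    | zero => intro S; exact subset_rfl
    | succ k ih => intro S; exact (Set.subset_union_left).trans (ih (f S))
  have h2 : ∀ (w : ↥Xᶜ) (p : (del G X).Walk ⟨v, hv⟩ w), w.1 ∈ f^[p.length] {v} := by
    intro w p
    generalize hu : (⟨v, hv⟩ : ↥Xᶜ) = u at p
    have hu' : v = u.1 := congrArg Subtype.val hu
    rw [hu']
    clear hu hu' hv
    induction p using SimpleGraph.Walk.concatRec with
    | Hnil => exact Set.mem_singleton _
    | @Hconcat u a b p hadj ih =>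
      rw [SimpleGraph.Walk.length_concat, Function.iterate_succ_apply']
      exact Or.inr ⟨⟨a.1, ih, hadj⟩, b.2⟩
  have h3 : ∀ k, f^[k] {v} ⊆ compSet ((del G X).connectedComponentMk ⟨v, hv⟩) := by
    intro k
    induction k with
    | zero =>
      rintro w rfl
      exact mem_compSet.2 ⟨hv, rfl⟩
    | succ k ih =>
      rw [Function.iterate_succ_apply']
      rintro w (hw | ⟨⟨z, hz, hzw⟩, hwX⟩)
      · exact ih hw
      · exact mem_compSet_of_adj (ih hz) hwX hzw
  unfold reach
  rw [h1, length_mat]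
  congr 1
  refine (h3 n).antisymm fun w hw => ?_
  obtain ⟨hwX, hw⟩ := mem_compSet.1 hw
  obtain ⟨p, hp⟩ := (SimpleGraph.ConnectedComponent.exact hw).symm.exists_isPath
  have hlen : p.length ≤ n := by
    have : Fintype ↥Xᶜ := Fintype.ofFinite _
    have h4 := hp.length_lt
    have h5 : Fintype.card ↥Xᶜ ≤ Fintype.card (Fin n) :=
      Fintype.card_le_of_injective Subtype.val Subtype.val_injective
    rw [Fintype.card_fin] at h5
    omega
  have h6 : f^[n] {v} = f^[n - p.length] (f^[p.length] {v}) := by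
    rw [← Function.iterate_add_apply, Nat.sub_add_cancel hlen]
  rw [h6]
  exact hmono _ _ (h2 _ p)

theorem mem_subsets {d : ℕ} {A m : List Bool} : m ∈ subsets d A ↔
    List.Forall₂ (fun a b => a = true → b = true) m A ∧ count m ≤ d := by
  induction A generalizing m with
  | nil => simp [subsets]; rintro rfl; simp [count]
  | cons b A ih =>
    have e : subsets d (b :: A) = (subsets d A).map (fun m => false :: m) ++
      if b = true then ((subsets d A).filter fun m => decide (count m < d)).map (fun m => true :: m)
      else [] := rfl
    rw [e, List.mem_append]
    cases m with
    | nil => cases b <;> simp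
    | cons a m =>
      rw [List.forall₂_cons]
      cases a <;> cases b <;> simp [ih, count]
      exact ⟨fun ⟨⟨h1, _⟩, h3⟩ => ⟨h1, of_decide_eq_true h3⟩,
        fun ⟨h1, h2⟩ => ⟨⟨h1, by omega⟩, decide_eq_true h2⟩⟩

theorem nodup_subsets (d : ℕ) (A : List Bool) : (subsets d A).Nodup := by
  induction A with
  | nil => simp [subsets]
  | cons b A ih =>
    have e : subsets d (b :: A) = (subsets d A).map (fun m => false :: m) ++
      if b = true then ((subsets d A).filter fun m => decide (count m < d)).map (fun m => true :: m)
      else [] := rfl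
    have h1 : ∀ c : Bool, Function.Injective fun m : List Bool => c :: m :=
      fun c => List.cons_injective
    rw [e]
    refine List.Nodup.append (ih.map (h1 _)) ?_ ?_
    · split_ifs
      · exact (ih.filter _).map (h1 _)
      · exact List.nodup_nil
    · intro m hm hm'
      obtain ⟨m', _, rfl⟩ := List.mem_map.1 hm
      split_ifs at hm' <;> simp at hm'

theorem length_of_mem_subsets {d : ℕ} {A m : List Bool} (h : m ∈ subsets d A) :
    m.length = A.length := (mem_subsets.1 h).1.length_eq

theorem mem_subsets_row {d : ℕ} {X : Set (Fin n)} {m : List Bool} :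
    m ∈ subsets d (row X) ↔ ∃ Z ⊆ X, Z.ncard ≤ d ∧ row Z = m := by
  rw [mem_subsets]
  constructor
  · rintro ⟨h1, h2⟩
    have hlen : m.length = n := by rw [h1.length_eq, length_row]
    have hm : row {i : Fin n | m[i.1]'(hlen.symm ▸ i.2) = true} = m := by
      refine List.ext_getElem (by rw [length_row, hlen]) fun i h3 h4 => ?_
      simp [row]
    refine ⟨_, fun i hi => ?_, ?_, hm⟩
    · have h5 := (List.forall₂_iff_get.1 h1).2 i.1 (hlen.symm ▸ i.2)
        (by rw [length_row]; exact i.2) hi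
      simpa [row] using h5
    · rwa [← count_row, hm]
  · rintro ⟨Z, hZX, hZ, rfl⟩
    refine ⟨?_, by rwa [count_row]⟩
    unfold row
    rw [List.forall₂_map_left_iff, List.forall₂_map_right_iff, List.forall₂_same]
    intro i _ h
    simp only [decide_eq_true_eq] at h ⊢
    exact hZX h

theorem mem_dedupRows {l : List (List Bool)} (hl : ∀ r ∈ l, ∃ S : Set (Fin n), row S = r) :
    (∀ r, r ∈ dedupRows l ↔ r ∈ l) ∧ (dedupRows l).Nodup := by
  induction l with
  | nil => simp [dedupRows]
  | cons a l ih =>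
    obtain ⟨h1, h2⟩ := ih fun r hr => hl r (List.mem_cons_of_mem _ hr)
    have e : dedupRows (a :: l) = if ((dedupRows l).any fun b => rowEq a b) = true then dedupRows l
      else a :: dedupRows l := rfl
    have h3 : ((dedupRows l).any fun b => rowEq a b) = true ↔ a ∈ dedupRows l := by
      rw [List.any_eq_true]
      obtain ⟨S, rfl⟩ := hl a List.mem_cons_self
      constructor
      · rintro ⟨b, hb, hab⟩
        obtain ⟨T, rfl⟩ := hl b (List.mem_cons_of_mem _ ((h1 b).1 hb))
        rwa [(rowEq_row S T).1 hab]
      · intro h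
        exact ⟨_, h, (rowEq_row S S).2 rfl⟩
    rw [e]
    split_ifs with hc
    · rw [h3] at hc
      refine ⟨fun r => ?_, h2⟩
      rw [h1, List.mem_cons, or_iff_right_of_imp]
      rintro rfl
      exact (h1 _).1 hc
    · rw [h3] at hc
      exact ⟨fun r => by rw [List.mem_cons, List.mem_cons, h1], List.nodup_cons.2 ⟨hc, h2⟩⟩

theorem mem_chunkRows {d : ℕ} {G : SimpleGraph (Fin n)} {X : Set (Fin n)} {r : List Bool} :
    r ∈ chunkRows d (mat G) (row X) ↔ ∃ Z ∈ chunks G X d, row Z = r := by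
  unfold chunkRows
  rw [List.mem_filter, mem_subsets_row]
  have hind : ∀ Z : Set (Fin n), (((row Z).any fun b => b) && !meets (row Z) (nbr (mat G) (row Z)))
      = true ↔ Z.Nonempty ∧ G.IsIndepSet Z := by
    intro Z
    rw [Bool.and_eq_true, any_row, Bool.not_eq_true', ← Bool.not_eq_true, nbr_row, meets_row]
    refine and_congr_right fun _ => ⟨fun h u hu v hv _ huv => h ⟨v, hv, u, hu, huv⟩, ?_⟩
    rintro h ⟨v, hv, u, hu, huv⟩
    exact h hu hv huv.ne huv
  constructor
  · rintro ⟨⟨Z, hZX, hZ, rfl⟩, h⟩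
    obtain ⟨h1, h2⟩ := (hind Z).1 h
    refine ⟨Z, ⟨hZX, h2, Set.one_le_encard_iff_nonempty.2 h1, ?_⟩, rfl⟩
    rw [← Z.toFinite.cast_ncard_eq]
    exact_mod_cast hZ
  · rintro ⟨Z, ⟨hZX, h2, h1, hZ⟩, rfl⟩
    rw [← Z.toFinite.cast_ncard_eq] at hZ
    exact ⟨⟨Z, hZX, by exact_mod_cast hZ, rfl⟩,
      (hind Z).2 ⟨Set.one_le_encard_iff_nonempty.1 h1, h2⟩⟩

theorem nodup_chunkRows (d : ℕ) (M : List (List Bool)) (X : List Bool) :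
    (chunkRows d M X).Nodup := (nodup_subsets d X).filter _

theorem compRows_spec (G : SimpleGraph (Fin n)) (X : Set (Fin n)) :
    (∀ r, r ∈ compRows (mat G) (row X) ↔ ∃ H : Comp G X, row (compSet H) = r) ∧
      (compRows (mat G) (row X)).Nodup := by
  have hmem : ∀ r, r ∈ ((subsets 1 (rowNot (row X))).filter fun z => z.any fun b => b).map
      (fun z => reach (mat G) (row X) z) ↔ ∃ H : Comp G X, row (compSet H) = r := by
    intro r
    rw [List.mem_map, rowNot_row]
    constructor
    · rintro ⟨z, hz, rfl⟩
      obtain ⟨hz1, hz2⟩ := List.mem_filter.1 hz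
      obtain ⟨Z, hZX, hZ, rfl⟩ := mem_subsets_row.1 hz1
      have hne := (any_row Z).1 hz2
      have h1 : Z.ncard = 1 := le_antisymm hZ ((Set.ncard_pos (Set.toFinite _)).2 hne)
      obtain ⟨v, rfl⟩ := Set.ncard_eq_one.1 h1
      exact ⟨_, (reach_row G X (hZX rfl)).symm⟩
    · rintro ⟨H, rfl⟩
      obtain ⟨v, hv⟩ := compSet_nonempty H
      obtain ⟨h, rfl⟩ := mem_compSet.1 hv
      refine ⟨row {v}, List.mem_filter.2 ⟨mem_subsets_row.2 ⟨{v}, ?_, by simp, rfl⟩, ?_⟩,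
        reach_row G X h⟩
      · rintro _ rfl
        exact h
      · exact (any_row _).2 ⟨v, rfl⟩
  have := mem_dedupRows (n := n) (l := ((subsets 1 (rowNot (row X))).filter
    fun z => z.any fun b => b).map (fun z => reach (mat G) (row X) z)) fun r hr => by
      obtain ⟨H, h⟩ := (hmem r).1 hr
      exact ⟨_, h⟩
  exact ⟨fun r => (this.1 r).trans (hmem r), this.2⟩

end Semantics

end VCKernel

namespace VCKernel

open TreeCode

/-! ### Binary numbers -/

/-- Successor of a binary number. -/
def inc : List Bool → List Bool
  | [] => [true]
  | b :: l => if b = true then false :: inc l else true :: l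

/-- Predecessor of a positive binary number. -/
def dec : List Bool → List Bool
  | [] => []
  | b :: l => if b = true then (if l.isEmpty = true then [] else false :: l) else true :: dec l

theorem bits_two_mul {m : ℕ} (h : m ≠ 0) : (2 * m).bits = false :: m.bits := Nat.bit0_bits m h

theorem bits_two_mul_add_one (m : ℕ) : (2 * m + 1).bits = true :: m.bits := Nat.bit1_bits m

theorem bits_eq_nil {m : ℕ} : m.bits = [] ↔ m = 0 := by
  constructor
  · intro h
    by_contra h0
    rcases Nat.even_or_odd' m with ⟨k, rfl | rfl⟩
    · rw [bits_two_mul (by omega)] at h; simp at h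
    · rw [bits_two_mul_add_one] at h; simp at h
  · rintro rfl; simp

theorem inc_bits (n : ℕ) : inc n.bits = (n + 1).bits := by
  induction n using Nat.strong_induction_on with
  | _ n ih =>
    rcases Nat.even_or_odd' n with ⟨m, rfl | rfl⟩
    · by_cases h : m = 0
      · subst h; simp [inc, Nat.one_bits]
      · rw [bits_two_mul h, bits_two_mul_add_one]; simp [inc]
    · rw [bits_two_mul_add_one, show 2 * m + 1 + 1 = 2 * (m + 1) by ring, bits_two_mul (by omega)]
      simp [inc, ih m (by omega)]

theorem dec_bits (n : ℕ) : dec (n + 1).bits = n.bits := by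
  induction n using Nat.strong_induction_on with
  | _ n ih =>
    rcases Nat.even_or_odd' n with ⟨m, rfl | rfl⟩
    · rw [bits_two_mul_add_one]
      by_cases h : m = 0
      · subst h; simp [dec]
      · have h1 : m.bits ≠ [] := fun e => h (bits_eq_nil.1 e)
        rw [bits_two_mul h]; simp [dec, h1]
    · rw [bits_two_mul_add_one, show 2 * m + 1 + 1 = 2 * (m + 1) by ring, bits_two_mul (by omega)]
      simp [dec, ih m (by omega)]

/-- Predecessor of an integer, given by sign and absolute value. -/
def intPred (x : Bool × List Bool) : Bool × List Bool :=
  if x.1 = true then (true, inc x.2)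
  else if x.2.isEmpty = true then (true, [true]) else (false, dec x.2)

/-- Sign and binary absolute value of an integer. -/
def intRep (k : ℤ) : Bool × List Bool := (decide (k < 0), k.natAbs.bits)

theorem enc_intRep (k : ℤ) : enc (intRep k) = encInt k := rfl

theorem intPred_intRep (k : ℤ) : intPred (intRep k) = intRep (k - 1) := by
  unfold intPred intRep
  rcases lt_trichotomy k 0 with h | rfl | h
  · have h1 : k - 1 < 0 := by omega
    have h2 : (k - 1).natAbs = k.natAbs + 1 := by omega
    simp [h, h1, h2, inc_bits]
  · simp [Nat.one_bits]
  · have h1 : ¬ k - 1 < 0 := by omega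
    have h2 : k.natAbs = (k - 1).natAbs + 1 := by omega
    have h3 : ((k - 1).natAbs + 1).bits ≠ [] := fun e => by simpa using bits_eq_nil.1 e
    rw [h2, dec_bits]
    simp [h.le, h1, h3]

/-- Subtraction of a unary number from an integer. -/
def intSub (x : Bool × List Bool) (n : ℕ) : Bool × List Bool :=
  (List.replicate n ()).foldl (fun y _ => intPred y) x

theorem intSub_intRep (k : ℤ) (n : ℕ) : intSub (intRep k) n = intRep (k - n) := by
  induction n with
  | zero => simp [intSub]
  | succ n ih =>
    have e : intSub (intRep k) (n + 1) = intPred (intSub (intRep k) n) := by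
      simp [intSub, List.replicate_succ']
    rw [e, ih, intPred_intRep]
    congr 1
    push_cast
    ring

theorem sz_bools_le (l : List Bool) : sz l ≤ 4 * l.length + 1 := by
  have := sz_le_of_forall l 3 fun b _ => sz_bool b
  omega

theorem length_inc_le (l : List Bool) : (inc l).length ≤ l.length + 1 := by
  induction l with
  | nil => simp [inc]
  | cons b l ih => cases b <;> simp [inc]; exact ih

theorem length_dec_le (l : List Bool) : (dec l).length ≤ l.length := by
  induction l with
  | nil => simp [dec]
  | cons b l ih =>
    cases b
    · simpa [dec] using ih
    · cases l <;> simp [dec]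

theorem length_bits_le (n : ℕ) : n.bits.length ≤ n := by
  induction n with
  | zero => simp
  | succ n ih => rw [← inc_bits]; exact (length_inc_le _).trans (by omega)

theorem sz_perm {α : Type} [TreeCode α] {l m : List α} (h : l.Perm m) : sz l = sz m := by
  induction h with
  | nil => rfl
  | cons a _ ih => rw [sz_cons, sz_cons, ih]
  | swap a b l => simp only [sz_cons]; omega
  | trans _ _ h1 h2 => exact h1.trans h2

theorem sz_toList {α : Type} [TreeCode α] (x : Option α) : sz x.toList = sz x := by
  cases x <;> rfl

/-- The vertex cover number, computed with a decision procedure for Vertex Cover: count the numbers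
less than `n` that are too small. The first component of the state is the binary counter. -/
def vcOpt (vc : List (List Bool) → List Bool → Bool) (M : List (List Bool)) : ℕ :=
  (M.foldl (fun s _ => if vc M s.1 = true then (inc s.1, s.2) else (inc s.1, s.2 + 1))
    (([] : List Bool), 0)).2

/-- The number of subsets of size `j` is at most `(n + 1) ^ j`. -/
theorem countP_subsets_le (d j : ℕ) (A : List Bool) :
    (subsets d A).countP (fun m => decide (count m = j)) ≤ (A.length + 1) ^ j := by
  induction A generalizing j with
  | nil => cases j <;> simp [subsets, count]
  | cons b A ih =>
    have e : subsets d (b :: A) = (subsets d A).map (fun m => false :: m) ++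
      if b = true then ((subsets d A).filter fun m => decide (count m < d)).map (fun m => true :: m)
      else [] := rfl
    have h1 : ((subsets d A).map (fun m => false :: m)).countP (fun m => decide (count m = j)) ≤
        (A.length + 1) ^ j := by
      rw [List.countP_map]
      exact ih j
    rw [e, List.countP_append, List.length_cons]
    cases j with
    | zero =>
      have h2 : (if b = true then ((subsets d A).filter fun m => decide (count m < d)).map
          (fun m => true :: m) else []).countP (fun m => decide (count m = 0)) = 0 := by
        rw [List.countP_eq_zero]
        intro m hm
        split_ifs at hm
        · obtain ⟨m', _, rfl⟩ := List.mem_map.1 hm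
          simp [count]
        · simp at hm
      rw [h2]
      simpa using h1
    | succ j =>
      have h2 : (if b = true then ((subsets d A).filter fun m => decide (count m < d)).map
          (fun m => true :: m) else []).countP (fun m => decide (count m = j + 1)) ≤
          (A.length + 1) ^ j := by
        split_ifs
        · rw [List.countP_map]
          refine le_trans ?_ (ih j)
          refine le_trans (List.Sublist.countP_le List.filter_sublist) (le_of_eq ?_)
          refine List.countP_congr fun m _ => ?_
          simp only [Function.comp_apply, decide_eq_true_eq]
          exact Nat.succ_inj
        · simp
      calc _ ≤ (A.length + 1) ^ (j + 1) + (A.length + 1) ^ j := Nat.add_le_add h1 h2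
        _ = (A.length + 1 + 1) * (A.length + 1) ^ j := by ring
        _ ≤ (A.length + 1 + 1) * (A.length + 1 + 1) ^ j := by gcongr; omega
        _ = _ := by ring

theorem length_subsets_le (d : ℕ) (A : List Bool) :
    (subsets d A).length ≤ (d + 1) * (A.length + 1) ^ d := by
  have h1 : ∀ (l : List (List Bool)), (∀ m ∈ l, count m ≤ d) →
      l.length ≤ ∑ j ∈ Finset.range (d + 1), l.countP fun m => decide (count m = j) := by
    intro l
    induction l with
    | nil => simp
    | cons m l ih =>
      intro h
      have h2 := ih fun m hm => h m (List.mem_cons_of_mem _ hm)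
      simp only [List.countP_cons, Finset.sum_add_distrib, List.length_cons, decide_eq_true_eq]
      have h3 : ∑ j ∈ Finset.range (d + 1), (if count m = j then 1 else 0) = 1 := by
        rw [Finset.sum_ite_eq, if_pos (Finset.mem_range.2 (Nat.lt_succ_of_le (h m (by simp))))]
      omega
  refine (h1 _ fun m hm => (mem_subsets.1 hm).2).trans ?_
  refine (Finset.sum_le_card_nsmul _ _ ((A.length + 1) ^ d) fun j hj => ?_).trans_eq (by simp)
  refine (countP_subsets_le d j A).trans (Nat.pow_le_pow_right (by omega) ?_)
  exact Nat.lt_succ_iff.1 (Finset.mem_range.1 hj)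

theorem dedupRows_sublist (l : List (List Bool)) : (dedupRows l).Sublist l := by
  induction l with
  | nil => exact List.Sublist.refl _
  | cons a l ih =>
    have e : dedupRows (a :: l) = if ((dedupRows l).any fun b => rowEq a b) = true then dedupRows l
      else a :: dedupRows l := rfl
    rw [e]
    split_ifs
    · exact ih.cons a
    · exact ih.cons_cons a

/-! ### The list functions run in polynomial time -/

namespace PolyOn

variable {α β γ ι : Type} [TreeCode α] [TreeCode β] [TreeCode γ] [TreeCode ι] {D : α → Prop}

/-- A function of the context alone, in an enlarged context. -/
theorem ctx {f : α → β} (hf : PolyOn D f) : PolyOn (fun x : α × γ => D x.1) fun x => f x.1 :=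
  hf.comp PolyOn.id.fst fun _ h => h

theorem toList {f : α → Option β} (hf : PolyOn D f) : PolyOn D fun a => (f a).toList :=
  (of_expr (D := fun _ => True) (f := fun x : Option β => x.toList) .reg
    fun x _ => by cases x <;> rfl).comp hf fun _ _ => trivial

theorem select {m : α → List Bool} {l : α → List β} (hm : PolyOn D m) (hl : PolyOn D l) :
    PolyOn D fun a => select (m a) (l a) :=
  ((hm.zip hl).filter (f := fun _ (p : Bool × β) => p.1) (E := fun _ => True) PolyOn.id.snd.fst
    fun _ _ _ _ => trivial).map (f := fun _ (p : Bool × β) => p.2) (E := fun _ => True) PolyOn.id.snd.snd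
    fun _ _ _ _ => trivial

section Rows

variable {r s X : α → List Bool} {M : α → List (List Bool)}

theorem meets (hr : PolyOn D r) (hs : PolyOn D s) : PolyOn D fun a => meets (r a) (s a) :=
  (hr.zip hs).any (f := fun _ (p : Bool × Bool) => p.1 && p.2) (E := fun _ => True)
    (PolyOn.id.snd.fst.and PolyOn.id.snd.snd) fun _ _ _ _ => trivial

theorem nbr (hM : PolyOn D M) (hr : PolyOn D r) : PolyOn D fun a => nbr (M a) (r a) :=
  hM.map (f := fun a s => VCKernel.meets s (r a)) (E := fun x => D x.1)
    (meets PolyOn.id.snd hr.ctx) fun _ _ h _ => h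

theorem rowNot (hr : PolyOn D r) : PolyOn D fun a => rowNot (r a) :=
  hr.map (f := fun _ b => !b) (E := fun _ => True) PolyOn.id.snd.not fun _ _ _ _ => trivial

theorem rowOr (hr : PolyOn D r) (hs : PolyOn D s) : PolyOn D fun a => rowOr (r a) (s a) :=
  (hr.zip hs).map (f := fun _ (p : Bool × Bool) => p.1 || p.2) (E := fun _ => True)
    (PolyOn.id.snd.fst.or PolyOn.id.snd.snd) fun _ _ _ _ => trivial

theorem rowAnd (hr : PolyOn D r) (hs : PolyOn D s) : PolyOn D fun a => rowAnd (r a) (s a) :=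
  (hr.zip hs).map (f := fun _ (p : Bool × Bool) => p.1 && p.2) (E := fun _ => True)
    (PolyOn.id.snd.fst.and PolyOn.id.snd.snd) fun _ _ _ _ => trivial

theorem rowEq (hr : PolyOn D r) (hs : PolyOn D s) : PolyOn D fun a => rowEq (r a) (s a) :=
  (hr.zip hs).all (f := fun _ (p : Bool × Bool) => (p.1 && p.2) || (!p.1 && !p.2)) (E := fun _ => True)
    ((PolyOn.id.snd.fst.and PolyOn.id.snd.snd).or (PolyOn.id.snd.fst.not.and PolyOn.id.snd.snd.not))
    fun _ _ _ _ => trivial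

theorem anyTrue (hr : PolyOn D r) : PolyOn D fun a => (r a).any fun b => b :=
  hr.any (f := fun _ b => b) (E := fun _ => True) PolyOn.id.snd fun _ _ _ _ => trivial

theorem induceMat (hr : PolyOn D r) (hM : PolyOn D M) :
    PolyOn D fun a => induceMat (r a) (M a) :=
  (hr.select hM).map (f := fun a s => VCKernel.select (r a) s) (E := fun x => D x.1)
    (hr.ctx.select PolyOn.id.snd) fun _ _ h _ => h

theorem count (hr : PolyOn D r) : PolyOn D fun a => count (r a) :=
  (hr.filter (f := fun _ b => b) (E := fun _ => True) PolyOn.id.snd fun _ _ _ _ => trivial).length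

theorem reach (hM : PolyOn D M) (hX : PolyOn D X) (hr : PolyOn D r) :
    PolyOn D fun a => reach (M a) (X a) (r a) := by
  refine foldl (E := fun x => D x.1) (g := fun a => 4 * sz (r a) + 1)
    (step := fun a s _ => VCKernel.rowOr s
      (VCKernel.rowAnd (VCKernel.nbr (M a) s) (VCKernel.rowNot (X a))))
    hM hr ?_ (fun a _ _ _ h _ => h) (((PolyBdd.const 4).mul hr.sz_bdd).add (.const 1)) ?_
  · exact PolyOn.id.snd.fst.rowOr ((hM.ctx.nbr PolyOn.id.snd.fst).rowAnd hX.ctx.rowNot)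
  · intro a p _ _ _
    have h1 : ∀ (p : List (List Bool)) (s : List Bool), (p.foldl (fun s _ => VCKernel.rowOr s
        (VCKernel.rowAnd (VCKernel.nbr (M a) s) (VCKernel.rowNot (X a)))) s).length ≤
        s.length := by
      intro p
      induction p with
      | nil => intro s; exact le_rfl
      | cons b p ih =>
        intro s
        refine (ih _).trans ?_
        unfold VCKernel.rowOr
        rw [List.length_map, List.length_zip]
        exact min_le_left _ _
    have h2 := h1 p (r a)
    have h3 := length_le_sz (r a)
    refine (sz_bools_le _).trans ?_
    omega

theorem subsets (d : ℕ) (hr : PolyOn D r) : PolyOn D fun a => subsets d (r a) := by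
  have hstep : PolyOn (fun _ : α × List (List Bool) × Bool => True)
      fun x => x.2.1.map (fun m => false :: m) ++ if x.2.2 = true then
        (x.2.1.filter fun m => decide (VCKernel.count m < d)).map (fun m => true :: m) else [] := by
    refine (PolyOn.id.snd.fst.map (f := fun _ m => false :: m) (E := fun _ => True)
      ((const_bool false).cons PolyOn.id.snd) fun _ _ _ _ => trivial).append
      (PolyOn.id.snd.snd.ite ?_ const_nil)
    exact (PolyOn.id.snd.fst.filter (f := fun _ m => decide (VCKernel.count m < d))
      (E := fun _ => True) (PolyOn.id.snd.count.lt (const_nat d)) fun _ _ _ _ => trivial).map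
      (f := fun _ m => true :: m) (E := fun _ => True)
      ((const_bool true).cons PolyOn.id.snd) fun _ _ _ _ => trivial
  refine foldr (E := fun _ => True)
    (g := fun a => (d + 1) * sz (r a) ^ d * (4 * sz (r a) + 2) + 1)
    (i := fun _ => [[]]) (step := fun _ b acc => acc.map (fun m => false :: m) ++ if b = true then
        (acc.filter fun m => decide (VCKernel.count m < d)).map (fun m => true :: m) else [])
    hr (const_nil.cons const_nil) hstep (fun _ _ _ _ _ _ => trivial) ?_ ?_
  · exact ((((PolyBdd.const _).mul (hr.sz_bdd.pow d)).mul
      (((PolyBdd.const 4).mul hr.sz_bdd).add (.const 2))).add (.const 1))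
  · intro a p q _ h
    have h1 := (sz_le_of_eq_append h).2
    have h2 := length_le_sz q
    have h3 := sz_pos q
    have h4 := length_subsets_le d q
    have h5 : (d + 1) * (q.length + 1) ^ d ≤ (d + 1) * sz (r a) ^ d := by
      by_cases hq : q.length = 0
      · rw [hq]
        have := Nat.pow_le_pow_left (show 0 + 1 ≤ sz (r a) by omega) d
        gcongr
      · gcongr; omega
    refine (sz_le_of_forall (VCKernel.subsets d q) (4 * sz (r a) + 1) fun m hm => ?_).trans ?_
    · refine (sz_bools_le m).trans ?_
      rw [length_of_mem_subsets hm]; omega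
    · have := h4.trans h5
      gcongr

theorem dedupRows (hM : PolyOn D M) : PolyOn D fun a => dedupRows (M a) := by
  refine foldr (E := fun _ => True) (g := fun a => sz (M a)) (i := fun _ => [])
    (step := fun _ b acc => if (acc.any fun c => VCKernel.rowEq b c) = true then acc else b :: acc)
    hM const_nil ?_ (fun _ _ _ _ _ _ => trivial) hM.sz_bdd ?_
  · refine ite ?_ PolyOn.id.snd.fst (PolyOn.id.snd.snd.cons PolyOn.id.snd.fst)
    exact PolyOn.id.snd.fst.any (f := fun (x : α × List (List Bool) × List Bool) (c : List Bool) =>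
      VCKernel.rowEq x.2.2 c) (E := fun _ => True)
      (PolyOn.id.fst.snd.snd.rowEq PolyOn.id.snd) fun _ _ _ _ => trivial
  · intro a p q _ h
    exact (sz_sublist (dedupRows_sublist q)).trans (sz_le_of_eq_append h).2

theorem chunkRows (d : ℕ) (hM : PolyOn D M) (hX : PolyOn D X) :
    PolyOn D fun a => chunkRows d (M a) (X a) :=
  (hX.subsets d).filter
    (f := fun a (z : List Bool) => (z.any fun b => b) && !VCKernel.meets z (VCKernel.nbr (M a) z))
    (E := fun x => D x.1)
    (PolyOn.id.snd.anyTrue.and (PolyOn.id.snd.meets (hM.ctx.nbr PolyOn.id.snd)).not)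
    fun _ _ h _ => h

theorem compRows (hM : PolyOn D M) (hX : PolyOn D X) :
    PolyOn D fun a => compRows (M a) (X a) :=
  (((hX.rowNot.subsets 1).filter (f := fun _ (z : List Bool) => z.any fun b => b) (E := fun _ => True)
    PolyOn.id.snd.anyTrue fun _ _ _ _ => trivial).map
    (f := fun a z => VCKernel.reach (M a) (X a) z) (E := fun x => D x.1)
    (hM.ctx.reach hX.ctx PolyOn.id.snd) fun _ _ h _ => h).dedupRows

end Rows

/-! ### Arithmetic in polynomial time -/

theorem mul {f g : α → ℕ} (hf : PolyOn D f) (hg : PolyOn D g) : PolyOn D fun a => f a * g a := by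
  have key : ∀ (b : ℕ) (p : List Unit) (s : ℕ), p.foldl (fun s _ => s + b) s =
      s + p.length * b := by
    intro b p
    induction p with
    | nil => simp
    | cons _ p ih => intro s; rw [List.foldl_cons, ih, List.length_cons]; ring
  refine (foldl (E := fun x => D x.1) (g := fun a => 2 * (sz (f a) * sz (g a)) + 1)
    (i := fun _ => 0) (step := fun a s _ => s + g a) hf.replicate zero
    (PolyOn.id.snd.fst.add hg.ctx) (fun _ _ _ _ h _ => h)
    (((PolyBdd.const 2).mul (hf.sz_bdd.mul hg.sz_bdd)).add (.const 1)) ?_).congr ?_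
  · intro a p q _ h
    rw [key, sz_nat, sz_nat, sz_nat]
    have h1 := congrArg List.length h
    rw [List.length_replicate, List.length_append] at h1
    have h2 : p.length * g a ≤ (2 * f a + 1) * (2 * g a + 1) := Nat.mul_le_mul (by omega) (by omega)
    omega
  · intro a _
    simp only [key, List.length_replicate, zero_add]

theorem inc {l : α → List Bool} (hl : PolyOn D l) : PolyOn D fun a => inc (l a) := by
  have key : ∀ q : List Bool, q.foldr (fun b s => (b :: s.1, if b = true then false :: s.2
      else true :: s.1)) ([], [true]) = (q, VCKernel.inc q) := by
    intro q
    induction q with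
    | nil => rfl
    | cons b q ih => rw [List.foldr_cons, ih]; rfl
  refine ((foldr (σ := List Bool × List Bool) (E := fun _ => True) (g := fun a => 8 * sz (l a) + 7)
    (i := fun _ => ([], [true])) (step := fun _ b s => (b :: s.1, if b = true then false :: s.2
      else true :: s.1)) hl (const_nil.pair ((const_bool true).cons const_nil)) ?_
    (fun _ _ _ _ _ _ => trivial) (((PolyBdd.const 8).mul hl.sz_bdd).add (.const 7)) ?_).snd).congr ?_
  · exact (PolyOn.id.snd.snd.cons PolyOn.id.snd.fst.fst).pair (PolyOn.id.snd.snd.ite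
      ((const_bool false).cons PolyOn.id.snd.fst.snd) ((const_bool true).cons PolyOn.id.snd.fst.fst))
  · intro a p q _ h
    rw [key, sz_prod]
    have h1 := sz_bools_le q
    have h2 := sz_bools_le (VCKernel.inc q)
    have h3 := length_inc_le q
    have h4 := length_le_sz q
    have h5 := (sz_le_of_eq_append h).2
    omega
  · intro a _
    simp only [key]

theorem dec {l : α → List Bool} (hl : PolyOn D l) : PolyOn D fun a => dec (l a) := by
  have key : ∀ q : List Bool, q.foldr (fun b s => (b :: s.1, if b = true then
      (if s.1.isEmpty = true then [] else false :: s.1) else true :: s.2)) ([], []) =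
      (q, VCKernel.dec q) := by
    intro q
    induction q with
    | nil => rfl
    | cons b q ih => rw [List.foldr_cons, ih]; rfl
  refine ((foldr (σ := List Bool × List Bool) (E := fun _ => True) (g := fun a => 8 * sz (l a) + 7)
    (i := fun _ => ([], [])) (step := fun _ b s => (b :: s.1, if b = true then
      (if s.1.isEmpty = true then [] else false :: s.1) else true :: s.2)) hl
    (const_nil.pair const_nil) ?_
    (fun _ _ _ _ _ _ => trivial) (((PolyBdd.const 8).mul hl.sz_bdd).add (.const 7)) ?_).snd).congr ?_
  · exact (PolyOn.id.snd.snd.cons PolyOn.id.snd.fst.fst).pair (PolyOn.id.snd.snd.ite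
      (PolyOn.id.snd.fst.fst.isEmpty.ite const_nil ((const_bool false).cons PolyOn.id.snd.fst.fst))
      ((const_bool true).cons PolyOn.id.snd.fst.snd))
  · intro a p q _ h
    rw [key, sz_prod]
    have h1 := sz_bools_le q
    have h2 := sz_bools_le (VCKernel.dec q)
    have h3 := length_dec_le q
    have h4 := length_le_sz q
    have h5 := (sz_le_of_eq_append h).2
    omega
  · intro a _
    simp only [key]

theorem intPred {f : α → Bool × List Bool} (hf : PolyOn D f) :
    PolyOn D fun a => intPred (f a) :=
  hf.fst.ite ((const_bool true).pair (hf.weaken fun _ h => h.1).snd.inc)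
    ((hf.weaken fun _ h => h.1).snd.isEmpty.ite
      ((const_bool true).pair ((const_bool true).cons const_nil))
      ((const_bool false).pair (hf.weaken fun _ h => h.1.1).snd.dec))

theorem intSub {f : α → Bool × List Bool} {g : α → ℕ} (hf : PolyOn D f) (hg : PolyOn D g) :
    PolyOn D fun a => intSub (f a) (g a) := by
  have key : ∀ (p : List Unit) (x : Bool × List Bool),
      (p.foldl (fun y _ => VCKernel.intPred y) x).2.length ≤ x.2.length + p.length := by
    intro p
    induction p with
    | nil => intro x; simp
    | cons _ p ih =>
      intro x
      have h1 : (VCKernel.intPred x).2.length ≤ x.2.length + 1 := by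
        unfold VCKernel.intPred
        split_ifs
        · exact length_inc_le _
        · simp
        · exact (length_dec_le _).trans (Nat.le_succ _)
      have h2 := ih (VCKernel.intPred x)
      rw [List.foldl_cons, List.length_cons]
      omega
  refine foldl (E := fun _ => True) (g := fun a => 4 * (sz (f a) + sz (g a)) + 5)
    (step := fun _ y _ => VCKernel.intPred y) hg.replicate hf PolyOn.id.snd.fst.intPred
    (fun _ _ _ _ _ _ => trivial)
    (((PolyBdd.const 4).mul (hf.sz_bdd.add hg.sz_bdd)).add (.const 5)) ?_
  intro a p q _ h
  have h1 := key p (f a)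
  generalize p.foldl (fun y _ => VCKernel.intPred y) (f a) = y at h1
  obtain ⟨b, l⟩ := y
  have h2 := congrArg List.length h
  rw [List.length_replicate, List.length_append] at h2
  have h3 := sz_bools_le l
  have h4 := sz_bool b
  have h5 := length_le_sz (f a).2
  have h6 : sz (f a).2 ≤ sz (f a) := by
    have := sz_prod (f a).1 (f a).2
    have e : ((f a).1, (f a).2) = f a := rfl
    rw [e] at this
    omega
  rw [sz_prod, sz_nat]
  simp only at h1
  omega

theorem vcOpt {vc : List (List Bool) → List Bool → Bool} {E : List (List Bool) × List Bool → Prop}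
    (hvc : PolyOn E fun x => vc x.1 x.2) {M : α → List (List Bool)} (hM : PolyOn D M)
    (hE : ∀ a j, D a → E (M a, Nat.bits j)) : PolyOn D fun a => vcOpt vc (M a) := by
  have key : ∀ a (p : List (List Bool)), ∃ c ≤ p.length,
      p.foldl (fun s _ => if vc (M a) s.1 = true then (VCKernel.inc s.1, s.2)
        else (VCKernel.inc s.1, s.2 + 1)) (([] : List Bool), 0) = (Nat.bits p.length, c) := by
    intro a p
    induction p using List.reverseRecOn with
    | nil => exact ⟨0, le_rfl, by simp⟩
    | append_singleton p b ih =>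
      obtain ⟨c, hc, e⟩ := ih
      rw [List.foldl_append, e, List.length_append, List.length_singleton, ← inc_bits]
      by_cases h : vc (M a) p.length.bits = true
      · exact ⟨c, by omega, by simp [h]⟩
      · exact ⟨c + 1, by omega, by simp [h]⟩
  refine (foldl (σ := List Bool × ℕ) (E := fun x => E (M x.1, x.2.1.1) ∧ D x.1)
    (g := fun a => 6 * sz (M a) + 3) (i := fun _ => ([], 0))
    (step := fun a s _ => if vc (M a) s.1 = true then (VCKernel.inc s.1, s.2)
        else (VCKernel.inc s.1, s.2 + 1)) hM (const_nil.pair zero) ?_ ?_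
    (((PolyBdd.const 6).mul hM.sz_bdd).add (.const 3)) ?_).snd
  · refine ite (hvc.comp (((hM.ctx).weaken fun _ h => h.2).pair PolyOn.id.snd.fst.fst)
      fun _ h => h.1) ?_ ?_
    · exact PolyOn.id.snd.fst.fst.inc.pair PolyOn.id.snd.fst.snd
    · exact PolyOn.id.snd.fst.fst.inc.pair PolyOn.id.snd.fst.snd.succ
  · intro a p b r ha _
    obtain ⟨c, _, e⟩ := key a p
    rw [e]
    exact ⟨hE a _ ha, ha⟩
  · intro a p r _ h
    obtain ⟨c, hc, e⟩ := key a p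
    rw [e, sz_prod, sz_nat]
    have h1 := sz_bools_le p.length.bits
    have h2 := length_bits_le p.length
    have h3 := length_le_sz p
    have h4 := (sz_le_of_eq_append h).1
    omega

/-! ### The auction in polynomial time -/

section Auction

variable {adj : α → γ → ι → Bool} {E : α × γ × ι → Prop} {L n : α → ℕ}

theorem pick (hadj : PolyOn E fun x => adj x.1 x.2.1 x.2.2) {z : α → γ}
    {I : α → List (Item γ ι)} (hL : PolyOn D L) (hz : PolyOn D z) (hI : PolyOn D I)
    (hE : ∀ a x, D a → x ∈ I a → E (a, z a, x.1)) :
    PolyOn D fun a => pick (adj a) (L a) (z a) (I a) := by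
  have hstep : PolyOn
      (fun y : α × (Option (Item γ ι) × List (Item γ ι)) × Item γ ι => D y.1 ∧ y.2.2 ∈ I y.1)
      fun y => pickStep (adj y.1) (L y.1) (z y.1) y.2.1 y.2.2 := by
    have hbest : PolyOn
        (fun y : α × (Option (Item γ ι) × List (Item γ ι)) × Item γ ι => D y.1 ∧ y.2.2 ∈ I y.1)
        fun y => y.2.1.1.elim true fun w => decide (y.2.2.2.1 < w.2.1) := by
      refine option_cases (E := fun _ => True) (l := fun y => y.2.1.1) (f := fun _ => true)
        (g := fun y w => decide (y.2.2.2.1 < w.2.1)) PolyOn.id.snd.fst.fst (const_bool true)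
        (PolyOn.id.fst.snd.snd.snd.fst.lt PolyOn.id.snd.snd.fst) (fun _ _ _ _ => trivial) ?_ ?_
      · intro y _ h; rw [h]; rfl
      · intro y w _ h; rw [h]; rfl
    refine ite ?_ (PolyOn.id.snd.snd.some.pair (PolyOn.id.snd.fst.fst.toList.append
      PolyOn.id.snd.fst.snd)) (PolyOn.id.snd.fst.fst.pair (PolyOn.id.snd.snd.cons
      PolyOn.id.snd.fst.snd))
    refine (hadj.comp (PolyOn.id.fst.pair ((hz.ctx.weaken fun _ h => h.1).pair
      PolyOn.id.snd.snd.fst)) fun y h => hE y.1 y.2.2 h.1 h.2).and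
      ((PolyOn.id.snd.snd.snd.fst.lt (hL.ctx.weaken fun _ h => h.1)).and hbest)
  refine foldl (E := fun y => D y.1 ∧ y.2.2 ∈ I y.1) (g := fun a => sz (I a) + 2)
    (i := fun _ => (none, [])) (step := fun a s x => pickStep (adj a) (L a) (z a) s x)
    hI (const_none.pair const_nil) hstep (fun a p x r ha h => ⟨ha, by simp [h]⟩)
    (hI.sz_bdd.add (.const 2)) ?_
  intro a p r _ h
  have h1 := (pick_spec (adj := adj a) (L := L a) (z a) p).1
  change sz (VCKernel.pick (adj a) (L a) (z a) p) ≤ _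
  generalize VCKernel.pick (adj a) (L a) (z a) p = s at h1
  obtain ⟨b, q⟩ := s
  have h2 := sz_perm h1
  have h3 := sz_append b.toList q
  have h4 := (sz_le_of_eq_append h).1
  simp only at h2
  rw [sz_toList] at h3
  rw [sz_prod]
  omega

theorem auctionStep (hadj : PolyOn E fun x => adj x.1 x.2.1 x.2.2)
    {s : α → List γ × List (Item γ ι)} (hL : PolyOn D L) (hs : PolyOn D s)
    (hE : ∀ a z x, D a → z ∈ (s a).1 → x ∈ (s a).2 → E (a, z, x.1)) :
    PolyOn D fun a => auctionStep (adj a) (L a) (s a) := by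
  let F : α × γ × List γ → Prop := fun y => D y.1 ∧ (s y.1).1 = y.2.1 :: y.2.2
  let adj' : α × γ × List γ → γ → ι → Bool := fun y => adj y.1
  have hp : PolyOn F fun y => VCKernel.pick (adj' y) (L y.1) y.2.1 (s y.1).2 := by
    refine pick (adj := adj') (E := fun x => E (x.1.1, x.2.1, x.2.2)) (L := fun y => L y.1)
      (z := fun y => y.2.1) (I := fun y => (s y.1).2)
      (hadj.comp (PolyOn.id.fst.fst.pair PolyOn.id.snd) fun _ h => h)
      (hL.ctx.weaken fun _ h => h.1) PolyOn.id.snd.fst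
      (hs.snd.ctx.weaken fun _ h => h.1) ?_
    rintro y x ⟨h1, h2⟩ hx
    exact hE y.1 y.2.1 x h1 (by rw [h2]; simp) hx
  have hcons : PolyOn F fun y => (VCKernel.pick (adj y.1) (L y.1) y.2.1 (s y.1).2).1.elim
      (y.2.2, (s y.1).2) fun x => (x.2.2.toList ++ y.2.2, (x.1, x.2.1 + 1, Option.some y.2.1) ::
        (VCKernel.pick (adj y.1) (L y.1) y.2.1 (s y.1).2).2) := by
    refine option_cases (E := fun x => F x.1) (f := fun y => (y.2.2, (s y.1).2))
      (g := fun y x => (x.2.2.toList ++ y.2.2, (x.1, x.2.1 + 1, Option.some y.2.1) ::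
        (VCKernel.pick (adj y.1) (L y.1) y.2.1 (s y.1).2).2)) hp.fst
      (PolyOn.id.snd.snd.pair (hs.snd.ctx.weaken fun _ h => h.1.1)) ?_ (fun _ _ h _ => h) ?_ ?_
    · exact (PolyOn.id.snd.snd.snd.toList.append PolyOn.id.fst.snd.snd).pair
        ((PolyOn.id.snd.fst.pair (PolyOn.id.snd.snd.fst.succ.pair PolyOn.id.fst.snd.fst.some)).cons
          hp.snd.ctx)
    · intro y _ h
      simp only [adj'] at h
      rw [h]; rfl
    · intro y x _ h
      simp only [adj'] at h
      rw [h]; rfl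
  refine list_cases (E := F) (l := fun a => (s a).1) (f := s)
    (g := fun a z Q => (VCKernel.pick (adj a) (L a) z (s a).2).1.elim
      (Q, (s a).2) fun x => (x.2.2.toList ++ Q, (x.1, x.2.1 + 1, Option.some z) ::
        (VCKernel.pick (adj a) (L a) z (s a).2).2)) hs.fst (hs.weaken fun _ h => h.1)
    hcons (fun a b m ha h => ⟨ha, h⟩) ?_ ?_
  · intro a _ h
    unfold VCKernel.auctionStep
    rw [h]
  · intro a z Q _ h
    unfold VCKernel.auctionStep
    rw [h]

theorem auction (hadj : PolyOn E fun x => adj x.1 x.2.1 x.2.2) {cs : α → List γ}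
    {is : α → List ι} (hL : PolyOn D L) (hn : PolyOn D n) (hcs : PolyOn D cs) (his : PolyOn D is)
    (hE : ∀ a z i, D a → z ∈ cs a → i ∈ is a → E (a, z, i)) (hnd : ∀ a, D a → (cs a).Nodup) :
    PolyOn D fun a => auction (adj a) (L a) (n a) (cs a) (is a) := by
  let F : α × (List γ × List (Item γ ι)) × Unit → Prop := fun y =>
    D y.1 ∧ AuctionInv (adj y.1) (L y.1) (cs y.1) (is y.1) y.2.1
  have hstep : PolyOn F fun y => VCKernel.auctionStep (adj y.1) (L y.1) y.2.1 := by
    refine auctionStep (adj := fun y : α × (List γ × List (Item γ ι)) × Unit => adj y.1)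
      (L := fun y => L y.1) (E := fun x => E (x.1.1, x.2.1, x.2.2))
      (hadj.comp (PolyOn.id.fst.fst.pair PolyOn.id.snd) fun _ h => h)
      (hL.ctx.weaken fun _ h => h.1) PolyOn.id.snd.fst ?_
    rintro y z x ⟨h1, h2⟩ hz hx
    exact hE y.1 z x.1 h1 (h2.mem z (List.mem_append_left _ hz))
      (h2.perm.subset (List.mem_map_of_mem hx))
  have hinit : PolyOn D fun a => (cs a, (is a).map fun i => ((i, 0, none) : Item γ ι)) :=
    hcs.pair (his.map (f := fun _ i => ((i, 0, none) : Item γ ι)) (E := fun _ => True)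
      (PolyOn.id.snd.pair (zero.pair const_none)) fun _ _ _ _ => trivial)
  have hinv : ∀ a p r, D a → List.replicate (n a) () = p ++ r →
      AuctionInv (adj a) (L a) (cs a) (is a) (p.foldl
        (fun s _ => VCKernel.auctionStep (adj a) (L a) s)
        (cs a, (is a).map fun i => ((i, 0, none) : Item γ ι))) := by
    intro a p r ha _
    have h1 := auction_inv (adj := adj a) (L := L a) (hnd a ha) (is a) p.length
    unfold VCKernel.auction at h1
    have hp : List.replicate p.length () = p :=
      (List.eq_replicate_of_mem fun _ _ => rfl).symm
    rwa [hp] at h1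
  let B : α → ℕ := fun a => sz (cs a) + sz (is a) + sz (L a) + 4
  have hB : PolyBdd D B := ((hcs.sz_bdd.add his.sz_bdd).add hL.sz_bdd).add (.const 4)
  refine foldl (E := F) (g := fun a => B a * (B a + 1) + 1 + (B a * (B a + 1) + 1) + 1)
    (step := fun a s _ => VCKernel.auctionStep (adj a) (L a) s) hn.replicate hinit hstep
    (fun a p b r ha h => ⟨ha, hinv a p (b :: r) ha h⟩)
    ((((hB.mul (hB.add (.const 1))).add (.const 1)).add
      ((hB.mul (hB.add (.const 1))).add (.const 1))).add (.const 1)) ?_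
  intro a p r ha h
  have h1 := hinv a p r ha h
  generalize p.foldl (fun s _ => VCKernel.auctionStep (adj a) (L a) s)
    (cs a, (is a).map fun i => ((i, 0, none) : Item γ ι)) = s at h1
  obtain ⟨Q, I⟩ := s
  have hQ : sz Q ≤ B a * (B a + 1) + 1 := by
    refine (sz_le_of_forall Q (B a) fun z hz => ?_).trans ?_
    · have := sz_le_of_mem (h1.mem z (List.mem_append_left _ hz))
      simp only [B]; omega
    · have h2 : Q.Nodup := (List.nodup_append'.1 h1.nodup).1
      have h3 : Q.length ≤ (cs a).length :=
        (h2.subperm fun z hz => h1.mem z (List.mem_append_left _ hz)).length_le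
      have h4 := length_le_sz (cs a)
      have h5 : Q.length ≤ B a := by simp only [B]; omega
      gcongr
  have hI : sz I ≤ B a * (B a + 1) + 1 := by
    refine (sz_le_of_forall I (B a) fun x hx => ?_).trans ?_
    · obtain ⟨i, p, o⟩ := x
      have h2 : sz i ≤ sz (is a) := sz_le_of_mem (h1.perm.subset (List.mem_map_of_mem hx))
      have h3 : p ≤ L a := (h1.price _ hx).1
      have h4 : sz o ≤ sz (cs a) + 2 := by
        cases o with
        | none => rw [sz_none]; omega
        | some z =>
          have := sz_le_of_mem (h1.mem z (List.mem_append_right _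
            (List.mem_filterMap.2 ⟨_, hx, rfl⟩)))
          rw [sz_some]; omega
      have h5 := sz_nat p
      have h6 := sz_nat (L a)
      simp only [B, sz_prod]
      omega
    · have h3 := h1.perm.length_eq
      rw [List.length_map] at h3
      simp only at h3
      have h4 := length_le_sz (is a)
      have h5 : I.length ≤ B a := by simp only [B]; omega
      gcongr
  rw [sz_prod]
  omega

end Auction

end PolyOn

end VCKernel

namespace VCKernel

open TreeCode

/-! ### Vertex Cover as a subroutine -/

theorem bits_injective : Function.Injective Nat.bits := fun m n h => by
  rw [← Nat.ofDigits_digits 2 m, ← Nat.ofDigits_digits 2 n, Nat.digits_two_eq_bits,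
    Nat.digits_two_eq_bits, h]

/-- The inputs of Vertex Cover on a class. -/
def VCInput (C : GraphClass) (x : List (List Bool) × List Bool) : Prop :=
  ∃ (n : ℕ) (G : SimpleGraph (Fin n)) (k : ℕ), C.Mem G ∧ x = (mat G, k.bits)

theorem eq_of_mat_eq {n m : ℕ} {G : SimpleGraph (Fin n)} {H : SimpleGraph (Fin m)}
    (h : mat G = mat H) : opt G = opt H := by
  have hn : n = m := by rw [← length_mat G, h, length_mat]
  subst hn
  rw [mat_injective h]

/-- A decision procedure for Vertex Cover on the class, as a function on matrices. -/
theorem GraphClass.VCPolyTime.exists_decision {C : GraphClass} (h : C.VCPolyTime) :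
    ∃ vc : List (List Bool) → List Bool → Bool, PolyOn (VCInput C) (fun x => vc x.1 x.2) ∧
      ∀ {n : ℕ} (G : SimpleGraph (Fin n)) (k : ℕ), C.Mem G →
        (vc (mat G) k.bits = true ↔ opt G ≤ k) := by
  classical
  obtain ⟨p, q, hp⟩ := h
  let vc : List (List Bool) → List Bool → Bool := fun M b =>
    decide (∃ (n : ℕ) (G : SimpleGraph (Fin n)) (k : ℕ), M = mat G ∧ b = k.bits ∧ opt G ≤ k)
  have hvc : ∀ {n : ℕ} (G : SimpleGraph (Fin n)) (k : ℕ),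
      (vc (mat G) k.bits = true ↔ opt G ≤ k) := by
    intro n G k
    simp only [vc, decide_eq_true_eq]
    constructor
    · rintro ⟨m, H, l, h1, h2, h3⟩
      rwa [eq_of_mat_eq h1, bits_injective h2]
    · intro h
      exact ⟨n, G, k, rfl, rfl, h⟩
  refine ⟨vc, ⟨.seq p (.ite .reg (.assign (.cons .nil .nil)) (.assign .nil)),
    fun x => 2 * q.eval (sz x) + sz x + 10,
    ((((PolyBdd.const 2).mul (PolyBdd.id.eval q)).add .id).add (.const 10)), ?_⟩,
    fun G k _ => hvc G k⟩
  rintro _ ⟨n, G, k, hG, rfl⟩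
  obtain ⟨b, t, hr, ht, hb⟩ := hp ⟨n, G, k⟩ hG
  have henc : enc (mat G, k.bits) = .cons (encGraph G) (encNat k) := by
    rw [enc_prod, enc_mat]; rfl
  have hsz := hr.size_le
  simp only [← henc] at hr ht hsz
  change b.size ≤ sz (mat G, k.bits) + t at hsz
  change t ≤ q.eval (sz (mat G, k.bits)) at ht
  rw [hasVC_iff, Nat.cast_le, ← hvc] at hb
  simp only at hb ⊢
  cases hv : vc (mat G) k.bits with
  | true =>
    have hb' : Expr.eval b .reg ≠ .nil := hb.2 hv
    refine ⟨_, .seq hr (.ite_true hb' (.assign (.cons .nil .nil) b)), ?_⟩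
    simp only [Expr.cost]
    omega
  | false =>
    have hb' : Expr.eval b .reg = .nil := by
      by_contra hne
      rw [hb.1 hne] at hv
      exact Bool.noConfusion hv
    refine ⟨_, .seq hr (.ite_false hb' (.assign .nil b)), ?_⟩
    simp only [Expr.cost]
    omega

theorem vcOpt_mat {vc : List (List Bool) → List Bool → Bool} {n : ℕ} {G : SimpleGraph (Fin n)}
    (h : ∀ k : ℕ, vc (mat G) k.bits = true ↔ opt G ≤ k) : vcOpt vc (mat G) = opt G := by
  have key : ∀ p : List (List Bool), p.foldl (fun s _ => if vc (mat G) s.1 = true then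
      (inc s.1, s.2) else (inc s.1, s.2 + 1)) (([] : List Bool), 0) =
      (Nat.bits p.length, min p.length (opt G)) := by
    intro p
    induction p using List.reverseRecOn with
    | nil => simp
    | append_singleton p b ih =>
      rw [List.foldl_append, ih, List.length_append, List.length_singleton, ← inc_bits]
      simp only [List.foldl_cons, List.foldl_nil, h]
      split_ifs with hk
      · rw [min_eq_right hk, min_eq_right (by omega)]
      · rw [min_eq_left (by omega), min_eq_left (by omega)]
  have h1 := opt_le_card (G := G)
  rw [Nat.card_fin] at h1
  unfold vcOpt
  rw [key, length_mat, min_eq_right h1]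

/-! ### Tests for blocking sets -/

/-- The minimum vertex covers that contain `Y` are `Y` together with a cover of `G - Y`. -/
theorem isBlocking_iff_opt_del {V : Type} [Finite V] {G : SimpleGraph V} {Y : Set V} :
    IsBlocking G Y ↔ opt G < opt (del G Y) + Y.ncard := by
  rw [← not_iff_not, not_isBlocking_iff, not_lt]
  constructor
  · rintro ⟨S, h1, h2, h3⟩
    have h4 := opt_le_of_coversOn (delEmb G Y) (S := S) fun u v _ _ h => h1 h
    rw [range_delEmb] at h4
    have h5 := Set.ncard_inter_add_ncard_sdiff_eq_ncard S Y
    rw [Set.inter_eq_right.2 h3, Set.sdiff_eq] at h5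
    omega
  · intro h
    obtain ⟨S, h1, h2⟩ := exists_opt (del G Y)
    have h3 := coversOn_image (delEmb G Y) h1
    rw [range_delEmb] at h3
    have hS : G.IsVertexCover (Y ∪ delEmb G Y '' S) := by
      intro u v huv
      by_cases hu : u ∈ Y
      · exact Or.inl (Or.inl hu)
      by_cases hv : v ∈ Y
      · exact Or.inr (Or.inl hv)
      exact (h3 hu hv huv).imp Or.inr Or.inr
    refine ⟨_, hS, le_antisymm ?_ (opt_le hS), Set.subset_union_left⟩
    refine (Set.ncard_union_le _ _).trans ?_
    rw [Set.ncard_image_of_injective _ (delEmb G Y).injective, h2]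
    omega

/-- The graph `G` with an additional vertex `0` that is adjacent to the vertices in `Y`. -/
def addVertex {n : ℕ} (G : SimpleGraph (Fin n)) (Y : Set (Fin n)) : SimpleGraph (Fin (n + 1)) where
  Adj i j := Fin.cases (motive := fun _ => Prop)
    (Fin.cases (motive := fun _ => Prop) False (fun b => b ∈ Y) j)
    (fun a => Fin.cases (motive := fun _ => Prop) (a ∈ Y) (fun b => G.Adj a b) j) i
  symm := by
    refine ⟨fun i j h => ?_⟩
    cases i using Fin.cases <;> cases j using Fin.cases
    · exact h
    · exact h
    · exact h
    · exact G.adj_symm h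
  loopless := by
    refine ⟨fun i h => ?_⟩
    cases i using Fin.cases
    · exact h
    · exact G.loopless.irrefl _ h

/-- The inclusion of `G` into the graph with the additional vertex. -/
def addVertexEmb {n : ℕ} (G : SimpleGraph (Fin n)) (Y : Set (Fin n)) : G ↪g addVertex G Y where
  toFun := Fin.succ
  inj' := Fin.succ_injective n
  map_rel_iff' := Iff.rfl

theorem range_addVertexEmb {n : ℕ} (G : SimpleGraph (Fin n)) (Y : Set (Fin n)) :
    Set.range (addVertexEmb G Y) = {0}ᶜ := Fin.range_succ n

theorem GraphClass.addVertex_mem {C : GraphClass} {n : ℕ} {G : SimpleGraph (Fin n)}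
    (hG : C.Mem G) (Y : Set (Fin n)) : (C.plus 1).Mem (addVertex G Y) := by
  refine ⟨{0}, by simp, C.iso (nonempty_iso_of_range_eq (addVertexEmb G Y)
    (delEmb (addVertex G Y) {0}) ?_) hG⟩
  rw [range_addVertexEmb, range_delEmb]

theorem isBlocking_iff_opt_addVertex {n : ℕ} {G : SimpleGraph (Fin n)} {Y : Set (Fin n)} :
    IsBlocking G Y ↔ opt G < opt (addVertex G Y) := by
  rw [← not_iff_not, not_isBlocking_iff, not_lt]
  constructor
  · rintro ⟨S, h1, h2, h3⟩
    rw [← h2, ← Set.ncard_image_of_injective S (Fin.succ_injective n)]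
    refine opt_le fun i j hij => ?_
    cases i using Fin.cases with
    | zero =>
      cases j using Fin.cases with
      | zero => exact (SimpleGraph.irrefl _ hij).elim
      | succ b => exact Or.inr ⟨b, h3 hij, rfl⟩
    | succ a =>
      cases j using Fin.cases with
      | zero => exact Or.inl ⟨a, h3 hij, rfl⟩
      | succ b => exact (h1 (v := a) (w := b) hij).imp (fun h => ⟨a, h, rfl⟩) fun h => ⟨b, h, rfl⟩
  · intro h
    obtain ⟨S, h1, h2⟩ := exists_opt (addVertex G Y)
    have hS : G.IsVertexCover (Fin.succ ⁻¹' S) := fun a b hab =>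
      h1 (v := Fin.succ a) (w := Fin.succ b) hab
    have h3 := opt_le hS
    have h4 : (Fin.succ ⁻¹' S).ncard = (S \ {0}).ncard := by
      rw [← Set.ncard_image_of_injective _ (Fin.succ_injective n), Set.image_preimage_eq_inter_range,
        Fin.range_succ]
      rfl
    by_cases h0 : (0 : Fin (n + 1)) ∈ S
    · have := Set.ncard_sdiff_singleton_lt_of_mem h0
      omega
    · rw [Set.sdiff_singleton_eq_self h0] at h4
      exact ⟨_, hS, by omega, fun y hy => (h1 (v := 0) (w := Fin.succ y) hy).resolve_left h0⟩

/-- The matrix of the graph with an additional vertex. -/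
def addVertexMat (M : List (List Bool)) (Y : List Bool) : List (List Bool) :=
  (false :: Y) :: (Y.zip M).map fun p => p.1 :: p.2

theorem addVertexMat_mat {n : ℕ} (G : SimpleGraph (Fin n)) (Y : Set (Fin n)) :
    addVertexMat (mat G) (row Y) = mat (addVertex G Y) := by
  have hrow : ∀ T : Set (Fin (n + 1)), ∀ b : Bool, (b = true ↔ 0 ∈ T) →
      row T = b :: row (Fin.succ ⁻¹' T) := by
    intro T b hb
    unfold row
    rw [List.finRange_succ, List.map_cons, List.map_map]
    congr 1
    by_cases h : (0 : Fin (n + 1)) ∈ T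
    · simp [h, hb.2 h]
    · have : b = false := by simpa using mt hb.1 h
      simp [h, this]
  classical
  have h1 : mat (addVertex G Y) = row ((addVertex G Y).neighborSet 0) ::
      (List.finRange n).map fun i => row ((addVertex G Y).neighborSet i.succ) := by
    unfold mat
    rw [List.finRange_succ, List.map_cons, List.map_map]
    rfl
  rw [h1]
  unfold addVertexMat
  congr 1
  · rw [hrow _ false (by simp)]
    rfl
  · unfold mat
    conv_lhs => rw [row]
    rw [zip_finRange, List.map_map]
    refine List.map_congr_left fun i _ => ?_
    rw [hrow ((addVertex G Y).neighborSet i.succ) (decide (i ∈ Y)) (by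
      exact decide_eq_true_iff)]
    rfl

/-- A polynomial-time test for blocking sets of graphs in the class. -/
def GraphClass.BlockingTest (C : GraphClass) (bt : List (List Bool) → List Bool → Bool) : Prop :=
  PolyOn (fun x : List (List Bool) × List Bool =>
      ∃ (n : ℕ) (G : SimpleGraph (Fin n)) (Y : Set (Fin n)), C.Mem G ∧ x = (mat G, row Y))
    (fun x => bt x.1 x.2) ∧
  ∀ {n : ℕ} (G : SimpleGraph (Fin n)) (Y : Set (Fin n)), C.Mem G →
    (bt (mat G) (row Y) = true ↔ IsBlocking G Y)

/-- In a hereditary class, blocking sets are recognized with Vertex Cover on the class, since it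
contains `G - Y` together with `G`. -/
theorem GraphClass.Hereditary.exists_blockingTest {C : GraphClass} (hC : C.Hereditary)
    (h : C.VCPolyTime) : ∃ bt, C.BlockingTest bt := by
  obtain ⟨vc, hvc, hspec⟩ := h.exists_decision
  have hmem : ∀ {n : ℕ} {G : SimpleGraph (Fin n)} (S : Set (Fin n)), C.Mem G →
      C.Mem (subgr G S) := fun S hG => hC.mem_of_embedding (subEmb _ S) hG
  refine ⟨fun M Y => decide (vcOpt vc M < vcOpt vc (induceMat (rowNot Y) M) + count Y), ?_, ?_⟩
  · refine (PolyOn.vcOpt hvc PolyOn.id.fst ?_).lt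
      ((PolyOn.vcOpt hvc (PolyOn.id.snd.rowNot.induceMat PolyOn.id.fst) ?_).add PolyOn.id.snd.count)
    · rintro _ j ⟨n, G, Y, hG, rfl⟩
      exact ⟨n, G, j, hG, rfl⟩
    · rintro _ j ⟨n, G, Y, hG, rfl⟩
      refine ⟨_, subgr G Yᶜ, j, hmem _ hG, ?_⟩
      simp only
      rw [rowNot_row, induceMat_row]
  · intro n G Y hG
    rw [decide_eq_true_iff, rowNot_row, induceMat_row, count_row,
      vcOpt_mat fun k => hspec G k hG, vcOpt_mat fun k => hspec _ k (hmem _ hG),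
      isBlocking_iff_opt_del, opt_congr (nonempty_iso_of_range_eq (subEmb G Yᶜ) (delEmb G Y) ?_)]
    rw [range_subEmb, range_delEmb]

/-- In general `G - Y` may lie outside of the class, but a new vertex with neighbourhood `Y` leads only
to `C + 1`. -/
theorem GraphClass.exists_blockingTest_of_plus {C : GraphClass}
    (h : C.VCPolyTime) (h' : (C.plus 1).VCPolyTime) : ∃ bt, C.BlockingTest bt := by
  obtain ⟨vc, hvc, hspec⟩ := h.exists_decision
  obtain ⟨vc', hvc', hspec'⟩ := h'.exists_decision
  refine ⟨fun M Y => decide (vcOpt vc M < vcOpt vc' (addVertexMat M Y)), ?_, ?_⟩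
  · have hadd : PolyOn (fun x : List (List Bool) × List Bool =>
        ∃ (n : ℕ) (G : SimpleGraph (Fin n)) (Y : Set (Fin n)), C.Mem G ∧ x = (mat G, row Y))
        fun x => addVertexMat x.1 x.2 :=
      ((PolyOn.const_bool false).cons PolyOn.id.snd).cons
        ((PolyOn.id.snd.zip PolyOn.id.fst).map (f := fun _ (p : Bool × List Bool) => p.1 :: p.2)
          (E := fun _ => True) (PolyOn.id.snd.fst.cons PolyOn.id.snd.snd) fun _ _ _ _ => trivial)
    refine (PolyOn.vcOpt hvc PolyOn.id.fst ?_).lt (PolyOn.vcOpt hvc' hadd ?_)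
    · rintro _ j ⟨n, G, Y, hG, rfl⟩
      exact ⟨n, G, j, hG, rfl⟩
    · rintro _ j ⟨n, G, Y, hG, rfl⟩
      refine ⟨_, addVertex G Y, j, C.addVertex_mem hG Y, ?_⟩
      simp only
      rw [addVertexMat_mat]
  · intro n G Y hG
    rw [decide_eq_true_iff, addVertexMat_mat, vcOpt_mat fun k => hspec G k hG,
      vcOpt_mat fun k => hspec' _ k (C.addVertex_mem hG Y), isBlocking_iff_opt_addVertex]

/-! ### The algorithm -/

section Algorithm

variable (d : ℕ) (vc bt : List (List Bool) → List Bool → Bool)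

/-- Instances as data: the adjacency matrix, the number `k` and the characteristic vector of the
modulator. -/
abbrev RawInstance : Type := List (List Bool) × (Bool × List Bool) × List Bool

/-- The instance as data. -/
noncomputable def Instance.raw (I : Instance) : RawInstance := (mat I.G, intRep I.k, row I.X)

theorem Instance.enc_raw (I : Instance) : TreeCode.enc I.raw = I.enc := by
  unfold Instance.raw Instance.enc
  rw [enc_prod, enc_prod, enc_mat, enc_row, enc_intRep]

/-- Adjacency of a chunk and a component in the bipartite graph. -/
def blocksRow (x : RawInstance) (z h : List Bool) : Bool :=
  bt (induceMat h x.1) (select h (nbr x.1 z))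

/-- The number of steps for which the auction is run. -/
def auctionLength (x : RawInstance) : ℕ :=
  (chunkRows d x.1 x.2.2).length +
    2 * ((compRows x.1 x.2.2).length * ((compRows x.1 x.2.2).length + 1))

/-- The outcome of the auction of the components among the chunks. -/
def runAuction (x : RawInstance) : List (List Bool) × List (Item (List Bool) (List Bool)) :=
  auction (blocksRow bt x) ((compRows x.1 x.2.2).length + 1) (auctionLength d x)
    (chunkRows d x.1 x.2.2) (compRows x.1 x.2.2)

/-- The vertices of the components that nobody has bought, as a union that starts with the empty set
(`X` without `X`, a vector of the right length). -/
def discardRow (x : RawInstance) : List Bool :=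
  (((runAuction d bt x).2.filter fun y => decide (y.2.1 < 1)).map fun y => y.1).foldl rowOr
    (rowAnd x.2.2 (rowNot x.2.2))

/-- The reduction rule as an algorithm. -/
def reduceRaw (x : RawInstance) : RawInstance :=
  (induceMat (rowNot (discardRow d bt x)) x.1,
    intSub x.2.1 (vcOpt vc (induceMat (discardRow d bt x) x.1)),
    select (rowNot (discardRow d bt x)) x.2.2)

variable {d vc bt} {C : GraphClass}

theorem blocksRow_iff (hC : C.ComponentClosed) (hbt : C.BlockingTest bt) {I : Instance}
    (hI : C.Mem (del I.G I.X)) (Z : Set (Fin I.n)) (H : Comp I.G I.X) :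
    (∃ (n : ℕ) (G : SimpleGraph (Fin n)) (Y : Set (Fin n)), C.Mem G ∧
      (induceMat (row (compSet H)) I.raw.1, select (row (compSet H)) (nbr I.raw.1 (row Z))) =
        (mat G, row Y)) ∧
    (blocksRow bt I.raw (row Z) (row (compSet H)) = true ↔ Blocks I.G Z H) := by
  obtain ⟨e, he⟩ := exists_iso_of_range_eq (compEmb H) (subEmb I.G (compSet H))
    (range_subEmb _ _).symm
  have hmem : C.Mem (subgr I.G (compSet H)) := C.iso ⟨e⟩ (hC.toSimpleGraph_mem hI H)
  have h1 : induceMat (row (compSet H)) I.raw.1 = mat (subgr I.G (compSet H)) := induceMat_row _ _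
  have h2 : select (row (compSet H)) (nbr I.raw.1 (row Z)) =
      row (subEmb I.G (compSet H) ⁻¹' {v | ∃ z ∈ Z, I.G.Adj z v}) := by
    change select _ (nbr (mat I.G) _) = _
    rw [nbr_row, select_row_row I.G]
  refine ⟨⟨_, subgr I.G (compSet H), _, hmem, by rw [h1, h2]⟩, ?_⟩
  unfold blocksRow
  rw [h1, h2, hbt.2 _ _ hmem]
  have h3 : subEmb I.G (compSet H) ⁻¹' {v | ∃ z ∈ Z, I.G.Adj z v} =
      e '' {v | ∃ z ∈ Z, I.G.Adj z v.1.1} := by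
    ext a
    constructor
    · rintro ⟨z, hz, hza⟩
      refine ⟨e.symm a, ⟨z, hz, ?_⟩, e.apply_symm_apply a⟩
      have h4 := he (e.symm a)
      rw [e.apply_symm_apply] at h4
      rwa [h4] at hza
    · rintro ⟨b, ⟨z, hz, hzb⟩, rfl⟩
      refine ⟨z, hz, ?_⟩
      rw [he]
      exact hzb
  rw [h3]
  refine ⟨fun h => ?_, fun h => h.iso e⟩
  have h4 := h.iso e.symm
  rw [← Set.image_comp] at h4
  have h5 : (⇑e.symm ∘ ⇑e) = id := funext fun a => e.symm_apply_apply a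
  rwa [h5, Set.image_id] at h4

theorem foldl_rowOr {n : ℕ} (l : List (List Bool)) (S : Set (Fin n))
    (hl : ∀ r ∈ l, ∃ T : Set (Fin n), row T = r) :
    l.foldl rowOr (row S) = row {v | v ∈ S ∨ ∃ T : Set (Fin n), row T ∈ l ∧ v ∈ T} := by
  induction l generalizing S with
  | nil => simp
  | cons r l ih =>
    obtain ⟨T, rfl⟩ := hl r (by simp)
    rw [List.foldl_cons, rowOr_row, ih _ fun r hr => hl r (by simp [hr])]
    congr 1
    ext v
    simp only [Set.mem_union, List.mem_cons]
    constructor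
    · rintro ((h | h) | ⟨T', h1, h2⟩)
      · exact Or.inl h
      · exact Or.inr ⟨T, Or.inl rfl, h⟩
      · exact Or.inr ⟨T', Or.inr h1, h2⟩
    · rintro (h | ⟨T', h1 | h1, h2⟩)
      · exact Or.inl (Or.inl h)
      · rw [row_injective h1] at h2
        exact Or.inl (Or.inr h2)
      · exact Or.inr ⟨T', h1, h2⟩

theorem exists_crown_discardRow (hC : C.ComponentClosed) (hbt : C.BlockingTest bt)
    {I : Instance} (hI : C.Mem (del I.G I.X)) :
    ∃ K : Crown I.G I.X d, discardRow d bt I.raw = row K.verts := by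
  obtain ⟨hcomp, hcompnd⟩ := compRows_spec I.G I.X
  have hinv := auction_inv (adj := blocksRow bt I.raw)
    (L := (compRows (mat I.G) (row I.X)).length + 1)
    (nodup_chunkRows d (mat I.G) (row I.X)) (compRows (mat I.G) (row I.X))
    (auctionLength d I.raw)
  have hQ := auction_queue_eq_nil (adj := blocksRow bt I.raw)
    (L := (compRows (mat I.G) (row I.X)).length + 1)
    (nodup_chunkRows d (mat I.G) (row I.X)) (is := compRows (mat I.G) (row I.X))
    (n := auctionLength d I.raw) le_rfl
  change (runAuction d bt I.raw).1 = [] at hQ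
  change AuctionInv _ _ _ _ (runAuction d bt I.raw) at hinv
  have hdef : discardRow d bt I.raw = ((((runAuction d bt I.raw).2.filter
    fun y => decide (y.2.1 < 1)).map fun y => y.1).foldl rowOr
      (rowAnd (row I.X) (rowNot (row I.X)))) := rfl
  rw [hdef]
  generalize runAuction d bt I.raw = s at hQ hinv
  obtain ⟨Q, items⟩ := s
  simp only at hQ
  subst hQ
  obtain ⟨K, hK⟩ := exists_crown (ofSet := row) (ofComp := fun H : Comp I.G I.X => row (compSet H))
    (d := d) hinv hcompnd (Nat.lt_succ_self _) row_injective.injOn (fun z => mem_chunkRows)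
    (row_injective.comp compSet_injective) hcomp
    (fun Z _ H => (blocksRow_iff hC hbt hI Z H).2)
  refine ⟨K, ?_⟩
  have hitem : ∀ x ∈ items, ∃ H : Comp I.G I.X, row (compSet H) = x.1 := fun x hx =>
    (hcomp _).1 (hinv.perm.subset (List.mem_map_of_mem hx))
  rw [rowNot_row, rowAnd_row, foldl_rowOr]
  · congr 1
    ext v
    rw [K.mem_verts]
    constructor
    · rintro (⟨h1, h2⟩ | ⟨T, hT, hv⟩)
      · exact (h2 h1).elim
      · obtain ⟨x, hx, hxT⟩ := List.mem_map.1 hT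
        obtain ⟨hx1, hx2⟩ := List.mem_filter.1 hx
        obtain ⟨H, hH⟩ := hitem x hx1
        refine ⟨H, (hK x hx1 H hH).2 (Nat.lt_one_iff.1 (of_decide_eq_true hx2)), ?_⟩
        rwa [row_injective (hH.trans hxT)]
    · rintro ⟨H, hH, hv⟩
      have h1 := hinv.perm.symm.subset ((hcomp _).2 ⟨H, rfl⟩)
      obtain ⟨x, hx, hxH⟩ := List.mem_map.1 h1
      refine Or.inr ⟨compSet H, List.mem_map.2 ⟨x, List.mem_filter.2 ⟨hx, ?_⟩, hxH⟩, hv⟩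
      exact decide_eq_true (Nat.lt_one_iff.2 ((hK x hx H hxH.symm).1 hH))
  · intro r hr
    obtain ⟨x, hx, rfl⟩ := List.mem_map.1 hr
    obtain ⟨H, hH⟩ := hitem x (List.mem_filter.1 hx).1
    exact ⟨_, hH⟩

/-- The promise of the algorithm. -/
def Promise (C : GraphClass) (x : RawInstance) : Prop :=
  ∃ I : Instance, C.Mem (del I.G I.X) ∧ x = I.raw

theorem polyOn_blocksRow (hC : C.ComponentClosed) (hbt : C.BlockingTest bt) :
    PolyOn (fun y : RawInstance × List Bool × List Bool => Promise C y.1 ∧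
      y.2.1 ∈ chunkRows d y.1.1 y.1.2.2 ∧ y.2.2 ∈ compRows y.1.1 y.1.2.2)
      fun y => blocksRow bt y.1 y.2.1 y.2.2 := by
  refine hbt.1.comp ((PolyOn.id.snd.snd.induceMat PolyOn.id.fst.fst).pair
    (PolyOn.id.snd.snd.select (PolyOn.id.fst.fst.nbr PolyOn.id.snd.fst))) ?_
  rintro ⟨x, z, h⟩ ⟨⟨I, hI, rfl⟩, hz, hh⟩
  obtain ⟨Z, _, rfl⟩ := mem_chunkRows.1 hz
  obtain ⟨H, rfl⟩ := ((compRows_spec I.G I.X).1 h).1 hh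
  exact (blocksRow_iff hC hbt hI Z H).1

theorem polyOn_discardRow (hC : C.ComponentClosed) (hbt : C.BlockingTest bt) :
    PolyOn (Promise C) fun x => discardRow d bt x := by
  have hcs : PolyOn (Promise C) fun x => chunkRows d x.1 x.2.2 :=
    PolyOn.id.fst.chunkRows d PolyOn.id.snd.snd
  have his : PolyOn (Promise C) fun x => compRows x.1 x.2.2 :=
    PolyOn.id.fst.compRows PolyOn.id.snd.snd
  have hL : PolyOn (Promise C) fun x => (compRows x.1 x.2.2).length + 1 := his.length.succ
  have hn : PolyOn (Promise C) fun x => auctionLength d x :=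
    hcs.length.add ((PolyOn.const_nat 2).mul (his.length.mul hL))
  have hrun : PolyOn (Promise C) fun x => runAuction d bt x :=
    PolyOn.auction (adj := fun x => blocksRow bt x) (polyOn_blocksRow (d := d) hC hbt) hL hn hcs his
      (fun x z h hx hz hh => ⟨hx, hz, hh⟩) fun x _ => nodup_chunkRows _ _ _
  have hrows : PolyOn (Promise C) fun x =>
      (((runAuction d bt x).2.filter fun y => decide (y.2.1 < 1)).map fun y => y.1) :=
    (hrun.snd.filter (f := fun _ (y : Item (List Bool) (List Bool)) => decide (y.2.1 < 1))
      (E := fun _ => True) (PolyOn.id.snd.snd.fst.lt (PolyOn.const_nat 1))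
      fun _ _ _ _ => trivial).map (f := fun _ (y : Item (List Bool) (List Bool)) => y.1)
      (E := fun _ => True) PolyOn.id.snd.fst fun _ _ _ _ => trivial
  have hinit : PolyOn (Promise C) fun x => rowAnd x.2.2 (rowNot x.2.2) :=
    PolyOn.id.snd.snd.rowAnd PolyOn.id.snd.snd.rowNot
  refine PolyOn.foldl (E := fun _ => True)
    (g := fun x => 4 * sz (rowAnd x.2.2 (rowNot x.2.2)) + 1) (step := fun _ s r => rowOr s r) hrows
    hinit (PolyOn.id.snd.fst.rowOr PolyOn.id.snd.snd) (fun _ _ _ _ _ _ => trivial)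
    (((PolyBdd.const 4).mul hinit.sz_bdd).add (.const 1)) ?_
  intro x p _ _ _
  have h1 : ∀ (p : List (List Bool)) (s : List Bool), (p.foldl rowOr s).length ≤ s.length := by
    intro p
    induction p with
    | nil => intro s; exact le_rfl
    | cons b p ih =>
      intro s
      refine (ih _).trans ?_
      unfold rowOr
      rw [List.length_map, List.length_zip]
      exact min_le_left _ _
  have h2 := h1 p (rowAnd x.2.2 (rowNot x.2.2))
  have h3 := length_le_sz (rowAnd x.2.2 (rowNot x.2.2))
  refine (sz_bools_le _).trans ?_
  change 4 * (p.foldl rowOr (rowAnd x.2.2 (rowNot x.2.2))).length + 1 ≤ _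
  omega

theorem subgr_verts_mem (hC : C.ComponentClosed) {I : Instance} (hI : C.Mem (del I.G I.X))
    (K : Crown I.G I.X d) : C.Mem (subgr I.G K.verts) := by
  refine C.iso (nonempty_iso_of_range_eq (induceEmb I.G K.verts) (subEmb I.G K.verts) ?_)
    (K.mem_induce_verts hC hI)
  rw [range_induceEmb, range_subEmb]

/-- With a subroutine for Vertex Cover and a test for blocking sets, the reduction rule can be
applied in polynomial time. -/
theorem GraphClass.ComponentClosed.componentReduction (hC : C.ComponentClosed)
    (hd : C.blockingSize = d) (hvc : C.VCPolyTime) (hbt : ∃ bt, C.BlockingTest bt) :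
    C.ComponentReduction d := by
  obtain ⟨bt, hbt⟩ := hbt
  obtain ⟨vc, hvc, hspec⟩ := hvc.exists_decision
  have hdisc := polyOn_discardRow (d := d) hC hbt
  have hpoly : PolyOn (Promise C) fun x => reduceRaw d vc bt x := by
    refine (hdisc.rowNot.induceMat PolyOn.id.fst).pair ((PolyOn.id.snd.fst.intSub
      (PolyOn.vcOpt hvc (hdisc.induceMat PolyOn.id.fst) ?_)).pair
      (hdisc.rowNot.select PolyOn.id.snd.snd))
    rintro _ j ⟨I, hI, rfl⟩
    obtain ⟨K, hK⟩ := exists_crown_discardRow (d := d) hC hbt hI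
    refine ⟨_, subgr I.G K.verts, j, subgr_verts_mem hC hI K, ?_⟩
    rw [hK]
    exact congrArg (fun M => (M, Nat.bits j)) (induceMat_row I.G K.verts)
  obtain ⟨p, g, ⟨q, hq⟩, hp⟩ := hpoly
  refine ⟨p, q, fun I hI => ?_⟩
  obtain ⟨t, hr, ht⟩ := hp I.raw ⟨I, hI, rfl⟩
  have ht' := ht.trans (hq I.raw ⟨I, hI, rfl⟩)
  rw [I.enc_raw] at hr
  change t ≤ q.eval (enc I.raw).size at ht'
  rw [I.enc_raw] at ht'
  refine ⟨_, t, hr, ht', ?_⟩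
  obtain ⟨K, hK⟩ := exists_crown_discardRow (d := d) hC hbt hI
  have hsav : vcOpt vc (mat (subgr I.G K.verts)) = K.savings := by
    rw [vcOpt_mat fun k => hspec _ k (subgr_verts_mem hC hI K)]
    refine opt_congr (nonempty_iso_of_range_eq (subEmb I.G K.verts) (induceEmb I.G K.verts) ?_)
    rw [range_induceEmb, range_subEmb]
  let J : Instance := ⟨_, subgr I.G K.vertsᶜ, I.k - K.savings, subEmb I.G K.vertsᶜ ⁻¹' I.X⟩
  have hJ : reduceRaw d vc bt I.raw = J.raw := by
    unfold reduceRaw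
    rw [hK, rowNot_row]
    change (induceMat (row K.vertsᶜ) (mat I.G),
      intSub (intRep I.k) (vcOpt vc (induceMat (row K.verts) (mat I.G))),
      select (row K.vertsᶜ) (row I.X)) = _
    rw [induceMat_row, induceMat_row, select_row_row I.G, hsav, intSub_intRep]
    rfl
  have hrange : Set.range (subEmb I.G K.vertsᶜ) = K.vertsᶜ := range_subEmb _ _
  have himage : subEmb I.G K.vertsᶜ '' J.X = I.X := by
    change subEmb I.G K.vertsᶜ '' (subEmb I.G K.vertsᶜ ⁻¹' I.X) = I.X
    rw [Set.image_preimage_eq_inter_range, hrange, Set.inter_eq_left]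
    exact K.subset_compl_verts
  have hrest : Nonempty (K.rest ≃g J.G) :=
    nonempty_iso_of_range_eq (delEmb I.G K.verts) (subEmb I.G K.vertsᶜ)
      (by rw [hrange, range_delEmb])
  have hdel : Nonempty (del K.rest K.restX ≃g del J.G J.X) := by
    refine nonempty_iso_of_range_eq ((delEmb K.rest K.restX).trans (delEmb I.G K.verts))
      ((delEmb J.G J.X).trans (subEmb I.G K.vertsᶜ)) ?_
    ext v
    constructor
    · rintro ⟨⟨⟨v, hv⟩, hX⟩, rfl⟩
      have h1 : v ∈ Set.range (subEmb I.G K.vertsᶜ) := hrange.ge hv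
      obtain ⟨a, rfl⟩ := h1
      exact ⟨⟨a, hX⟩, rfl⟩
    · rintro ⟨⟨a, hX⟩, rfl⟩
      have h1 : subEmb I.G K.vertsᶜ a ∈ K.vertsᶜ := hrange.le ⟨a, rfl⟩
      exact ⟨⟨⟨_, h1⟩, hX⟩, rfl⟩
  refine ⟨J, (congrArg TreeCode.enc hJ).trans J.enc_raw, ⟨K, subEmb I.G K.vertsᶜ, hrange, himage, rfl⟩,
    C.iso hdel (K.mem_rest hC hI), ?_, ?_⟩
  · rw [← K.hasVC_rest_iff hd hC hI, hasVC_iff, hasVC_iff, opt_congr hrest]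
  · obtain ⟨e⟩ := hdel
    rw [← Nat.card_congr e.connectedComponentEquiv]
    exact K.card_comp_rest_le

end Algorithm

end VCKernel

theorem theorem3 (C : VCKernel.GraphClass) (d : ℕ) (hd : C.blockingSize = (d : ℕ∞)) :
    -- hereditary classes
    (C.Hereditary → C.VCPolyTime → C.ComponentReduction d) ∧
    -- robust classes
    (C.Robust → C.VCPolyTime → (C.plus 1).VCPolyTime → C.ComponentReduction d) ∧
    -- the reduction rule is applicable and safe, and leaves few components
    (C.Hereditary ∨ C.Robust →
      ∀ {V : Type} [Finite V] (G : SimpleGraph V) (X : Set V), C.Mem (VCKernel.del G X) →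
        Nonempty (VCKernel.Crown G X d) ∧
        ∀ K : VCKernel.Crown G X d,
          C.Mem (VCKernel.del K.rest K.restX) ∧
          (∀ k : ℤ, VCKernel.HasVC K.rest (k - K.savings) ↔ VCKernel.HasVC G k) ∧
          Nat.card (VCKernel.Comp K.rest K.restX) ≤ X.ncard ^ d) := by
  refine ⟨fun h hvc => VCKernel.GraphClass.ComponentClosed.componentReduction h.componentClosed hd hvc
      (h.exists_blockingTest hvc),
    fun h hvc hvc' => VCKernel.GraphClass.ComponentClosed.componentReduction h.componentClosed hd hvc
      (C.exists_blockingTest_of_plus hvc hvc'), fun h V _ G X hG => ?_⟩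
  have hC : C.ComponentClosed := h.elim (fun h => h.componentClosed) fun h => h.componentClosed
  exact ⟨VCKernel.nonempty_crown G X d, fun K => ⟨K.mem_rest hC hG, K.hasVC_rest_iff hd hC hG,
    K.card_comp_rest_le⟩⟩
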